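/- **Theorem 1.3.** Let $(\mathcal X,d,\mu)$ be a metric space with a Borel measure such that every ball $B(x,r)=\{y:d(x,y)<r\}$, $r>0$, has finite and positive measure. Let $0<\kappa\le n$ and suppose that $\mathcal X$ is an RD-space: there are constants $0<C_1\le 1\le C_2$ such that $$C_1\lambda^{\kappa}\mu(B(x,r))\le\mu(B(x,\lambda r))\le C_2\lambda^{n}\mu(B(x,r))$$ for all $x\in\mathcal X$, $0<r<2\,\mathrm{diam}\,\mathcal X$ and $1\le\lambda<2\,\mathrm{diam}(\mathcal X)/r$. Suppose that $\mu(\mathcal X)=\infty$, fix $x_1\in\mathcal X$, and let $s\in(0,1]$ and $p\in(n/(n+s),\infty)$. Functions are complex-valued (or all real-valued), with $\mathbb K$ the scalar field. *Hajłasz–Sobolev space.* For a function $f$ let $\mathcal D(f)$ be the class of nonnegative Borel functions $g$ for which there is a null set $E$ with $|f(x)-f(y)|\le d(x,y)^s(g(x)+g(y))$ for all $x,y\in\mathcal X\setminus E$. Then $\dot M^{s,p}(\mathcal X)$ is the set of measurable $f\in L^p_{\rm loc}(\mathcal X)$ (in $L^p$ on every ball) such that $\mathcal D(f)\cap L^p(\mathcal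 X)\ne\emptyset$, and $\|f\|_{\dot M^{s,p}}=\inf_{g\in\mathcal D(f)}\|g\|_{L^p}$. *Test functions.* Write $V_r(x)=\mu(B(x,r))$ and $V(x,y)=\mu(B(x,d(x,y)))$. For $x\in\mathcal X$, $r,\gamma>0$ and $\beta\in(0,1]$, the space $\mathcal G(x,r,\beta,\gamma)$ consists of all functions $\varphi:\mathcal X\to\mathbb K$ for which there is $C\ge0$ such that * $|\varphi(y)|\le C\,\frac{1}{V_r(x)+V(x,y)}\left(\frac{r}{r+d(x,y)}\right)^{\gamma}$ for all $y$, and * $|\varphi(y)-\varphi(z)|\le C\left(\frac{d(y,z)}{r+d(x,y)}\right)^{\beta}\frac{1}{V_r(x)+V(x,y)}\left(\frac{r}{r+d(x,y)}\right)^{\gamma}$ whenever $d(y,z)\le (r+d(x,y))/2$; its norm is the infimum of such $C$. Let $\mathcal G(1,2)=\mathcal G(x_1,1,1,2)$, and let $(\mathcal G(1,2))'$ be its dual, the space of bounded linear functionals. For $k\in\mathbb Z$ and $x\in\mathcal X$ let $\mathcal A_k(x)$ be the set of $\varphi\in\mathcal G(1,2)$ with $\int_{\mathcal X}\varphi\,d\mu=0$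 and $\|\varphi\|_{\mathcal G(x,2^{-k},1,2)}\le1$. *Grand Triebel–Lizorkin space.* $\mathcal A\dot F^s_{p,\infty}(\mathcal X)$ is the set of all $\Lambda\in(\mathcal G(1,2))'$ with $$\|\Lambda\|_{\mathcal A\dot F^s_{p,\infty}}=\Big\|\sup_{k\in\mathbb Z}2^{ks}\sup_{\varphi\in\mathcal A_k(\cdot)}|\langle\Lambda,\varphi\rangle|\Big\|_{L^p(\mathcal X)}<\infty .$$ Then $\dot M^{s,p}(\mathcal X)=\mathcal A\dot F^s_{p,\infty}(\mathcal X)$ with equivalent norms, under the identification of a function $f$ with the functional $\Lambda_f:\varphi\mapsto\int_{\mathcal X}f\varphi\,d\mu$ (where $f\varphi$ is required to be integrable for all $\varphi\in\mathcal G(1,2)$). That is: 1. for each $f\in\dot M^{s,p}(\mathcal X)$, the functional $\Lambda_f$ is defined and belongs to $\mathcal A\dot F^s_{p,\infty}(\mathcal X)$; 2. each $\Lambda\in\mathcal A\dot F^s_{p,\infty}(\mathcal X)$ equals $\Lambda_f$ for some $f\in\dot M^{s,p}(\mathcal X)$; 3. if $\Lambda_f$ and $\Lambda_{f'}$ are defined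 and $c\in\mathbb K$, then $\Lambda_f-\Lambda_{f'}=c\int_{\mathcal X}\cdot\,d\mu$ if and only if $f-f'=c$ almost everywhere, so the identification is one-to-one up to null sets, and also after passing to the quotients modulo constants on both sides; 4. there is a constant $C>0$ such that $C^{-1}\|f\|_{\dot M^{s,p}}\le\|\Lambda_f\|_{\mathcal A\dot F^s_{p,\infty}}\le C\|f\|_{\dot M^{s,p}}$ for all $f\in\dot M^{s,p}(\mathcal X)$. -/

import Mathlib

open MeasureTheory Metric
open scoped ENNReal

/-- `(X, d, μ)` is an RD-space with exponents `0 < κ ≤ n`: all balls have finite and positive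
measure, and `C₁ t ^ κ μ(B(x,r)) ≤ μ(B(x,tr)) ≤ C₂ t ^ n μ(B(x,r))` for all `x`, all
`0 < r < 2 diam X` and all `1 ≤ t < 2 diam X / r`, where `0 < C₁ ≤ 1 ≤ C₂`.
The diameter is taken in `[0, ∞]`. -/
structure IsRDSpace {X : Type*} [MetricSpace X] [MeasurableSpace X]
    (μ : Measure X) (κ n : ℝ) : Prop where
  measure_ball_pos : ∀ (x : X) (r : ℝ), 0 < r → 0 < μ (ball x r)
  measure_ball_lt_top : ∀ (x : X) (r : ℝ), μ (ball x r) < ∞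
  kappa_pos : 0 < κ
  kappa_le : κ ≤ n
  growth : ∃ C₁ C₂ : ℝ, 0 < C₁ ∧ C₁ ≤ 1 ∧ 1 ≤ C₂ ∧
    ∀ (x : X) (r t : ℝ), 0 < r → ENNReal.ofReal r < 2 * ediam (Set.univ : Set X) →
      1 ≤ t → ENNReal.ofReal t < 2 * ediam (Set.univ : Set X) / ENNReal.ofReal r →
        ENNReal.ofReal (C₁ * t ^ κ) * μ (ball x r) ≤ μ (ball x (t * r)) ∧
        μ (ball x (t * r)) ≤ ENNReal.ofReal (C₂ * t ^ n) * μ (ball x r)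

/-! ### Fractional Hajłasz–Sobolev spaces -/

section Hajlasz

variable {X : Type*} [MetricSpace X] [MeasurableSpace X] {𝕜 : Type*} [RCLike 𝕜]

/-- The class `𝒟(f)` of nonnegative Borel functions `g` with
`|f(x) - f(y)| ≤ d(x,y)^s (g(x) + g(y))` for all `x, y` outside a set of measure zero. -/
def hajlaszGradients (μ : Measure X) (s : ℝ) (f : X → 𝕜) : Set (X → ℝ) :=
  {g | Measurable g ∧ (∀ x, 0 ≤ g x) ∧ ∃ E : Set X, μ E = 0 ∧
    ∀ x, x ∉ E → ∀ y, y ∉ E → ‖f x - f y‖ ≤ dist x y ^ s * (g x + g y)}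

/-- The (quasi-)norm of the homogeneous space `Ṁ^{s,p}`: the infimum of `‖g‖_{L^p}` over
`g ∈ 𝒟(f)`, with value `∞` if `𝒟(f)` is empty. -/
noncomputable def hajlaszNorm (μ : Measure X) (s p : ℝ) (f : X → 𝕜) : ℝ≥0∞ :=
  ⨅ g ∈ hajlaszGradients μ s f, eLpNorm g (ENNReal.ofReal p) μ

/-- Membership in `Ṁ^{s,p}`: `f` is `μ`-measurable, lies in `L^p` on each ball, and has some
`g ∈ 𝒟(f)` in `L^p`. -/
def MemHajlasz (μ : Measure X) (s p : ℝ) (f : X → 𝕜) : Prop :=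
  AEStronglyMeasurable f μ ∧
  (∀ (x : X) (r : ℝ), MemLp f (ENNReal.ofReal p) (μ.restrict (ball x r))) ∧
  ∃ g ∈ hajlaszGradients μ s f, MemLp g (ENNReal.ofReal p) μ

end Hajlasz

/-! ### Test functions, their duals and grand Triebel–Lizorkin spaces -/

section Grand

variable {X : Type*} [MetricSpace X] [MeasurableSpace X] {𝕜 : Type*} [RCLike 𝕜]

/-- The weight `(V_r(x₁) + V(x₁,x))⁻¹ (r / (r + d(x₁,x)))^γ`, where `V_r(x₁) = μ(B(x₁,r))` and
`V(x₁,x) = μ(B(x₁,d(x₁,x)))`. -/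
noncomputable def testWeight (μ : Measure X) (x₁ : X) (r γ : ℝ) (x : X) : ℝ :=
  1 / (μ.real (ball x₁ r) + μ.real (ball x₁ (dist x₁ x))) * (r / (r + dist x₁ x)) ^ γ

/-- `C` is an admissible constant in the size and regularity conditions that define
`𝒢(x₁, r, β, γ)`. -/
def IsTestBound (μ : Measure X) (x₁ : X) (r β γ : ℝ) (φ : X → 𝕜) (C : ℝ) : Prop :=
  0 ≤ C ∧ (∀ x, ‖φ x‖ ≤ C * testWeight μ x₁ r γ x) ∧
  ∀ x y, dist x y ≤ (r + dist x₁ x) / 2 →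
    ‖φ x - φ y‖ ≤ C * ((dist x y / (r + dist x₁ x)) ^ β * testWeight μ x₁ r γ x)

variable (𝕜) in
/-- The space `𝒢(x₁, r, β, γ)` of `𝕜`-valued test functions, as a space of functions. -/
def testSpace (μ : Measure X) (x₁ : X) (r β γ : ℝ) : Submodule 𝕜 (X → 𝕜) where
  carrier := {φ | ∃ C, IsTestBound μ x₁ r β γ φ C}
  zero_mem' := ⟨0, le_rfl, by simp, by simp⟩
  add_mem' := by
    rintro φ ψ ⟨C, hC, h1, h2⟩ ⟨D, hD, k1, k2⟩
    refine ⟨C + D, add_nonneg hC hD, fun x => ?_, fun x y h => ?_⟩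
    · rw [add_mul]
      exact (norm_add_le _ _).trans (add_le_add (h1 x) (k1 x))
    · rw [add_mul]
      have e : (φ + ψ) x - (φ + ψ) y = (φ x - φ y) + (ψ x - ψ y) := by
        simp only [Pi.add_apply]; ring
      rw [e]
      exact (norm_add_le _ _).trans (add_le_add (h2 x y h) (k2 x y h))
  smul_mem' := by
    rintro c φ ⟨C, hC, h1, h2⟩
    refine ⟨‖c‖ * C, mul_nonneg (norm_nonneg c) hC, fun x => ?_, fun x y h => ?_⟩
    · rw [Pi.smul_apply, norm_smul, mul_assoc]
      exact mul_le_mul_of_nonneg_left (h1 x) (norm_nonneg c)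
    · rw [Pi.smul_apply, Pi.smul_apply, ← smul_sub, norm_smul, mul_assoc]
      exact mul_le_mul_of_nonneg_left (h2 x y h) (norm_nonneg c)

/-- The norm of `𝒢(x₁, r, β, γ)`: the infimum of the admissible constants (meaningful for
`φ ∈ 𝒢(x₁, r, β, γ)`, where there is one). -/
noncomputable def testNorm (μ : Measure X) (x₁ : X) (r β γ : ℝ) (φ : X → 𝕜) : ℝ :=
  sInf {C | IsTestBound μ x₁ r β γ φ C}

/-- `Λ` belongs to `(𝒢(1,2))'`, the space of bounded linear functionals on
`𝒢(1,2) = 𝒢(x₁, 1, 1, 2)`. -/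
def IsBoundedOnTest (μ : Measure X) (x₁ : X) (Λ : testSpace 𝕜 μ x₁ 1 1 2 →ₗ[𝕜] 𝕜) : Prop :=
  ∃ C : ℝ, ∀ φ : testSpace 𝕜 μ x₁ 1 1 2, ‖Λ φ‖ ≤ C * testNorm μ x₁ 1 1 2 (φ : X → 𝕜)

variable (𝕜) in
/-- The class `𝒜_k(x)` of all `φ ∈ 𝒢(1,2)` with vanishing integral whose norm in
`𝒢(x, 2^{-k}, 1, 2)` is at most `1`. -/
def testClass (μ : Measure X) (x₁ : X) (k : ℤ) (x : X) : Set (testSpace 𝕜 μ x₁ 1 1 2) :=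
  {φ | ∫ y, (φ : X → 𝕜) y ∂μ = 0 ∧
    (φ : X → 𝕜) ∈ testSpace 𝕜 μ x ((2 : ℝ) ^ (-k)) 1 2 ∧
    testNorm μ x ((2 : ℝ) ^ (-k)) 1 2 (φ : X → 𝕜) ≤ 1}

/-- The grand Littlewood–Paley function for `q = ∞`:
`x ↦ sup_{k ∈ ℤ} 2^{ks} sup_{φ ∈ 𝒜_k(x)} |⟨Λ, φ⟩|`. -/
noncomputable def grandFunction (μ : Measure X) (x₁ : X) (s : ℝ)
    (Λ : testSpace 𝕜 μ x₁ 1 1 2 →ₗ[𝕜] 𝕜) (x : X) : ℝ≥0∞ :=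
  ⨆ k : ℤ, ENNReal.ofReal ((2 : ℝ) ^ ((k : ℝ) * s)) * ⨆ φ ∈ testClass 𝕜 μ x₁ k x, ‖Λ φ‖ₑ

/-- The (quasi-)norm of the homogeneous grand Triebel–Lizorkin space `𝒜Ḟ^s_{p,∞}`. -/
noncomputable def grandNorm (μ : Measure X) (x₁ : X) (s p : ℝ)
    (Λ : testSpace 𝕜 μ x₁ 1 1 2 →ₗ[𝕜] 𝕜) : ℝ≥0∞ :=
  eLpNorm (grandFunction μ x₁ s Λ) (ENNReal.ofReal p) μ

/-- Membership in `𝒜Ḟ^s_{p,∞}`: `Λ ∈ (𝒢(1,2))'` and its grand (quasi-)norm is finite. -/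
def MemGrand (μ : Measure X) (x₁ : X) (s p : ℝ)
    (Λ : testSpace 𝕜 μ x₁ 1 1 2 →ₗ[𝕜] 𝕜) : Prop :=
  IsBoundedOnTest μ x₁ Λ ∧ grandNorm μ x₁ s p Λ < ∞

/-- The identification of a function `f` with a functional `Λ` on `𝒢(1,2)`: for each test
function `φ`, the product `f φ` is integrable and `⟨Λ, φ⟩ = ∫ f φ dμ`. -/
def Represents (μ : Measure X) (x₁ : X) (f : X → 𝕜)
    (Λ : testSpace 𝕜 μ x₁ 1 1 2 →ₗ[𝕜] 𝕜) : Prop :=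
  ∀ φ : testSpace 𝕜 μ x₁ 1 1 2,
    Integrable (fun x => f x * (φ : X → 𝕜) x) μ ∧ Λ φ = ∫ x, f x * (φ : X → 𝕜) x ∂μ

end Grand

section

open Filter Topology

/-- All balls have positive and finite measure, and `μ(B(x,tr)) ≤ D t ^ n μ(B(x,r))` for all
`t ≥ 1`. -/
structure BallGrowth {X : Type*} [MetricSpace X] [MeasurableSpace X]
    (μ : Measure X) (n D : ℝ) : Prop where
  measure_ball_pos : ∀ (x : X) (r : ℝ), 0 < r → 0 < μ (ball x r)
  measure_ball_lt_top : ∀ (x : X) (r : ℝ), μ (ball x r) < ∞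
  exponent_pos : 0 < n
  one_le : 1 ≤ D
  growth : ∀ (x : X) (r t : ℝ), 0 < r → 1 ≤ t →
    μ.real (ball x (t * r)) ≤ D * t ^ n * μ.real (ball x r)

theorem IsRDSpace.exists_ballGrowth {X : Type*} [MetricSpace X] [MeasurableSpace X]
    {μ : Measure X} {κ n : ℝ} (hX : IsRDSpace μ κ n) (hμ : μ Set.univ = ∞) (x₁ : X) :
    ∃ D, BallGrowth μ n D := by
  obtain ⟨C₁, C₂, -, -, hC₂, h⟩ := hX.growth
  have hdiam : ediam (Set.univ : Set X) = ∞ := by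
    by_contra hne
    have hb : Bornology.IsBounded (Set.univ : Set X) := isBounded_iff_ediam_ne_top.2 hne
    obtain ⟨R, hR⟩ := hb.subset_ball x₁
    have := (measure_mono hR).trans_lt (hX.measure_ball_lt_top x₁ R)
    exact absurd hμ this.ne
  refine ⟨C₂, hX.measure_ball_pos, hX.measure_ball_lt_top, hX.kappa_pos.trans_le hX.kappa_le,
    hC₂, fun x r t hr ht => ?_⟩
  have h2 : (2 : ℝ≥0∞) * ∞ = ∞ := ENNReal.mul_top (by norm_num)
  have := (h x r t hr (by rw [hdiam, h2]; exact ENNReal.ofReal_lt_top) ht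
    (by rw [hdiam, h2, ENNReal.top_div_of_ne_top ENNReal.ofReal_ne_top]
        exact ENNReal.ofReal_lt_top)).2
  have h0 : 0 ≤ C₂ * t ^ n := by positivity
  have := ENNReal.toReal_mono
    (ENNReal.mul_ne_top ENNReal.ofReal_ne_top (hX.measure_ball_lt_top x r).ne) this
  rwa [ENNReal.toReal_mul, ENNReal.toReal_ofReal h0] at this

/-- Every set contains a maximal `r`-separated subset. -/
theorem exists_separated_covering {X : Type*} [MetricSpace X] (A : Set X) {r : ℝ} (hr : 0 < r) :
    ∃ T ⊆ A, (T.Pairwise fun x y => r ≤ dist x y) ∧ ∀ x ∈ A, ∃ y ∈ T, dist x y < r := by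
  obtain ⟨T, hT⟩ := zorn_subset {T : Set X | T ⊆ A ∧ T.Pairwise fun x y => r ≤ dist x y} (by
    intro c hc hchain
    refine ⟨⋃₀ c, ⟨Set.sUnion_subset fun t ht => (hc ht).1, ?_⟩,
      fun t ht => Set.subset_sUnion_of_mem ht⟩
    exact (Set.pairwise_sUnion hchain.directedOn).2 fun t ht => (hc ht).2)
  refine ⟨T, hT.prop.1, hT.prop.2, fun x hx => ?_⟩
  by_contra! hcon
  have hins : insert x T ∈ {T : Set X | T ⊆ A ∧ T.Pairwise fun x y => r ≤ dist x y} := by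
    refine ⟨Set.insert_subset hx hT.prop.1, hT.prop.2.insert fun y hy _ => ⟨hcon y hy, ?_⟩⟩
    rw [dist_comm]; exact hcon y hy
  have := hT.le_of_ge hins (Set.subset_insert x T) (Set.mem_insert x T)
  have h0 := hcon x this
  rw [dist_self] at h0
  linarith

theorem disjoint_ball_half_of_le_dist {X : Type*} [MetricSpace X] {x y : X} {r : ℝ}
    (h : r ≤ dist x y) : Disjoint (ball x (r / 2)) (ball y (r / 2)) :=
  ball_disjoint_ball (by linarith)

namespace BallGrowth

variable {X : Type*} [MetricSpace X] [MeasurableSpace X] {μ : Measure X} {n D : ℝ}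

theorem real_ball_pos (h : BallGrowth μ n D) (x : X) {r : ℝ} (hr : 0 < r) :
    0 < μ.real (ball x r) :=
  ENNReal.toReal_pos (h.measure_ball_pos x r hr).ne' (h.measure_ball_lt_top x r).ne

theorem const_pos (h : BallGrowth μ n D) : 0 < D := zero_lt_one.trans_le h.one_le

theorem real_mono (h : BallGrowth μ n D) {s : Set X} {x : X} {r : ℝ} (hs : s ⊆ ball x r) :
    μ.real s ≤ μ.real (ball x r) :=
  measureReal_mono hs (h.measure_ball_lt_top x r).ne

theorem ofReal_real_ball (h : BallGrowth μ n D) (x : X) (r : ℝ) :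
    ENNReal.ofReal (μ.real (ball x r)) = μ (ball x r) :=
  ofReal_measureReal (h.measure_ball_lt_top x r).ne

theorem real_ball_le (h : BallGrowth μ n D) {x x' : X} {r r' L : ℝ} (hr' : 0 < r')
    (hL : 1 ≤ L) (hd : dist x x' + r ≤ L * r') :
    μ.real (ball x r) ≤ D * L ^ n * μ.real (ball x' r') := by
  refine (h.real_mono (ball_subset_ball' ?_)).trans (h.growth x' r' L hr' hL)
  linarith

theorem measure_ball_le (h : BallGrowth μ n D) {x x' : X} {r r' L : ℝ} (hr' : 0 < r')
    (hL : 1 ≤ L) (hd : dist x x' + r ≤ L * r') :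
    μ (ball x r) ≤ ENNReal.ofReal (D * L ^ n) * μ (ball x' r') := by
  have hD := h.const_pos
  rw [← h.ofReal_real_ball x r, ← h.ofReal_real_ball x' r', ← ENNReal.ofReal_mul (by positivity)]
  exact ENNReal.ofReal_le_ofReal (h.real_ball_le hr' hL hd)

theorem sigmaFinite (h : BallGrowth μ n D) (x₁ : X) : SigmaFinite μ := by
  refine ⟨⟨⟨fun k : ℕ => ball x₁ k, fun _ => trivial, fun k => h.measure_ball_lt_top _ _,
    iUnion_ball_nat x₁⟩⟩⟩

theorem isLocallyFiniteMeasure (h : BallGrowth μ n D) : IsLocallyFiniteMeasure μ :=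
  ⟨fun x => ⟨ball x 1, ball_mem_nhds x one_pos, h.measure_ball_lt_top x 1⟩⟩

theorem secondCountableTopology [BorelSpace X] (h : BallGrowth μ n D) (x₁ : X) :
    SecondCountableTopology X := by
  have := h.sigmaFinite x₁
  refine secondCountable_of_almost_dense_set fun ε hε => ?_
  obtain ⟨T, -, hsep, hcov⟩ := exists_separated_covering (Set.univ : Set X) hε
  have hcount := Measure.countable_meas_pos_of_disjoint_iUnion (μ := μ)
    (As := fun t : T => ball (t : X) (ε / 2)) (fun _ => measurableSet_ball)
    (fun t t' htt' => disjoint_ball_half_of_le_dist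
      (hsep t.2 t'.2 fun he => htt' (Subtype.ext he)))
  have huniv : {t : T | 0 < μ (ball (t : X) (ε / 2))} = Set.univ :=
    Set.eq_univ_of_forall fun t => h.measure_ball_pos _ _ (by positivity)
  rw [huniv, Set.countable_univ_iff] at hcount
  exact ⟨T, Set.countable_coe_iff.1 hcount, fun x => by
    obtain ⟨y, hy, hxy⟩ := hcov x trivial
    exact ⟨y, hy, hxy.le⟩⟩

theorem isUnifLocDoublingMeasure (h : BallGrowth μ n D) : IsUnifLocDoublingMeasure μ := by
  refine ⟨⟨(D * 3 ^ n).toNNReal, ?_⟩⟩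
  filter_upwards [self_mem_nhdsWithin] with ε hε x
  have hε : 0 < ε := hε
  calc μ (closedBall x (2 * ε)) ≤ μ (ball x (3 * ε)) :=
        measure_mono (closedBall_subset_ball (by linarith))
    _ ≤ ENNReal.ofReal (D * 3 ^ n) * μ (ball x ε) :=
        h.measure_ball_le hε (by norm_num) (by simp)
    _ ≤ _ := mul_le_mul' le_rfl (measure_mono ball_subset_closedBall)

/-- A separated subset of a ball is finite. -/
theorem finite_of_separated [BorelSpace X] (h : BallGrowth μ n D) {T : Set X} {x : X} {r R : ℝ}
    (hr : 0 < r) (hT : T ⊆ ball x R) (hsep : T.Pairwise fun x y => r ≤ dist x y) :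
    T.Finite := by
  rcases T.eq_empty_or_nonempty with rfl | ⟨t₀, ht₀⟩
  · exact Set.finite_empty
  have hR : 0 < R := dist_nonneg.trans_lt (mem_ball.1 (hT ht₀))
  have hD := h.const_pos
  set L : ℝ := 1 + 2 * R / (r / 2) with hL
  have hL1 : 1 ≤ L := by rw [hL]; have : 0 ≤ 2 * R / (r / 2) := by positivity
                         linarith
  have hfin := Measure.finite_const_le_meas_of_disjoint_iUnion μ
    (ε := (ENNReal.ofReal (D * L ^ n))⁻¹ * μ (ball x R)) (ENNReal.mul_pos
      (ENNReal.inv_ne_zero.2 ENNReal.ofReal_ne_top) (h.measure_ball_pos x R hR).ne')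
    (As := fun t : T => ball (t : X) (r / 2)) (fun _ => measurableSet_ball)
    (fun t t' htt' => disjoint_ball_half_of_le_dist
      (hsep t.2 t'.2 fun he => htt' (Subtype.ext he)))
    (ne_top_of_le_ne_top (h.measure_ball_lt_top x (R + r / 2)).ne (measure_mono
      (Set.iUnion_subset fun t => ball_subset_ball' (y := x) (by
        have := mem_ball.1 (hT t.2); linarith))))
  have huniv : {t : T | (ENNReal.ofReal (D * L ^ n))⁻¹ * μ (ball x R) ≤ μ (ball (t : X) (r / 2))}
      = Set.univ := Set.eq_univ_of_forall fun t => by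
    have hx := mem_ball'.1 (hT t.2)
    have := h.measure_ball_le (x := x) (x' := t) (r := R) (r' := r / 2) (by positivity) hL1
      (by rw [hL, add_mul, div_mul_cancel₀ _ (by positivity)]; linarith)
    have hpos : 0 < D * L ^ n := by positivity
    rw [Set.mem_ofPred_eq, mul_comm, ← div_eq_mul_inv]
    exact ENNReal.div_le_of_le_mul' this
  rw [huniv, Set.finite_univ_iff] at hfin
  exact Set.toFinite T

end BallGrowth

/-- The uncentered Hardy–Littlewood maximal function. -/
noncomputable def ballMaximal {X : Type*} [MetricSpace X] [MeasurableSpace X]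
    (μ : Measure X) (u : X → ℝ≥0∞) (x : X) : ℝ≥0∞ :=
  ⨆ (y : X) (r : ℝ), (ball y r).indicator
    (fun _ => (μ (ball y r))⁻¹ * ∫⁻ z in ball y r, u z ∂μ) x

section

variable {X : Type*} [MetricSpace X] [MeasurableSpace X] {μ : Measure X} {n D : ℝ}

theorem measurable_ballMaximal [BorelSpace X] (μ : Measure X) (u : X → ℝ≥0∞) :
    Measurable (ballMaximal μ u) := by
  apply LowerSemicontinuous.measurable
  exact lowerSemicontinuous_iSup fun y => lowerSemicontinuous_iSup fun r =>
    isOpen_ball.lowerSemicontinuous_indicator (zero_le)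

theorem average_le_ballMaximal (μ : Measure X) (u : X → ℝ≥0∞) {x y : X} {r : ℝ}
    (hx : x ∈ ball y r) :
    (μ (ball y r))⁻¹ * ∫⁻ z in ball y r, u z ∂μ ≤ ballMaximal μ u x := by
  refine le_trans ?_ (le_iSup₂ (f := fun y r => (ball y r).indicator
    (fun _ => (μ (ball y r))⁻¹ * ∫⁻ z in ball y r, u z ∂μ) x) y r)
  rw [Set.indicator_of_mem hx]

theorem exists_average_of_lt_ballMaximal {u : X → ℝ≥0∞} {x : X} {a : ℝ≥0∞}
    (ha : a < ballMaximal μ u x) : ∃ y r, x ∈ ball y r ∧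
      a < (μ (ball y r))⁻¹ * ∫⁻ z in ball y r, u z ∂μ := by
  simp only [ballMaximal, lt_iSup_iff] at ha
  obtain ⟨y, r, h⟩ := ha
  by_cases hx : x ∈ ball y r
  · exact ⟨y, r, hx, by rwa [Set.indicator_of_mem hx] at h⟩
  · simp [Set.indicator_of_notMem hx] at h

namespace BallGrowth

theorem setLIntegral_ball_le (h : BallGrowth μ n D) (u : X → ℝ≥0∞) (x : X) {r : ℝ} (hr : 0 < r) :
    ∫⁻ z in ball x r, u z ∂μ ≤ ballMaximal μ u x * μ (ball x r) := by
  have := average_le_ballMaximal μ u (mem_ball_self hr : x ∈ ball x r)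
  rw [mul_comm, ← div_eq_mul_inv] at this
  rwa [ENNReal.div_le_iff (h.measure_ball_pos x r hr).ne' (h.measure_ball_lt_top x r).ne] at this

/-- The weak type `(1,1)` inequality. -/
theorem weak_type_ballMaximal [BorelSpace X] (h : BallGrowth μ n D) (x₁ : X) (u : X → ℝ≥0∞)
    (a : ℝ≥0∞) :
    a * μ {x | a < ballMaximal μ u x} ≤ ENNReal.ofReal (D * 6 ^ n) * ∫⁻ x, u x ∂μ := by
  have := h.sigmaFinite x₁
  let t : ℕ → Set (X × ℝ) := fun k => {b | 0 < b.2 ∧ b.2 ≤ k ∧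
    a * μ (ball b.1 b.2) ≤ ∫⁻ z in ball b.1 b.2, u z ∂μ}
  let S : ℕ → Set X := fun k => ⋃ b ∈ t k, ball b.1 b.2
  have hS : Monotone S := fun k l hkl => Set.biUnion_subset_biUnion_left fun b hb =>
    ⟨hb.1, hb.2.1.trans (by exact_mod_cast hkl), hb.2.2⟩
  have hsub : {x | a < ballMaximal μ u x} ⊆ ⋃ k, S k := by
    intro x hx
    obtain ⟨y, r, hxy, hlt⟩ := exists_average_of_lt_ballMaximal hx
    have hr : 0 < r := dist_nonneg.trans_lt hxy
    obtain ⟨k, hk⟩ := exists_nat_ge r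
    rw [mul_comm, ← div_eq_mul_inv, ENNReal.lt_div_iff_mul_lt
      (Or.inl (h.measure_ball_pos y r hr).ne') (Or.inl (h.measure_ball_lt_top y r).ne)] at hlt
    exact Set.mem_iUnion.2 ⟨k, Set.mem_biUnion (x := (y, r)) ⟨hr, hk, hlt.le⟩ hxy⟩
  have hk : ∀ k, a * μ (S k) ≤ ENNReal.ofReal (D * 6 ^ n) * ∫⁻ x, u x ∂μ := by
    intro k
    obtain ⟨v, hvt, hdisj, hcov⟩ := Vitali.exists_disjoint_subfamily_covering_enlargement_closedBall
      (t k) (fun b => b.1) (fun b => b.2) k (fun b hb => hb.2.1) 5 (by norm_num)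
    have hdisj' : Pairwise (Function.onFun Disjoint fun b : v => ball (b : X × ℝ).1 b.1.2) :=
      fun b b' hbb' => (hdisj b.2 b'.2 fun he => hbb' (Subtype.ext he)).mono
        ball_subset_closedBall ball_subset_closedBall
    have hcount := Measure.countable_meas_pos_of_disjoint_iUnion (μ := μ)
      (fun b : v => measurableSet_ball) hdisj'
    have huniv : {b : v | 0 < μ (ball (b : X × ℝ).1 b.1.2)} = Set.univ :=
      Set.eq_univ_of_forall fun b => h.measure_ball_pos _ _ (hvt b.2).1
    rw [huniv, Set.countable_univ_iff] at hcount
    have hSk : S k ⊆ ⋃ b : v, ball (b : X × ℝ).1 (6 * b.1.2) := by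
      refine Set.iUnion₂_subset fun b hb => ?_
      obtain ⟨b', hb', hbb'⟩ := hcov b hb
      refine (ball_subset_closedBall.trans hbb').trans
        ((closedBall_subset_ball ?_).trans (Set.subset_iUnion (fun b : v =>
          ball (b : X × ℝ).1 (6 * b.1.2)) ⟨b', hb'⟩))
      have := (hvt hb').1
      linarith
    calc a * μ (S k) ≤ a * ∑' b : v, μ (ball (b : X × ℝ).1 (6 * b.1.2)) := by
          gcongr; exact (measure_mono hSk).trans (measure_iUnion_le _)
      _ ≤ a * ∑' b : v, ENNReal.ofReal (D * 6 ^ n) * μ (ball (b : X × ℝ).1 b.1.2) := by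
          gcongr with b
          exact h.measure_ball_le (hvt b.2).1 (by norm_num) (by simp)
      _ = ENNReal.ofReal (D * 6 ^ n) * ∑' b : v, a * μ (ball (b : X × ℝ).1 b.1.2) := by
          rw [ENNReal.tsum_mul_left, ENNReal.tsum_mul_left]; ring
      _ ≤ ENNReal.ofReal (D * 6 ^ n) * ∑' b : v, ∫⁻ z in ball (b : X × ℝ).1 b.1.2, u z ∂μ := by
          gcongr with b
          exact (hvt b.2).2.2
      _ = ENNReal.ofReal (D * 6 ^ n) * ∫⁻ z in ⋃ b : v, ball (b : X × ℝ).1 b.1.2, u z ∂μ := by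
          rw [lintegral_iUnion (fun _ => measurableSet_ball) hdisj']
      _ ≤ _ := mul_le_mul' le_rfl (setLIntegral_le_lintegral _ _)
  calc a * μ {x | a < ballMaximal μ u x} ≤ a * μ (⋃ k, S k) := by gcongr
    _ = ⨆ k, a * μ (S k) := by rw [hS.measure_iUnion, ENNReal.mul_iSup]
    _ ≤ _ := iSup_le hk

/-- The part of `u` below the level `a / 2` is harmless for the level set `{M u > a}`. -/
theorem weak_type_ballMaximal_truncated [BorelSpace X] (h : BallGrowth μ n D) (x₁ : X)
    {u : X → ℝ≥0∞} (hu : Measurable u) (a : ℝ≥0∞) :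
    a * μ {x | a < ballMaximal μ u x} ≤
      ENNReal.ofReal (2 * (D * 6 ^ n)) * ∫⁻ x in {x | a < 2 * u x}, u x ∂μ := by
  have hmeas : MeasurableSet {x | a < 2 * u x} := measurableSet_lt measurable_const
    (hu.const_mul 2)
  set w : X → ℝ≥0∞ := {x | a < 2 * u x}.indicator u
  have huw : ∀ x, u x ≤ w x + a / 2 := fun x => by
    by_cases hx : a < 2 * u x
    · exact (Set.indicator_of_mem (s := {x | a < 2 * u x}) hx u).symm.le.trans le_self_add
    · refine le_trans ?_ le_add_self
      rw [ENNReal.le_div_iff_mul_le (by simp) (by simp), mul_comm]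
      exact not_lt.1 hx
  have hsub : {x | a < ballMaximal μ u x} ⊆ {x | a / 2 < ballMaximal μ w x} := by
    intro x hx
    obtain ⟨y, r, hxy, hlt⟩ := exists_average_of_lt_ballMaximal hx
    have hr : 0 < r := dist_nonneg.trans_lt hxy
    have hle : (μ (ball y r))⁻¹ * ∫⁻ z in ball y r, u z ∂μ ≤
        (μ (ball y r))⁻¹ * ∫⁻ z in ball y r, w z ∂μ + a / 2 := by
      calc _ ≤ (μ (ball y r))⁻¹ * ∫⁻ z in ball y r, (w z + a / 2) ∂μ := by
            gcongr with z; exact huw z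
        _ = _ := by
            rw [lintegral_add_right _ measurable_const, mul_add, lintegral_const,
              Measure.restrict_apply_univ, mul_comm (a / 2), ← mul_assoc,
              ENNReal.inv_mul_cancel (h.measure_ball_pos y r hr).ne'
                (h.measure_ball_lt_top y r).ne, one_mul]
    have h1 := hlt.trans_le (hle.trans (add_le_add_left (average_le_ballMaximal μ w hxy) _))
    have h2 : a / 2 + a / 2 < ballMaximal μ w x + a / 2 := by rwa [ENNReal.add_halves]
    exact lt_of_add_lt_add_right h2
  calc a * μ {x | a < ballMaximal μ u x} ≤ 2 * (a / 2) * μ {x | a / 2 < ballMaximal μ w x} := by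
        rw [ENNReal.mul_div_cancel (by simp) (by simp)]; gcongr
    _ ≤ 2 * (ENNReal.ofReal (D * 6 ^ n) * ∫⁻ x, w x ∂μ) := by
        rw [mul_assoc]; exact mul_le_mul' le_rfl (h.weak_type_ballMaximal x₁ w _)
    _ = _ := by
        rw [lintegral_indicator hmeas, ENNReal.ofReal_mul two_pos.le, mul_assoc,
          ENNReal.ofReal_ofNat]

/-- The maximal function is bounded on `L^t` for `t > 1`. -/
theorem lintegral_ballMaximal_rpow_le [BorelSpace X] (h : BallGrowth μ n D) (x₁ : X) {t : ℝ}
    (ht : 1 < t) : ∃ C : ℝ, 0 < C ∧ ∀ u : X → ℝ, Measurable u → (∀ x, 0 ≤ u x) →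
      ∫⁻ x, ballMaximal μ (fun z => ENNReal.ofReal (u z)) x ^ t ∂μ ≤
        ENNReal.ofReal C * ∫⁻ x, ENNReal.ofReal (u x ^ t) ∂μ := by
  have hD := h.const_pos
  refine ⟨t * (2 * (D * 6 ^ n)) * (t - 1)⁻¹ * 2 ^ (t - 1), by
    have : 0 < t - 1 := by linarith
    positivity, fun u hu hu0 => ?_⟩
  have := h.sigmaFinite x₁
  set U : X → ℝ≥0∞ := fun z => ENNReal.ofReal (u z) with hU
  have hUm : Measurable U := hu.ennreal_ofReal
  set K : ℝ := 2 * (D * 6 ^ n) with hK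
  have hK0 : 0 < K := by positivity
  set ν : Measure X := μ.withDensity U with hν
  have hν2 : ∀ a : ℝ, 0 < a → ENNReal.ofReal a * μ {x | ENNReal.ofReal a < ballMaximal μ U x} ≤
      ENNReal.ofReal K * ν {x | a < 2 * u x} := fun a ha => by
    have h1 := h.weak_type_ballMaximal_truncated x₁ hUm (ENNReal.ofReal a)
    have hset : {x | ENNReal.ofReal a < 2 * U x} = {x | a < 2 * u x} := by
      ext x
      have : (2 : ℝ≥0∞) * U x = ENNReal.ofReal (2 * u x) := by
        rw [ENNReal.ofReal_mul (by norm_num)]; simp [hU]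
      simp only [Set.mem_ofPred_eq, this]
      exact ENNReal.ofReal_lt_ofReal_iff_of_nonneg ha.le
    rw [hset] at h1
    rwa [hν, withDensity_apply _ (measurableSet_lt measurable_const (hu.const_mul 2))]
  have main : ∀ N : ℕ, ∫⁻ x, (min (ballMaximal μ U x) N) ^ t ∂μ ≤
      ENNReal.ofReal (t * K * (t - 1)⁻¹ * 2 ^ (t - 1)) * ∫⁻ x, ENNReal.ofReal (u x ^ t) ∂μ := by
    intro N
    set F : X → ℝ := fun x => (min (ballMaximal μ U x) N).toReal with hF
    have hFm : Measurable F := ((measurable_ballMaximal μ U).min measurable_const).ennreal_toReal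
    have hFt : ∀ x, min (ballMaximal μ U x) N ≠ ∞ := fun x =>
      ne_top_of_le_ne_top (ENNReal.natCast_ne_top N) (min_le_right _ _)
    calc ∫⁻ x, (min (ballMaximal μ U x) N) ^ t ∂μ = ∫⁻ x, ENNReal.ofReal (F x ^ t) ∂μ := by
          refine lintegral_congr fun x => ?_
          rw [hF, ← ENNReal.ofReal_rpow_of_nonneg ENNReal.toReal_nonneg (by linarith),
            ENNReal.ofReal_toReal (hFt x)]
      _ = ENNReal.ofReal t * ∫⁻ a in Set.Ioi 0, μ {x | a < F x} * ENNReal.ofReal (a ^ (t - 1)) :=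
          lintegral_rpow_eq_lintegral_meas_lt_mul μ (ae_of_all _ fun _ => ENNReal.toReal_nonneg)
            hFm.aemeasurable (by linarith)
      _ ≤ ENNReal.ofReal t * ∫⁻ a in Set.Ioi 0,
            ENNReal.ofReal K * (ν {x | a < 2 * u x} * ENNReal.ofReal (a ^ (t - 1 - 1))) := by
          gcongr 1
          refine setLIntegral_mono' measurableSet_Ioi fun a (ha : 0 < a) => ?_
          have hsub : {x | a < F x} ⊆ {x | ENNReal.ofReal a < ballMaximal μ U x} := fun x hx =>
            (ENNReal.ofReal_lt_iff_lt_toReal ha.le (hFt x)).2 hx |>.trans_le (min_le_left _ _)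
          have hpow : ENNReal.ofReal (a ^ (t - 1)) =
              ENNReal.ofReal a * ENNReal.ofReal (a ^ (t - 1 - 1)) := by
            rw [← ENNReal.ofReal_mul ha.le, mul_comm, ← Real.rpow_add_one ha.ne']
            congr 2; ring
          rw [hpow, ← mul_assoc, ← mul_assoc]
          gcongr ?_ * _
          rw [mul_comm]
          exact le_trans (by gcongr) (hν2 a ha)
      _ = ENNReal.ofReal t * (ENNReal.ofReal K * ∫⁻ a in Set.Ioi 0,
            (ν {x | a < 2 * u x} * ENNReal.ofReal (a ^ (t - 1 - 1)))) := by
          rw [lintegral_const_mul' _ _ ENNReal.ofReal_ne_top]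
      _ = ENNReal.ofReal (t * K * (t - 1)⁻¹) * ∫⁻ x, ENNReal.ofReal ((2 * u x) ^ (t - 1)) ∂ν := by
          have ht1 : 0 < t - 1 := by linarith
          rw [lintegral_rpow_eq_lintegral_meas_lt_mul ν
            (ae_of_all _ fun x => mul_nonneg two_pos.le (hu0 x))
            (hu.const_mul 2).aemeasurable ht1, ← mul_assoc, ← mul_assoc,
            ← ENNReal.ofReal_mul (by linarith), ← ENNReal.ofReal_mul (by positivity),
            inv_mul_cancel_right₀ ht1.ne']
      _ = _ := by
          have ht1 : 0 < t - 1 := by linarith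
          rw [hν, lintegral_withDensity_eq_lintegral_mul _ hUm
            (((hu.const_mul 2).pow_const _).ennreal_ofReal),
            ENNReal.ofReal_mul (p := t * K * (t - 1)⁻¹) (by positivity),
            mul_assoc (ENNReal.ofReal (t * K * (t - 1)⁻¹))]
          congr 1
          rw [← lintegral_const_mul' _ _ ENNReal.ofReal_ne_top]
          refine lintegral_congr fun x => ?_
          rw [Pi.mul_apply, hU, ← ENNReal.ofReal_mul (hu0 x), ← ENNReal.ofReal_mul (by positivity),
            Real.mul_rpow two_pos.le (hu0 x)]
          rcases (hu0 x).eq_or_lt with h0 | h0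
          · rw [← h0, Real.zero_rpow ht1.ne', Real.zero_rpow (by linarith)]; simp
          · rw [show u x ^ t = u x ^ (t - 1) * u x by
              rw [← Real.rpow_add_one h0.ne']; congr 1; ring]
            congr 1; ring
  calc ∫⁻ x, ballMaximal μ U x ^ t ∂μ
      = ∫⁻ x, ⨆ N : ℕ, (min (ballMaximal μ U x) N) ^ t ∂μ := by
        refine lintegral_congr fun x => ?_
        have hsup : ⨆ N : ℕ, min (ballMaximal μ U x) N = ballMaximal μ U x := by
          rw [← inf_iSup_eq, ENNReal.iSup_natCast, inf_top_eq]
        have := (ENNReal.orderIsoRpow t (by linarith)).map_iSup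
          fun N : ℕ => min (ballMaximal μ U x) N
        rw [hsup] at this
        exact this
    _ = ⨆ N : ℕ, ∫⁻ x, (min (ballMaximal μ U x) N) ^ t ∂μ := by
        refine lintegral_iSup (fun N => ((measurable_ballMaximal μ U).min
          measurable_const).pow_const _) fun N N' hNN' x => ?_
        dsimp only
        gcongr
    _ ≤ _ := iSup_le main

end BallGrowth

end

section

variable {X : Type*} [MetricSpace X] [MeasurableSpace X] {𝕜 : Type*} [RCLike 𝕜]

/-- The weight `(r/ρ)² / μ(B(x,ρ))`. For `ρ = r + d(x,y)` it is comparable with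
`testWeight μ x r 2 y`. -/
noncomputable def ballWeight (μ : Measure X) (x : X) (r ρ : ℝ) : ℝ :=
  (μ.real (ball x ρ))⁻¹ * (r / ρ) ^ 2

/-- The size and regularity conditions of `𝒢(x, r, 1, 2)` with `ballWeight` in place of
`testWeight`, and with regularity only for `d(y,z) ≤ δ (r + d(x,y))`. -/
def IsLocalTestBound (μ : Measure X) (x : X) (r δ : ℝ) (φ : X → 𝕜) (A : ℝ) : Prop :=
  0 ≤ A ∧ (∀ y, ‖φ y‖ ≤ A * ballWeight μ x r (r + dist x y)) ∧
  ∀ y z, dist y z ≤ δ * (r + dist x y) →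
    ‖φ y - φ z‖ ≤ A * (dist y z / (r + dist x y) * ballWeight μ x r (r + dist x y))

variable {μ : Measure X} {n D : ℝ}

theorem ballWeight_nonneg (μ : Measure X) (x : X) (r ρ : ℝ) : 0 ≤ ballWeight μ x r ρ := by
  unfold ballWeight; positivity

theorem IsTestBound.smul {x : X} {r β γ C : ℝ} {φ : X → 𝕜} (h : IsTestBound μ x r β γ φ C)
    (c : 𝕜) : IsTestBound μ x r β γ (c • φ) (‖c‖ * C) := by
  refine ⟨mul_nonneg (norm_nonneg c) h.1, fun y => ?_, fun y z hyz => ?_⟩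
  · rw [Pi.smul_apply, norm_smul, mul_assoc]
    exact mul_le_mul_of_nonneg_left (h.2.1 y) (norm_nonneg c)
  · rw [Pi.smul_apply, Pi.smul_apply, ← smul_sub, norm_smul, mul_assoc]
    exact mul_le_mul_of_nonneg_left (h.2.2 y z hyz) (norm_nonneg c)

theorem IsTestBound.add {x : X} {r β γ C C' : ℝ} {φ ψ : X → 𝕜} (h : IsTestBound μ x r β γ φ C)
    (h' : IsTestBound μ x r β γ ψ C') : IsTestBound μ x r β γ (φ + ψ) (C + C') := by
  refine ⟨add_nonneg h.1 h'.1, fun y => ?_, fun y z hyz => ?_⟩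
  · rw [add_mul]
    exact (norm_add_le _ _).trans (add_le_add (h.2.1 y) (h'.2.1 y))
  · rw [add_mul, Pi.add_apply, Pi.add_apply, add_sub_add_comm]
    exact (norm_add_le _ _).trans (add_le_add (h.2.2 y z hyz) (h'.2.2 y z hyz))

theorem IsTestBound.sub {x : X} {r β γ C C' : ℝ} {φ ψ : X → 𝕜} (h : IsTestBound μ x r β γ φ C)
    (h' : IsTestBound μ x r β γ ψ C') : IsTestBound μ x r β γ (φ - ψ) (C + C') := by
  have := h.add (h'.smul (-1))
  rwa [norm_neg, norm_one, one_mul, neg_one_smul, ← sub_eq_add_neg] at this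

theorem testWeight_nonneg (μ : Measure X) (x : X) {r γ : ℝ} (hr : 0 ≤ r) (y : X) :
    0 ≤ testWeight μ x r γ y := by
  unfold testWeight; positivity

theorem IsTestBound.mono {x : X} {r β γ C C' : ℝ} {φ : X → 𝕜} (hr : 0 ≤ r)
    (h : IsTestBound μ x r β γ φ C) (hC : C ≤ C') : IsTestBound μ x r β γ φ C' := by
  refine ⟨h.1.trans hC, fun y => (h.2.1 y).trans ?_, fun y z hyz => (h.2.2 y z hyz).trans ?_⟩
  · have := testWeight_nonneg μ x hr (γ := γ) y
    gcongr
  · have := testWeight_nonneg μ x hr (γ := γ) y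
    gcongr

/-- The infimum in the definition of `testNorm` is attained. -/
theorem isTestBound_testNorm {x : X} {r β γ : ℝ} {φ : X → 𝕜} (hφ : φ ∈ testSpace 𝕜 μ x r β γ) :
    IsTestBound μ x r β γ φ (testNorm μ x r β γ φ) := by
  have hne : {C | IsTestBound μ x r β γ φ C}.Nonempty := hφ
  have hbdd : BddBelow {C | IsTestBound μ x r β γ φ C} := ⟨0, fun C hC => hC.1⟩
  have hclosed : IsClosed {C | IsTestBound μ x r β γ φ C} := by
    simp only [IsTestBound, Set.ofPred_and, Set.ofPred_forall]
    refine (isClosed_le continuous_const continuous_id).inter ((isClosed_iInter fun y => ?_).inter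
      (isClosed_iInter fun y => isClosed_iInter fun z => isClosed_iInter fun _ => ?_))
    · exact isClosed_le continuous_const (continuous_id.mul continuous_const)
    · exact isClosed_le continuous_const (continuous_id.mul continuous_const)
  exact hclosed.csInf_mem hne hbdd

theorem testNorm_le {x : X} {r β γ C : ℝ} {φ : X → 𝕜} (h : IsTestBound μ x r β γ φ C) :
    testNorm μ x r β γ φ ≤ C :=
  csInf_le ⟨0, fun _ hC => hC.1⟩ h

theorem mem_testClass_iff {x₁ x : X} {k : ℤ} {φ : testSpace 𝕜 μ x₁ 1 1 2} :
    φ ∈ testClass 𝕜 μ x₁ k x ↔ ∫ y, (φ : X → 𝕜) y ∂μ = 0 ∧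
      IsTestBound μ x ((2 : ℝ) ^ (-k)) 1 2 (φ : X → 𝕜) 1 := by
  refine and_congr_right fun _ => ⟨fun h => ?_, fun h => ⟨⟨1, h⟩, testNorm_le h⟩⟩
  exact (isTestBound_testNorm h.1).mono (by positivity) h.2

namespace BallGrowth

theorem ballWeight_le_of_le (h : BallGrowth μ n D) (x : X) (r : ℝ) {ρ ρ' L : ℝ} (hρ : 0 < ρ)
    (hρ' : 0 < ρ') (hL : 1 ≤ L) (hle : ρ ≤ L * ρ') :
    ballWeight μ x r ρ' ≤ D * L ^ n * L ^ 2 * ballWeight μ x r ρ := by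
  have h1 := h.real_ball_pos x hρ
  have h2 := h.real_ball_pos x hρ'
  have h3 : μ.real (ball x ρ) ≤ D * L ^ n * μ.real (ball x ρ') :=
    h.real_ball_le hρ' hL (by simpa using hle)
  have hD := h.const_pos
  have e1 : (μ.real (ball x ρ'))⁻¹ ≤ D * L ^ n * (μ.real (ball x ρ))⁻¹ := by
    rw [← div_eq_mul_inv, inv_le_comm₀ h2 (by positivity), inv_div, div_le_iff₀ (by positivity)]
    linarith
  have e2 : (r / ρ') ^ 2 ≤ L ^ 2 * (r / ρ) ^ 2 := by
    rw [← mul_pow, ← sq_abs (r / ρ'), ← sq_abs (L * (r / ρ)), abs_mul, abs_div, abs_div,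
      abs_of_pos hρ, abs_of_pos hρ', abs_of_pos (by linarith : 0 < L)]
    gcongr
    rw [mul_div_assoc', div_le_div_iff₀ hρ' hρ]
    nlinarith [abs_nonneg r]
  unfold ballWeight
  calc _ ≤ (D * L ^ n * (μ.real (ball x ρ))⁻¹) * (L ^ 2 * (r / ρ) ^ 2) := by gcongr
    _ = _ := by ring

theorem testWeight_le (h : BallGrowth μ n D) (x : X) {r : ℝ} (hr : 0 < r) (y : X) :
    testWeight μ x r 2 y ≤ D * 2 ^ n * ballWeight μ x r (r + dist x y) := by
  have hd : 0 ≤ dist x y := dist_nonneg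
  have h1 := h.real_ball_pos x hr
  have h2 := h.real_ball_pos x (by positivity : 0 < r + dist x y)
  have hD := h.const_pos
  have h0 : (0 : ℝ) ≤ μ.real (ball x (dist x y)) := measureReal_nonneg
  have h3 : μ.real (ball x (r + dist x y)) ≤
      D * 2 ^ n * (μ.real (ball x r) + μ.real (ball x (dist x y))) := by
    rcases le_total (dist x y) r with hle | hle
    · refine (h.real_ball_le hr one_le_two (by rw [dist_self]; linarith)).trans ?_
      gcongr; linarith
    · refine (h.real_ball_le (hr.trans_le hle) one_le_two (by rw [dist_self]; linarith)).trans ?_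
      gcongr; linarith
  unfold testWeight ballWeight
  rw [Real.rpow_two, ← mul_assoc]
  gcongr ?_ * _
  rw [one_div, ← div_eq_mul_inv, inv_le_comm₀ (by positivity) (by positivity), inv_div,
    div_le_iff₀ (by positivity)]
  linarith

theorem ballWeight_le (h : BallGrowth μ n D) (x : X) {r : ℝ} (hr : 0 < r) (y : X) :
    ballWeight μ x r (r + dist x y) ≤ 2 * testWeight μ x r 2 y := by
  have hd : 0 ≤ dist x y := dist_nonneg
  have h1 := h.real_ball_pos x hr
  have h2 := h.real_ball_pos x (by positivity : 0 < r + dist x y)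
  have h0 : (0 : ℝ) ≤ μ.real (ball x (dist x y)) := measureReal_nonneg
  have h3 := h.real_mono (ball_subset_ball (by linarith) : ball x r ⊆ ball x (r + dist x y))
  have h4 := h.real_mono
    (ball_subset_ball (by linarith) : ball x (dist x y) ⊆ ball x (r + dist x y))
  unfold testWeight ballWeight
  rw [Real.rpow_two, ← mul_assoc]
  gcongr ?_ * _
  rw [inv_eq_one_div, mul_one_div, div_le_div_iff₀ h2 (by positivity)]
  linarith

theorem isTestBound_of_isLocalTestBound (h : BallGrowth μ n D) {δ : ℝ} (hδ : 0 < δ) :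
    ∃ K : ℝ, 0 < K ∧ ∀ (x : X) (r : ℝ) (φ : X → 𝕜) (A : ℝ), 0 < r →
      IsLocalTestBound μ x r δ φ A → IsTestBound μ x r 1 2 φ (K * A) := by
  have hD := h.const_pos
  set M : ℝ := 1 + D * 2 ^ n * 2 ^ 2 with hM
  have hM1 : 1 ≤ M := by rw [hM]; have : 0 ≤ D * 2 ^ n * 2 ^ 2 := by positivity
                         linarith
  refine ⟨2 * (M * (1 + 1 / δ)), by positivity, fun x r φ A hr ⟨hA, hs, hreg⟩ => ?_⟩
  have hb : ∀ y, ballWeight μ x r (r + dist x y) ≤ 2 * testWeight μ x r 2 y :=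
    h.ballWeight_le x hr
  have hK : 1 ≤ M * (1 + 1 / δ) := by
    have : 0 ≤ 1 / δ := by positivity
    nlinarith
  refine ⟨by positivity, fun y => ?_, fun y z hyz => ?_⟩
  · have ht := testWeight_nonneg μ x hr.le (γ := 2) y
    calc ‖φ y‖ ≤ A * (2 * testWeight μ x r 2 y) :=
          (hs y).trans (mul_le_mul_of_nonneg_left (hb y) hA)
      _ = 2 * 1 * A * testWeight μ x r 2 y := by ring
      _ ≤ _ := by gcongr
  · rw [Real.rpow_one]
    have hρ : 0 < r + dist x y := by positivity
    have hw := ballWeight_nonneg μ x r (r + dist x y)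
    have ht := testWeight_nonneg μ x hr.le (γ := 2) y
    suffices hsuff : ‖φ y - φ z‖ ≤ A * (M * (1 + 1 / δ)) *
        (dist y z / (r + dist x y) * ballWeight μ x r (r + dist x y)) by
      refine hsuff.trans ?_
      calc _ ≤ A * (M * (1 + 1 / δ)) *
            (dist y z / (r + dist x y) * (2 * testWeight μ x r 2 y)) := by
            gcongr; exact hb y
        _ = _ := by ring
    rcases le_total (dist y z) (δ * (r + dist x y)) with hle | hle
    · refine (hreg y z hle).trans ?_
      gcongr
      exact le_mul_of_one_le_right hA hK
    · have hz : r + dist x y ≤ 2 * (r + dist x z) := by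
        have := dist_triangle x z y
        rw [dist_comm z y] at this
        linarith
      have hwz := h.ballWeight_le_of_le x r hρ (by positivity : 0 < r + dist x z) one_le_two hz
      have h1δ : 1 ≤ 1 / δ * (dist y z / (r + dist x y)) := by
        rw [div_mul_div_comm, one_mul, le_div_iff₀ (by positivity)]; linarith
      calc ‖φ y - φ z‖ ≤ ‖φ y‖ + ‖φ z‖ := norm_sub_le _ _
        _ ≤ A * ballWeight μ x r (r + dist x y) +
            A * (D * 2 ^ n * 2 ^ 2 * ballWeight μ x r (r + dist x y)) :=
            add_le_add (hs y) ((hs z).trans (by gcongr))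
        _ = A * (M * ballWeight μ x r (r + dist x y)) * 1 := by rw [hM]; ring
        _ ≤ A * (M * ballWeight μ x r (r + dist x y)) *
            (1 / δ * (dist y z / (r + dist x y))) := by gcongr
        _ = A * (M * (1 / δ)) *
            (dist y z / (r + dist x y) * ballWeight μ x r (r + dist x y)) := by ring
        _ ≤ _ := by gcongr; linarith

theorem isLocalTestBound_of_isTestBound (h : BallGrowth μ n D) {x : X} {r : ℝ} {φ : X → 𝕜}
    {C : ℝ} (hr : 0 < r) (hφ : IsTestBound μ x r 1 2 φ C) :
    IsLocalTestBound μ x r (1 / 2) φ (D * 2 ^ n * C) := by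
  have hD := h.const_pos
  have hC := hφ.1
  refine ⟨by positivity, fun y => (hφ.2.1 y).trans ?_, fun y z hyz =>
    (hφ.2.2 y z (by linarith)).trans ?_⟩
  · calc _ ≤ C * (D * 2 ^ n * ballWeight μ x r (r + dist x y)) := by
          gcongr; exact h.testWeight_le x hr y
      _ = _ := by ring
  · rw [Real.rpow_one]
    calc _ ≤ C * (dist y z / (r + dist x y) *
          (D * 2 ^ n * ballWeight μ x r (r + dist x y))) := by
          gcongr; exact h.testWeight_le x hr y
      _ = _ := by ring

/-- Test functions at comparable scales and centers are the same, with comparable norms. -/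
theorem isTestBound_transfer (h : BallGrowth μ n D) {L : ℝ} (hL : 1 ≤ L) :
    ∃ K : ℝ, 0 < K ∧ ∀ (x x' : X) (r r' : ℝ) (φ : X → 𝕜) (C : ℝ), 0 < r → 0 < r' →
      dist x x' ≤ L * r → r ≤ L * r' → r' ≤ L * r → IsTestBound μ x r 1 2 φ C →
        IsTestBound μ x' r' 1 2 φ (K * C) := by
  have hD := h.const_pos
  have hL0 : 0 < L := by linarith
  set P : ℝ := 2 * L ^ 2 with hP
  have hLP : L ≤ P := by nlinarith
  have hP1 : 1 ≤ P := hL.trans hLP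
  obtain ⟨K, hK, hK'⟩ := h.isTestBound_of_isLocalTestBound (𝕜 := 𝕜)
    (δ := 1 / 2 / P) (by positivity)
  set Q : ℝ := D * (P + L) ^ n * (L * P) ^ 2 with hQ
  refine ⟨K * (D * 2 ^ n * (P * Q)), by positivity,
    fun x x' r r' φ C hr hr' hd hrr' hr'r hφ => ?_⟩
  obtain ⟨hA, hs, hreg⟩ := h.isLocalTestBound_of_isTestBound hr hφ
  have hρ1 : ∀ y, r + dist x y ≤ P * (r' + dist x' y) := fun y => by
    have := dist_triangle x x' y
    have : L * r ≤ L * (L * r') := by gcongr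
    have : 0 ≤ dist x' y := dist_nonneg
    rw [hP]; nlinarith
  have hρ2 : ∀ y, r' + dist x' y ≤ P * (r + dist x y) := fun y => by
    have := dist_triangle x' x y
    rw [dist_comm x' x] at this
    have : 0 ≤ dist x y := dist_nonneg
    rw [hP]; nlinarith
  have hw : ∀ y, ballWeight μ x r (r + dist x y) ≤ Q * ballWeight μ x' r' (r' + dist x' y) := by
    intro y
    have hp : 0 < r + dist x y := by positivity
    have hp' : 0 < r' + dist x' y := by positivity
    have v := h.real_ball_pos x hp
    have v' := h.real_ball_pos x' hp'
    have hv : μ.real (ball x' (r' + dist x' y)) ≤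
        D * (P + L) ^ n * μ.real (ball x (r + dist x y)) := by
      refine h.real_ball_le hp (by linarith) ?_
      rw [dist_comm]
      have := hρ2 y
      have : 0 ≤ dist x y := dist_nonneg
      nlinarith
    have e1 : (μ.real (ball x (r + dist x y)))⁻¹ ≤
        D * (P + L) ^ n * (μ.real (ball x' (r' + dist x' y)))⁻¹ := by
      rw [← div_eq_mul_inv, inv_le_comm₀ v (by positivity), inv_div, div_le_iff₀ (by positivity)]
      linarith
    have e2 : r / (r + dist x y) ≤ L * P * (r' / (r' + dist x' y)) := by
      rw [mul_div_assoc', div_le_div_iff₀ hp hp']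
      calc r * (r' + dist x' y) ≤ (L * r') * (P * (r + dist x y)) := by
            gcongr; exact hρ2 y
        _ = _ := by ring
    unfold ballWeight
    calc _ ≤ (D * (P + L) ^ n * (μ.real (ball x' (r' + dist x' y)))⁻¹) *
          (L * P * (r' / (r' + dist x' y))) ^ 2 := by gcongr
      _ = _ := by rw [hQ]; ring
  have hQ0 : 0 < Q := by positivity
  have key := hK' x' r' φ (D * 2 ^ n * C * (P * Q)) hr'
    ⟨by positivity, fun y => (hs y).trans ?_, fun y z hyz => (hreg y z ?_).trans ?_⟩
  · convert key using 1; ring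
  · have := ballWeight_nonneg μ x' r' (r' + dist x' y)
    calc _ ≤ D * 2 ^ n * C * (Q * ballWeight μ x' r' (r' + dist x' y)) := by
          gcongr; exact hw y
      _ ≤ D * 2 ^ n * C * (P * Q * ballWeight μ x' r' (r' + dist x' y)) := by
          gcongr; exact le_mul_of_one_le_left hQ0.le hP1
      _ = _ := by ring
  · refine hyz.trans ?_
    calc _ ≤ 1 / 2 / P * (P * (r + dist x y)) := by gcongr; exact hρ2 y
      _ = _ := by field_simp
  · have hp : 0 < r + dist x y := by positivity
    have hp' : 0 < r' + dist x' y := by positivity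
    have e3 : dist y z / (r + dist x y) ≤ P * (dist y z / (r' + dist x' y)) := by
      rw [mul_div_assoc', div_le_div_iff₀ hp hp']
      have := hρ2 y
      have : 0 ≤ dist y z := dist_nonneg
      nlinarith
    have := ballWeight_nonneg μ x' r' (r' + dist x' y)
    have := ballWeight_nonneg μ x r (r + dist x y)
    calc _ ≤ D * 2 ^ n * C * (P * (dist y z / (r' + dist x' y)) *
          (Q * ballWeight μ x' r' (r' + dist x' y))) := by gcongr; exact hw y
      _ = _ := by ring

/-- Lipschitz functions supported in a ball of radius `L r` are test functions at scale `r`. -/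
theorem isTestBound_of_lipschitz (h : BallGrowth μ n D) {L : ℝ} (hL : 0 ≤ L) :
    ∃ K : ℝ, 0 < K ∧ ∀ (x : X) (r : ℝ) (φ : X → 𝕜) (a : ℝ), 0 < r → 0 ≤ a →
      (∀ y, φ y ≠ 0 → dist x y ≤ L * r) → (∀ y, ‖φ y‖ ≤ a / μ.real (ball x r)) →
      (∀ y z, ‖φ y - φ z‖ ≤ a / μ.real (ball x r) * (dist y z / r)) →
        IsTestBound μ x r 1 2 φ (K * a) := by
  have hD := h.const_pos
  obtain ⟨K, hK, hK'⟩ := h.isTestBound_of_isLocalTestBound (𝕜 := 𝕜)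
    (δ := 1 / 2) (by positivity)
  set P : ℝ := 2 * (1 + L) with hP
  have hP1 : 1 ≤ P := by linarith
  set Q : ℝ := D * P ^ n * P ^ 2 with hQ
  have hQ0 : 0 < Q := by positivity
  refine ⟨K * (P * Q), by positivity, fun x r φ a hr ha hsupp hs hlip => ?_⟩
  have hv := h.real_ball_pos x hr
  have hw : ∀ y, r + dist x y ≤ P * r →
      1 / μ.real (ball x r) ≤ Q * ballWeight μ x r (r + dist x y) := fun y hy => by
    have := h.ballWeight_le_of_le x r (by positivity : 0 < r + dist x y) hr hP1 hy
    rwa [ballWeight, div_self hr.ne', one_pow, mul_one, inv_eq_one_div] at this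
  have key := hK' x r φ (a * (P * Q)) hr
    ⟨by positivity, fun y => ?_, fun y z hyz => ?_⟩
  · convert key using 1; ring
  · have hw0 := ballWeight_nonneg μ x r (r + dist x y)
    by_cases hy : φ y = 0
    · rw [hy, norm_zero]; positivity
    · have := hsupp y hy
      calc ‖φ y‖ ≤ a * (1 / μ.real (ball x r)) := by rw [mul_one_div]; exact hs y
        _ ≤ a * (Q * ballWeight μ x r (r + dist x y)) := by
            gcongr; exact hw y (by rw [hP]; nlinarith)
        _ ≤ a * (P * Q * ballWeight μ x r (r + dist x y)) := by
            gcongr; exact le_mul_of_one_le_left hQ0.le hP1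
        _ = _ := by ring
  · have hw0 := ballWeight_nonneg μ x r (r + dist x y)
    have hp : 0 < r + dist x y := by positivity
    rcases le_or_gt (r + dist x y) (P * r) with hle | hlt
    · calc _ ≤ a / μ.real (ball x r) * (dist y z / r) := hlip y z
        _ = a * (1 / μ.real (ball x r)) * (dist y z / r) := by ring
        _ ≤ a * (Q * ballWeight μ x r (r + dist x y)) * (P * (dist y z / (r + dist x y))) := by
            gcongr
            · exact hw y hle
            · rw [mul_div_assoc', div_le_div_iff₀ hr hp]
              have : 0 ≤ dist y z := dist_nonneg
              nlinarith
        _ = _ := by ring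
    · have hy : φ y = 0 := by
        by_contra hy
        have := hsupp y hy
        rw [hP] at hlt; nlinarith
      have hz : φ z = 0 := by
        by_contra hz
        have := hsupp z hz
        have := dist_triangle x z y
        rw [dist_comm z y] at this
        rw [hP] at hlt; nlinarith
      rw [hy, hz, sub_zero, norm_zero]
      positivity

end BallGrowth

end

/-- A Lipschitz cutoff: `1` on `B(x,r)` and `0` off `B(x,2r)`. -/
noncomputable def ballCutoff {X : Type*} [MetricSpace X] (x : X) (r : ℝ) (y : X) : ℝ :=
  max 0 (min 1 (2 - dist x y / r))

section

variable {X : Type*} [MetricSpace X]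

theorem ballCutoff_nonneg (x : X) (r : ℝ) (y : X) : 0 ≤ ballCutoff x r y := le_max_left _ _

theorem ballCutoff_le_one (x : X) (r : ℝ) (y : X) : ballCutoff x r y ≤ 1 :=
  max_le zero_le_one (min_le_left _ _)

theorem ballCutoff_eq_one {x y : X} {r : ℝ} (hr : 0 < r) (h : dist x y ≤ r) :
    ballCutoff x r y = 1 := by
  have : dist x y / r ≤ 1 := (div_le_one hr).2 h
  rw [ballCutoff, min_eq_left (by linarith), max_eq_right zero_le_one]

theorem ballCutoff_eq_zero {x y : X} {r : ℝ} (hr : 0 < r) (h : 2 * r ≤ dist x y) :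
    ballCutoff x r y = 0 := by
  have : 2 ≤ dist x y / r := (le_div_iff₀ hr).2 h
  rw [ballCutoff, max_eq_left ((min_le_right _ _).trans (by linarith))]

theorem dist_le_of_ballCutoff_ne_zero {x y : X} {r : ℝ} (hr : 0 < r) (h : ballCutoff x r y ≠ 0) :
    dist x y ≤ 2 * r := by
  by_contra! hlt
  exact h (ballCutoff_eq_zero hr hlt.le)

theorem abs_ballCutoff_sub_le (x : X) {r : ℝ} (hr : 0 < r) (y z : X) :
    |ballCutoff x r y - ballCutoff x r z| ≤ dist y z / r := by
  have h1 : |dist x y / r - dist x z / r| ≤ dist y z / r := by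
    rw [← sub_div, abs_div, abs_of_pos hr]
    gcongr
    rw [dist_comm x y, dist_comm x z]
    exact abs_dist_sub_le y z x
  refine (abs_max_sub_max_le_abs _ _ 0 |>.trans_eq' ?_).trans
    ((abs_min_sub_min_le_max 1 (2 - dist x y / r) 1 (2 - dist x z / r)).trans ?_)
  · rw [ballCutoff, ballCutoff, max_comm 0, max_comm 0]
  · rw [sub_self, abs_zero, max_eq_right (abs_nonneg _), sub_sub_sub_cancel_left, abs_sub_comm]
    exact h1

theorem continuous_ballCutoff (x : X) (r : ℝ) : Continuous (ballCutoff x r) := by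
  unfold ballCutoff; fun_prop

end

/-- The cutoff normalized to have integral `1`. -/
noncomputable def ballKernel (𝕜 : Type*) [RCLike 𝕜] {X : Type*} [MetricSpace X] [MeasurableSpace X]
    (μ : Measure X) (x : X) (r : ℝ) (y : X) : 𝕜 :=
  ((ballCutoff x r y / ∫ z, ballCutoff x r z ∂μ : ℝ) : 𝕜)

section

variable {X : Type*} [MetricSpace X] [MeasurableSpace X] {𝕜 : Type*} [RCLike 𝕜]
  {μ : Measure X} {n D : ℝ}

theorem IsTestBound.continuous {x : X} {r C : ℝ} {φ : X → 𝕜} (hr : 0 < r)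
    (h : IsTestBound μ x r 1 2 φ C) : Continuous φ := by
  refine continuous_iff_continuousAt.2 fun y => ?_
  rw [ContinuousAt, tendsto_iff_norm_sub_tendsto_zero]
  have hρ : 0 < r + dist x y := by positivity
  have hlim : Tendsto (fun z => C * ((dist y z / (r + dist x y)) * testWeight μ x r 2 y))
      (𝓝 y) (𝓝 0) := by
    have : Continuous fun z => C * ((dist y z / (r + dist x y)) * testWeight μ x r 2 y) := by
      fun_prop
    convert this.tendsto y using 2
    simp
  refine squeeze_zero' (Eventually.of_forall fun z => norm_nonneg _) ?_ hlim
  filter_upwards [closedBall_mem_nhds y (half_pos hρ)] with z hz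
  have := h.2.2 y z (by rw [dist_comm]; exact hz)
  rwa [Real.rpow_one, norm_sub_rev] at this

theorem ballKernel_ne_zero {x y : X} {r : ℝ} (h : ballKernel 𝕜 μ x r y ≠ 0) :
    ballCutoff x r y ≠ 0 := fun h0 => h (by rw [ballKernel, h0]; simp)

namespace BallGrowth

/-- An integral against the weight `(r/ρ) / μ(B(x,ρ))`, `ρ = r + d(x,y)`, is controlled by the
averages over the balls centered at `x`. -/
theorem lintegral_weight_le [BorelSpace X] (h : BallGrowth μ n D) :
    ∃ K : ℝ, 0 < K ∧ ∀ (x : X) (r : ℝ) (M : ℝ≥0∞) (u : X → ℝ≥0∞), 0 < r → Measurable u →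
      (∀ ρ : ℝ, 0 < ρ → ∫⁻ y in ball x ρ, u y ∂μ ≤ M * μ (ball x ρ)) →
      ∫⁻ y, ENNReal.ofReal (r / (r + dist x y) * (μ.real (ball x (r + dist x y)))⁻¹) * u y ∂μ ≤
        ENNReal.ofReal K * M := by
  have hD := h.const_pos
  set P : ℝ := D * 2 ^ n with hP
  have hP0 : 0 < P := by positivity
  refine ⟨P * 2, by positivity, fun x r M u hr hu hM => ?_⟩
  set R : ℕ → ℝ := fun j => 2 ^ (j + 1) * r with hR
  have hR0 : ∀ j, 0 < R j := fun j => by positivity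
  set c : ℕ → ℝ := fun j => (1 / 2) ^ j * (P * (μ.real (ball x (R j)))⁻¹) with hc
  have hpt : ∀ y, ENNReal.ofReal (r / (r + dist x y) * (μ.real (ball x (r + dist x y)))⁻¹) * u y ≤
      ∑' j, ENNReal.ofReal (c j) * (ball x (R j)).indicator u y := by
    intro y
    have hρ : 0 < r + dist x y := by positivity
    obtain ⟨j, hj1, hj2⟩ := exists_nat_pow_near (x := (r + dist x y) / r) (y := (2 : ℝ))
      ((one_le_div hr).2 (by have : 0 ≤ dist x y := dist_nonneg
                             linarith)) one_lt_two
    rw [le_div_iff₀ hr] at hj1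
    rw [div_lt_iff₀ hr] at hj2
    refine le_trans ?_ (ENNReal.le_tsum j)
    have hmem : y ∈ ball x (R j) := by rw [mem_ball']; exact lt_of_le_of_lt (by linarith) hj2
    rw [Set.indicator_of_mem hmem]
    have hv := h.real_ball_pos x hρ
    have hvj := h.real_ball_pos x (hR0 j)
    have hV : μ.real (ball x (R j)) ≤ P * μ.real (ball x (r + dist x y)) :=
      h.real_ball_le hρ one_le_two (by rw [dist_self, zero_add, hR]; dsimp only
                                       rw [pow_succ]; linarith)
    gcongr ENNReal.ofReal ?_ * _
    refine mul_le_mul ?_ ?_ (by positivity) (by positivity)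
    · rw [one_div, inv_pow, inv_eq_one_div, div_le_div_iff₀ hρ (by positivity)]
      linarith
    · rw [← div_eq_mul_inv, inv_le_comm₀ hv (by positivity), inv_div, div_le_iff₀ hP0]
      linarith
  calc _ ≤ ∫⁻ y, ∑' j, ENNReal.ofReal (c j) * (ball x (R j)).indicator u y ∂μ :=
        lintegral_mono hpt
    _ = ∑' j, ENNReal.ofReal (c j) * ∫⁻ y in ball x (R j), u y ∂μ := by
        rw [lintegral_tsum fun j => ((hu.indicator measurableSet_ball).const_mul _).aemeasurable]
        congr 1; ext j
        rw [lintegral_const_mul' _ _ ENNReal.ofReal_ne_top, lintegral_indicator measurableSet_ball]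
    _ ≤ ∑' j, ENNReal.ofReal ((1 / 2) ^ j) * (ENNReal.ofReal P * M) := by
        refine ENNReal.tsum_le_tsum fun j => ?_
        have hvj := h.real_ball_pos x (hR0 j)
        calc _ ≤ ENNReal.ofReal (c j) * (M * ENNReal.ofReal (μ.real (ball x (R j)))) := by
              rw [h.ofReal_real_ball]; gcongr; exact hM _ (hR0 j)
          _ = ENNReal.ofReal (c j * μ.real (ball x (R j))) * M := by
              rw [ENNReal.ofReal_mul (p := c j) (by positivity)]; ring
          _ = _ := by
              rw [← mul_assoc, ← ENNReal.ofReal_mul (by positivity), hc]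
              congr 2; field_simp
    _ = _ := by
        rw [ENNReal.tsum_mul_right, ← ENNReal.ofReal_tsum_of_nonneg (fun j => by positivity)
          summable_geometric_two, tsum_geometric_two, ← mul_assoc,
          ← ENNReal.ofReal_mul (by norm_num), mul_comm P]

theorem ballWeight_le_weight (h : BallGrowth μ n D) (x : X) {r : ℝ} (hr : 0 < r) (y : X) :
    ballWeight μ x r (r + dist x y) ≤
      r / (r + dist x y) * (μ.real (ball x (r + dist x y)))⁻¹ := by
  have hρ : 0 < r + dist x y := by positivity
  have hv := h.real_ball_pos x hρ
  have h1 : r / (r + dist x y) ≤ 1 :=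
    (div_le_one hρ).2 (by have : 0 ≤ dist x y := dist_nonneg
                          linarith)
  rw [ballWeight, mul_comm]
  gcongr
  exact pow_le_of_le_one (by positivity) h1 two_ne_zero

theorem lintegral_enorm_testFunction_le [BorelSpace X] (h : BallGrowth μ n D) :
    ∃ K : ℝ, 0 < K ∧ ∀ (x : X) (r : ℝ) (φ : X → 𝕜) (C : ℝ), 0 < r →
      IsTestBound μ x r 1 2 φ C → ∫⁻ y, ‖φ y‖ₑ ∂μ ≤ ENNReal.ofReal (K * C) := by
  have hD := h.const_pos
  obtain ⟨K, hK, hK'⟩ := h.lintegral_weight_le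
  refine ⟨K * (D * 2 ^ n), by positivity, fun x r φ C hr hφ => ?_⟩
  obtain ⟨hA, hs, -⟩ := h.isLocalTestBound_of_isTestBound hr hφ
  have := hK' x r 1 (fun _ => 1) hr measurable_const (fun ρ _ => by simp)
  calc ∫⁻ y, ‖φ y‖ₑ ∂μ ≤ ∫⁻ y, ENNReal.ofReal (D * 2 ^ n * C) *
        (ENNReal.ofReal (r / (r + dist x y) * (μ.real (ball x (r + dist x y)))⁻¹) * 1) ∂μ := by
        refine lintegral_mono fun y => ?_
        rw [mul_one, ← ENNReal.ofReal_mul hA, ← ofReal_norm]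
        refine ENNReal.ofReal_le_ofReal ((hs y).trans ?_)
        gcongr
        exact h.ballWeight_le_weight x hr y
    _ ≤ ENNReal.ofReal (D * 2 ^ n * C) * (ENNReal.ofReal K * 1) := by
        rw [lintegral_const_mul' _ _ ENNReal.ofReal_ne_top]; gcongr
    _ = _ := by
        rw [mul_one, ← ENNReal.ofReal_mul hA]; congr 1; ring

theorem integrable_testFunction [BorelSpace X] (h : BallGrowth μ n D) {x : X} {r C : ℝ}
    {φ : X → 𝕜} (hr : 0 < r) (hφ : IsTestBound μ x r 1 2 φ C) : Integrable φ μ := by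
  have := h.secondCountableTopology x
  obtain ⟨K, -, hK⟩ := h.lintegral_enorm_testFunction_le (𝕜 := 𝕜)
  exact ⟨(hφ.continuous hr).aestronglyMeasurable,
    (hK x r φ C hr hφ).trans_lt ENNReal.ofReal_lt_top⟩

theorem norm_integral_testFunction_le [BorelSpace X] (h : BallGrowth μ n D) :
    ∃ K : ℝ, 0 < K ∧ ∀ (x : X) (r : ℝ) (φ : X → 𝕜) (C : ℝ), 0 < r →
      IsTestBound μ x r 1 2 φ C → ‖∫ y, φ y ∂μ‖ ≤ K * C := by
  obtain ⟨K, hK, hK'⟩ := h.lintegral_enorm_testFunction_le (𝕜 := 𝕜)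
  refine ⟨K, hK, fun x r φ C hr hφ => ?_⟩
  have hC := hφ.1
  have := (enorm_integral_le_lintegral_enorm φ).trans (hK' x r φ C hr hφ)
  rwa [← ofReal_norm, ENNReal.ofReal_le_ofReal_iff (by positivity)] at this

theorem integrable_ballCutoff [BorelSpace X] (h : BallGrowth μ n D) (x : X) {r : ℝ} (hr : 0 < r) :
    Integrable (ballCutoff x r) μ := by
  have := h.secondCountableTopology x
  have h1 : Integrable ((ball x (2 * r)).indicator fun _ => (1 : ℝ)) μ :=
    (integrable_indicator_iff measurableSet_ball).2
      (integrableOn_const (h.measure_ball_lt_top _ _).ne)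
  refine h1.mono' (continuous_ballCutoff x r).aestronglyMeasurable (ae_of_all _ fun y => ?_)
  rw [Real.norm_of_nonneg (ballCutoff_nonneg x r y)]
  by_cases hy : y ∈ ball x (2 * r)
  · rw [Set.indicator_of_mem hy]; exact ballCutoff_le_one x r y
  · rw [Set.indicator_of_notMem hy, ballCutoff_eq_zero hr (by
      rw [mem_ball', not_lt] at hy; exact hy)]

theorem real_ball_le_integral_ballCutoff [BorelSpace X] (h : BallGrowth μ n D) (x : X) {r : ℝ}
    (hr : 0 < r) : μ.real (ball x r) ≤ ∫ y, ballCutoff x r y ∂μ := by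
  rw [← integral_indicator_one measurableSet_ball]
  refine integral_mono ((integrable_indicator_iff measurableSet_ball).2
      (integrableOn_const (h.measure_ball_lt_top _ _).ne)) (h.integrable_ballCutoff x hr)
      fun y => ?_
  by_cases hy : y ∈ ball x r
  · rw [Set.indicator_of_mem hy, ballCutoff_eq_one hr (mem_ball'.1 hy).le]; rfl
  · rw [Set.indicator_of_notMem hy]; exact ballCutoff_nonneg x r y

theorem integral_ballKernel [BorelSpace X] (h : BallGrowth μ n D) (x : X) {r : ℝ} (hr : 0 < r) :
    ∫ y, ballKernel 𝕜 μ x r y ∂μ = 1 := by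
  have := (h.real_ball_pos x hr).trans_le (h.real_ball_le_integral_ballCutoff x hr)
  unfold ballKernel
  rw [integral_ofReal, integral_div, div_self this.ne', RCLike.ofReal_one]

theorem norm_ballKernel_le [BorelSpace X] (h : BallGrowth μ n D) (x : X) {r : ℝ} (hr : 0 < r)
    (y : X) : ‖ballKernel 𝕜 μ x r y‖ ≤ 1 / μ.real (ball x r) := by
  have hv := h.real_ball_pos x hr
  have hle := h.real_ball_le_integral_ballCutoff x hr
  rw [ballKernel, RCLike.norm_ofReal, abs_div, abs_of_pos (hv.trans_le hle),
    abs_of_nonneg (ballCutoff_nonneg x r y)]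
  exact div_le_div₀ zero_le_one (ballCutoff_le_one x r y) hv hle

theorem norm_ballKernel_sub_le [BorelSpace X] (h : BallGrowth μ n D) (x : X) {r : ℝ} (hr : 0 < r)
    (y z : X) :
    ‖ballKernel 𝕜 μ x r y - ballKernel 𝕜 μ x r z‖ ≤ 1 / μ.real (ball x r) * (dist y z / r) := by
  have hv := h.real_ball_pos x hr
  have hle := h.real_ball_le_integral_ballCutoff x hr
  rw [ballKernel, ballKernel, ← RCLike.ofReal_sub, RCLike.norm_ofReal, ← sub_div, abs_div,
    abs_of_pos (hv.trans_le hle), one_div_mul_eq_div]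
  exact div_le_div₀ (by positivity) (abs_ballCutoff_sub_le x hr y z) hv hle

theorem isTestBound_ballKernel [BorelSpace X] (h : BallGrowth μ n D) :
    ∃ K : ℝ, 0 < K ∧ ∀ (x : X) (r : ℝ), 0 < r →
      IsTestBound μ x r 1 2 (ballKernel 𝕜 μ x r) K := by
  obtain ⟨K, hK, hK'⟩ := h.isTestBound_of_lipschitz (𝕜 := 𝕜) (L := 2) zero_le_two
  refine ⟨K, hK, fun x r hr => ?_⟩
  have := hK' x r (ballKernel 𝕜 μ x r) 1 hr zero_le_one (fun y hy =>
    dist_le_of_ballCutoff_ne_zero hr (ballKernel_ne_zero hy)) (h.norm_ballKernel_le x hr)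
    (h.norm_ballKernel_sub_le x hr)
  rwa [mul_one] at this

theorem exists_isTestBound_transfer (h : BallGrowth μ n D) (x x' : X) {r r' : ℝ} (hr : 0 < r)
    (hr' : 0 < r') : ∃ K : ℝ, 0 < K ∧ ∀ (φ : X → 𝕜) (C : ℝ), IsTestBound μ x r 1 2 φ C →
      IsTestBound μ x' r' 1 2 φ (K * C) := by
  set L : ℝ := 1 + (dist x x' / r + (r / r' + r' / r)) with hL
  have e1 : 0 ≤ dist x x' / r := by positivity
  have e2 : 0 ≤ r / r' := by positivity
  have e3 : 0 ≤ r' / r := by positivity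
  obtain ⟨K, hK, hK'⟩ := h.isTestBound_transfer (𝕜 := 𝕜) (L := L) (by linarith)
  exact ⟨K, hK, fun φ C hφ => hK' x x' r r' φ C hr hr' ((div_le_iff₀ hr).1 (by linarith))
    ((div_le_iff₀ hr').1 (by linarith)) ((div_le_iff₀ hr).1 (by linarith)) hφ⟩

/-- The space of test functions does not depend on the center and the scale. -/
theorem mem_testSpace_of_isTestBound (h : BallGrowth μ n D) (x₁ : X) {x : X} {r C : ℝ}
    {φ : X → 𝕜} (hr : 0 < r) (hφ : IsTestBound μ x r 1 2 φ C) : φ ∈ testSpace 𝕜 μ x₁ 1 1 2 := by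
  obtain ⟨K, -, hK⟩ := h.exists_isTestBound_transfer (𝕜 := 𝕜) x x₁ hr one_pos
  exact ⟨_, hK φ C hφ⟩

/-- A Lipschitz function with bounded support is a test function. -/
theorem mem_testSpace_of_lipschitz (h : BallGrowth μ n D) (x₁ : X) {φ : X → 𝕜} {R a b : ℝ}
    (hsupp : ∀ y, φ y ≠ 0 → dist x₁ y ≤ R) (hs : ∀ y, ‖φ y‖ ≤ a)
    (hlip : ∀ y z, ‖φ y - φ z‖ ≤ b * dist y z) : φ ∈ testSpace 𝕜 μ x₁ 1 1 2 := by
  obtain ⟨K, -, hK⟩ := h.isTestBound_of_lipschitz (𝕜 := 𝕜) (L := max R 0) (le_max_right _ _)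
  have hv := h.real_ball_pos x₁ one_pos
  refine ⟨_, hK x₁ 1 φ (max 0 (max a b) * μ.real (ball x₁ 1)) one_pos (by positivity)
    (fun y hy => (hsupp y hy).trans (by rw [mul_one]; exact le_max_left _ _)) (fun y => ?_)
    fun y z => ?_⟩
  · rw [mul_div_cancel_right₀ _ hv.ne']
    exact (hs y).trans ((le_max_left a b).trans (le_max_right _ _))
  · rw [mul_div_cancel_right₀ _ hv.ne', div_one]
    refine (hlip y z).trans ?_
    gcongr
    exact (le_max_right a b).trans (le_max_right _ _)

end BallGrowth

end

section

variable {X : Type*} [MetricSpace X] [MeasurableSpace X] {𝕜 : Type*} [RCLike 𝕜]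
  {μ : Measure X} {n D : ℝ}

theorem exists_le_of_setLIntegral_lt [BorelSpace X] {g : X → ℝ} {E : Set X} {q a ρ : ℝ} {y : X}
    (hq : 0 ≤ q) (ha : 0 ≤ a) (hE : μ E = 0)
    (hlt : ∫⁻ z in ball y ρ, ENNReal.ofReal (g z ^ q) ∂μ < ENNReal.ofReal (a ^ q) * μ (ball y ρ)) :
    ∃ z ∈ ball y ρ, z ∉ E ∧ g z ≤ a := by
  by_contra! hcon
  refine hlt.not_ge ?_
  rw [← setLIntegral_const]
  refine lintegral_mono_ae ?_
  filter_upwards [ae_restrict_mem measurableSet_ball,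
    ae_restrict_of_ae (measure_eq_zero_iff_ae_notMem.1 hE)] with z hz hzE
  exact ENNReal.ofReal_le_ofReal (Real.rpow_le_rpow ha (hcon z hz hzE).le hq)

namespace BallGrowth

/-- Chaining towards points where the gradient is small. -/
theorem exists_chain [BorelSpace X] (h : BallGrowth μ n D) {s q θ w A : ℝ} (hs : 0 < s)
    (hq : 0 < q) (hθ : 0 < θ) (hθ1 : θ < 1) (hw : 1 < w) (hθn : θ ^ n = w⁻¹)
    (hθs : 2 * θ ^ s = w) (hwq : 2 ^ q = w) (hA : 1 ≤ A) (hAq : D * (4 / (1 - θ)) ^ n < A ^ q)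
    {f : X → 𝕜} {g : X → ℝ} {E : Set X} (hE : μ E = 0)
    (hfg : ∀ x, x ∉ E → ∀ y, y ∉ E → ‖f x - f y‖ ≤ dist x y ^ s * (g x + g y))
    {x : X} {R T : ℝ} (hR : 0 < R) (hT : 0 < T)
    (hav : ∫⁻ z in ball x (2 * R), ENNReal.ofReal (g z ^ q) ∂μ ≤
      ENNReal.ofReal (T ^ q) * μ (ball x (2 * R))) (k : ℕ) :
    ∀ y, y ∉ E → dist x y < R * (1 + θ ^ k) → g y ≤ 2 ^ k * (A * T) →
      ∃ z, z ∉ E ∧ dist x z < 2 * R ∧ g z ≤ A * T ∧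
        ‖f y - f z‖ ≤ 4 / (w - 1) * w ^ k * (R ^ s * (A * T)) := by
  have hD := h.const_pos
  have hn := h.exponent_pos
  have hA0 : 0 < A := by linarith
  have hw0 : 0 < w - 1 := by linarith
  have hθ0 : 0 < 1 - θ := by linarith
  induction k with
  | zero =>
    intro y hy hxy hgy
    refine ⟨y, hy, by rw [pow_zero] at hxy; linarith, by simpa using hgy, ?_⟩
    rw [sub_self, norm_zero]; positivity
  | succ k ih =>
    intro y hy hxy hgy
    set ρ : ℝ := R * θ ^ k * (1 - θ) with hρ
    have hρ0 : 0 < ρ := by positivity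
    have hθk : 0 < θ ^ k := by positivity
    have hθk1 : θ ^ k ≤ 1 := pow_le_one₀ hθ.le hθ1.le
    have hsum : R * (1 + θ ^ (k + 1)) + ρ = R * (1 + θ ^ k) := by rw [hρ, pow_succ]; ring
    have hRk : R * (1 + θ ^ k) ≤ 2 * R := by nlinarith
    have hwk : (2 ^ k : ℝ) ^ q = w ^ k := by rw [← Real.rpow_pow_comm two_pos.le, hwq]
    have hθkn : (θ ^ k) ^ n = (w ^ k)⁻¹ := by rw [← Real.rpow_pow_comm hθ.le, hθn, inv_pow]
    have hθks : 2 ^ k * (θ ^ k) ^ s = w ^ k := by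
      rw [← Real.rpow_pow_comm hθ.le, ← mul_pow, hθs]
    have hlt : ∫⁻ z in ball y ρ, ENNReal.ofReal (g z ^ q) ∂μ <
        ENNReal.ofReal ((2 ^ k * (A * T)) ^ q) * μ (ball y ρ) := by
      have hL1 : 1 ≤ 4 * R / ρ := by
        rw [one_le_div hρ0]
        have : 0 < R * (1 + θ ^ (k + 1)) := by positivity
        linarith
      have hLn : (4 * R / ρ) ^ n = (4 / (1 - θ)) ^ n * w ^ k := by
        rw [show 4 * R / ρ = 4 / (1 - θ) * (θ ^ k)⁻¹ by rw [hρ]; field_simp,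
          Real.mul_rpow (by positivity) (by positivity), Real.inv_rpow hθk.le, hθkn, inv_inv]
      calc ∫⁻ z in ball y ρ, ENNReal.ofReal (g z ^ q) ∂μ
          ≤ ∫⁻ z in ball x (2 * R), ENNReal.ofReal (g z ^ q) ∂μ :=
            lintegral_mono_set (ball_subset_ball' (by rw [dist_comm]; linarith))
        _ ≤ ENNReal.ofReal (T ^ q) * μ (ball x (2 * R)) := hav
        _ ≤ ENNReal.ofReal (T ^ q) * (ENNReal.ofReal (D * (4 * R / ρ) ^ n) * μ (ball y ρ)) := by
            gcongr
            exact h.measure_ball_le hρ0 hL1 (by rw [div_mul_cancel₀ _ hρ0.ne']; linarith)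
        _ = ENNReal.ofReal (T ^ q * (D * (4 * R / ρ) ^ n)) * μ (ball y ρ) := by
            rw [← mul_assoc, ← ENNReal.ofReal_mul (by positivity)]
        _ < _ := by
            refine ENNReal.mul_lt_mul_left (h.measure_ball_pos y ρ hρ0).ne'
              (h.measure_ball_lt_top y ρ).ne ((ENNReal.ofReal_lt_ofReal_iff (by positivity)).2 ?_)
            rw [hLn, Real.mul_rpow (by positivity) (by positivity),
              Real.mul_rpow hA0.le hT.le, hwk]
            have : 0 < T ^ q * w ^ k := by positivity
            nlinarith
    obtain ⟨y', hy', hy'E, hgy'⟩ := exists_le_of_setLIntegral_lt hq.le (by positivity) hE hlt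
    rw [mem_ball'] at hy'
    obtain ⟨z, hzE, hz, hgz, hfz⟩ := ih y' hy'E
      (by have := dist_triangle x y y'; linarith) hgy'
    refine ⟨z, hzE, hz, hgz, ?_⟩
    have hstep : ‖f y - f y'‖ ≤ 4 * w ^ k * (R ^ s * (A * T)) := by
      calc ‖f y - f y'‖ ≤ dist y y' ^ s * (g y + g y') := hfg y hy y' hy'E
        _ ≤ dist y y' ^ s * (2 ^ (k + 1) * (A * T) + 2 ^ k * (A * T)) := by gcongr
        _ ≤ ρ ^ s * (4 * 2 ^ k * (A * T)) := by
            gcongr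
            rw [pow_succ]
            have : 0 < 2 ^ k * (A * T) := by positivity
            linarith
        _ = (1 - θ) ^ s * (4 * (2 ^ k * (θ ^ k) ^ s) * (R ^ s * (A * T))) := by
            rw [hρ, Real.mul_rpow (by positivity) hθ0.le, Real.mul_rpow hR.le hθk.le]; ring
        _ ≤ 1 * (4 * (2 ^ k * (θ ^ k) ^ s) * (R ^ s * (A * T))) := by
            gcongr
            exact Real.rpow_le_one hθ0.le (by linarith) hs.le
        _ = _ := by rw [one_mul, hθks]
    calc ‖f y - f z‖ ≤ ‖f y - f y'‖ + ‖f y' - f z‖ := norm_sub_le_norm_sub_add_norm_sub _ _ _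
      _ ≤ 4 * w ^ k * (R ^ s * (A * T)) + 4 / (w - 1) * w ^ k * (R ^ s * (A * T)) :=
          add_le_add hstep hfz
      _ = _ := by rw [pow_succ]; field_simp; ring

/-- A pointwise Sobolev–Poincaré inequality, with exponent `q = n / (n + s)`, on all balls
centered at a point `x` with a bound on the averages of `g ^ q`. -/
theorem exists_norm_sub_const_le [BorelSpace X] (h : BallGrowth μ n D) {s : ℝ} (hs : 0 < s)
    (hs1 : s ≤ 1) :
    ∃ K : ℝ, 0 < K ∧ ∀ (f : X → 𝕜) (g : X → ℝ) (E : Set X), (∀ x, 0 ≤ g x) → μ E = 0 →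
      (∀ x, x ∉ E → ∀ y, y ∉ E → ‖f x - f y‖ ≤ dist x y ^ s * (g x + g y)) →
      ∀ (x : X) (r T : ℝ), 0 < r → 0 < T →
      (∀ ρ : ℝ, 0 < ρ → ∫⁻ z in ball x ρ, ENNReal.ofReal (g z ^ (n / (n + s))) ∂μ ≤
        ENNReal.ofReal (T ^ (n / (n + s))) * μ (ball x ρ)) →
      ∃ c : 𝕜, ∀ y, y ∉ E → ‖f y - c‖ ≤
        K * (r + dist x y) ^ s * (T + T ^ (1 - n / (n + s)) * g y ^ (n / (n + s))) := by
  have hD := h.const_pos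
  have hn := h.exponent_pos
  set q : ℝ := n / (n + s) with hqdef
  have hq : 0 < q := by positivity
  have hq1 : q ≤ 1 := (div_le_one (by positivity)).2 (by linarith)
  set w : ℝ := 2 ^ q with hwdef
  have hw : 1 < w := Real.one_lt_rpow one_lt_two hq
  set θ : ℝ := 2 ^ (-(n + s)⁻¹) with hθdef
  have hθ : 0 < θ := by positivity
  have hθ1 : θ < 1 := Real.rpow_lt_one_of_one_lt_of_neg one_lt_two (by
    rw [neg_lt_zero]; positivity)
  have hθn : θ ^ n = w⁻¹ := by
    rw [hθdef, ← Real.rpow_mul two_pos.le, hwdef, ← Real.rpow_neg two_pos.le]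
    congr 1; rw [hqdef]; field_simp
  have hθs : 2 * θ ^ s = w := by
    rw [hθdef, ← Real.rpow_mul two_pos.le, ← Real.rpow_one_add' two_pos.le, hwdef, hqdef]
    · congr 1; field_simp; ring
    · have : 1 + -(n + s)⁻¹ * s = n / (n + s) := by field_simp; ring
      rw [this]; positivity
  have hθ0 : 0 < 1 - θ := by linarith
  set A : ℝ := (D * (4 / (1 - θ)) ^ n + 1) ^ (1 / q) with hAdef
  have hAq' : A ^ q = D * (4 / (1 - θ)) ^ n + 1 := by
    rw [hAdef, ← Real.rpow_mul (by positivity), one_div_mul_cancel hq.ne', Real.rpow_one]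
  have hAq : D * (4 / (1 - θ)) ^ n < A ^ q := by rw [hAq']; linarith
  have hA : 1 < A := Real.one_lt_rpow (by
    have : 0 < D * (4 / (1 - θ)) ^ n := by positivity
    linarith) (by positivity)
  have hA0 : 0 < A := by linarith
  have hw0 : 0 < w - 1 := by linarith
  refine ⟨4 / (w - 1) * w * A + 8 * A, by positivity,
    fun f g E hg hE hfg x r T hr hT hav => ?_⟩
  have hAT : 0 < A * T := by positivity
  obtain ⟨z₀, hz₀, hz₀E, hgz₀⟩ := exists_le_of_setLIntegral_lt (g := g) (y := x) (ρ := r)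
    (a := A * T) hq.le hAT.le hE (by
      refine (hav r hr).trans_lt (ENNReal.mul_lt_mul_left (h.measure_ball_pos x r hr).ne'
        (h.measure_ball_lt_top x r).ne ((ENNReal.ofReal_lt_ofReal_iff (by positivity)).2 ?_))
      exact Real.rpow_lt_rpow hT.le (by nlinarith) hq)
  refine ⟨f z₀, fun y hy => ?_⟩
  set R : ℝ := r + dist x y with hR
  have hR0 : 0 < R := by positivity
  have hxy : dist x y < R := by linarith
  have hanchor : ∀ z, z ∉ E → dist x z < 2 * R → g z ≤ A * T →
      ‖f z - f z₀‖ ≤ 8 * A * (R ^ s * T) := fun z hzE hz hgz => by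
    rw [mem_ball'] at hz₀
    have hd : dist z z₀ ≤ 4 * R := by
      have := dist_triangle z x z₀
      rw [dist_comm z x] at this
      have : 0 ≤ dist x y := dist_nonneg
      linarith
    calc ‖f z - f z₀‖ ≤ dist z z₀ ^ s * (g z + g z₀) := hfg z hzE z₀ hz₀E
      _ ≤ (4 * R) ^ s * (A * T + A * T) := by
          have := hg z; have := hg z₀; gcongr
      _ = 4 ^ s * R ^ s * (2 * (A * T)) := by rw [Real.mul_rpow (by norm_num) hR0.le]; ring
      _ ≤ 4 * R ^ s * (2 * (A * T)) := by
          gcongr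
          exact (Real.rpow_le_rpow_of_exponent_le (by norm_num) hs1).trans_eq (Real.rpow_one 4)
      _ = _ := by ring
  have hgyq : 0 ≤ g y ^ q := Real.rpow_nonneg (hg y) q
  rcases le_or_gt (g y) (A * T) with hgy | hgy
  · refine (hanchor y hy (by linarith) hgy).trans ?_
    calc 8 * A * (R ^ s * T) = 8 * A * R ^ s * (T + 0) := by ring
      _ ≤ _ := by
          gcongr
          · exact le_add_of_nonneg_left (by positivity)
          · positivity
  · obtain ⟨k, hk1, hk2⟩ := exists_nat_pow_near (x := g y / (A * T)) (y := (2 : ℝ))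
      ((one_le_div hAT).2 hgy.le) one_lt_two
    obtain ⟨z, hzE, hz, hgz, hfz⟩ := h.exists_chain hs hq hθ hθ1 hw hθn hθs rfl hA.le hAq hE hfg
      hR0 hT (hav (2 * R) (by positivity)) (k + 1) y hy
      (by have : 0 < R * θ ^ (k + 1) := by positivity
          linarith) ((div_lt_iff₀ hAT).1 hk2).le
    have hwk : w ^ k * (A * T) ≤ A * (T ^ (1 - q) * g y ^ q) := by
      have e1 : w ^ k ≤ g y ^ q / (A * T) ^ q := by
        rw [← Real.div_rpow (hg y) hAT.le, hwdef, Real.rpow_pow_comm two_pos.le]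
        exact Real.rpow_le_rpow (by positivity) hk1 hq.le
      calc w ^ k * (A * T) ≤ g y ^ q / (A * T) ^ q * (A * T) := by gcongr
        _ = (A * T) ^ (1 - q) * g y ^ q := by
            rw [Real.rpow_sub hAT, Real.rpow_one]; field_simp
        _ = A ^ (1 - q) * (T ^ (1 - q) * g y ^ q) := by
            rw [Real.mul_rpow hA0.le hT.le]; ring
        _ ≤ A * (T ^ (1 - q) * g y ^ q) := by
            gcongr
            exact (Real.rpow_le_rpow_of_exponent_le hA.le (by linarith)).trans_eq (Real.rpow_one A)
    calc ‖f y - f z₀‖ ≤ ‖f y - f z‖ + ‖f z - f z₀‖ := norm_sub_le_norm_sub_add_norm_sub _ _ _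
      _ ≤ 4 / (w - 1) * w ^ (k + 1) * (R ^ s * (A * T)) + 8 * A * (R ^ s * T) :=
          add_le_add hfz (hanchor z hzE hz hgz)
      _ = 4 / (w - 1) * w * R ^ s * (w ^ k * (A * T)) + 8 * A * (R ^ s * T) := by
          rw [pow_succ]; ring
      _ ≤ 4 / (w - 1) * w * R ^ s * (A * (T ^ (1 - q) * g y ^ q)) + 8 * A * (R ^ s * T) := by
          gcongr
      _ ≤ 4 / (w - 1) * w * R ^ s * (A * (T ^ (1 - q) * g y ^ q)) + 8 * A * (R ^ s * T) +
          (4 / (w - 1) * w * R ^ s * (A * T) +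
            8 * A * (R ^ s * (T ^ (1 - q) * g y ^ q))) := by
          exact le_add_of_nonneg_right (by positivity)
      _ = _ := by ring

/-- The oscillation of `f` against a test function at a point `x` with a bound on the averages of
`g ^ q`, `q = n / (n + s)`. -/
theorem exists_lintegral_sub_const_mul_le [BorelSpace X] (h : BallGrowth μ n D) {s : ℝ}
    (hs : 0 < s) (hs1 : s ≤ 1) :
    ∃ K : ℝ, 0 < K ∧ ∀ (f : X → 𝕜) (g : X → ℝ), g ∈ hajlaszGradients μ s f →
      ∀ (x : X) (r T : ℝ), 0 < r → 0 < T →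
      (∀ ρ : ℝ, 0 < ρ → ∫⁻ z in ball x ρ, ENNReal.ofReal (g z ^ (n / (n + s))) ∂μ ≤
        ENNReal.ofReal (T ^ (n / (n + s))) * μ (ball x ρ)) →
      ∃ c : 𝕜, ∀ (φ : X → 𝕜) (C : ℝ), IsTestBound μ x r 1 2 φ C →
        ∫⁻ y, ‖(f y - c) * φ y‖ₑ ∂μ ≤ ENNReal.ofReal (K * C * (r ^ s * T)) := by
  have hD := h.const_pos
  have hn := h.exponent_pos
  obtain ⟨K, hK, hK'⟩ := h.exists_norm_sub_const_le (𝕜 := 𝕜) hs hs1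
  obtain ⟨K₁, hK₁, hK₁'⟩ := h.lintegral_weight_le
  set q : ℝ := n / (n + s) with hqdef
  have hq : 0 < q := by positivity
  refine ⟨K * (D * 2 ^ n) * (K₁ * 2), by positivity, fun f g ⟨hgm, hg, E, hE, hfg⟩ x r T hr hT
    hav => ?_⟩
  obtain ⟨c, hc⟩ := hK' f g E hg hE hfg x r T hr hT hav
  refine ⟨c, fun φ C hφ => ?_⟩
  obtain ⟨hA, hsz, -⟩ := h.isLocalTestBound_of_isTestBound hr hφ
  have hC := hφ.1
  set v : X → ℝ := fun y => T + T ^ (1 - q) * g y ^ q with hv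
  have hv0 : ∀ y, 0 ≤ v y := fun y => by
    have := Real.rpow_nonneg (hg y) q
    positivity
  have hvm : Measurable v := measurable_const.add (measurable_const.mul (hgm.pow_const q))
  have hgq : Measurable fun y => ENNReal.ofReal (g y ^ q) := (hgm.pow_const q).ennreal_ofReal
  have hvav : ∀ ρ : ℝ, 0 < ρ → ∫⁻ y in ball x ρ, ENNReal.ofReal (v y) ∂μ ≤
      ENNReal.ofReal (2 * T) * μ (ball x ρ) := fun ρ hρ => by
    calc ∫⁻ y in ball x ρ, ENNReal.ofReal (v y) ∂μ
        = ∫⁻ y in ball x ρ, (ENNReal.ofReal T +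
            ENNReal.ofReal (T ^ (1 - q)) * ENNReal.ofReal (g y ^ q)) ∂μ := by
          refine lintegral_congr fun y => ?_
          have := Real.rpow_nonneg (hg y) q
          rw [hv, ENNReal.ofReal_add hT.le (by positivity), ENNReal.ofReal_mul (by positivity)]
      _ ≤ ENNReal.ofReal T * μ (ball x ρ) +
          ENNReal.ofReal (T ^ (1 - q)) * (ENNReal.ofReal (T ^ q) * μ (ball x ρ)) := by
          rw [lintegral_add_left measurable_const, setLIntegral_const,
            lintegral_const_mul' _ _ ENNReal.ofReal_ne_top]
          gcongr
          exact hav ρ hρ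
      _ = _ := by
          rw [← mul_assoc, ← add_mul, ← ENNReal.ofReal_mul (by positivity),
            ← Real.rpow_add hT, sub_add_cancel, Real.rpow_one,
            ← ENNReal.ofReal_add hT.le hT.le, two_mul]
  have hpt : ∀ y, y ∉ E → ‖(f y - c) * φ y‖ₑ ≤ ENNReal.ofReal (K * (D * 2 ^ n) * C * r ^ s) *
      (ENNReal.ofReal (r / (r + dist x y) * (μ.real (ball x (r + dist x y)))⁻¹) *
        ENNReal.ofReal (v y)) := fun y hy => by
    have hρ : 0 < r + dist x y := by positivity
    have hvol := h.real_ball_pos x hρ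
    have hvy := hv0 y
    rw [← ENNReal.ofReal_mul (by positivity), ← ENNReal.ofReal_mul (by positivity), ← ofReal_norm,
      norm_mul]
    refine ENNReal.ofReal_le_ofReal ?_
    have hratio : (r + dist x y) ^ s * (r / (r + dist x y)) ≤ r ^ s := by
      have h1 : r / (r + dist x y) ≤ 1 := (div_le_one hρ).2 (by
        have : 0 ≤ dist x y := dist_nonneg
        linarith)
      calc _ ≤ (r + dist x y) ^ s * (r / (r + dist x y)) ^ s := by
            gcongr
            exact Real.self_le_rpow_of_le_one (by positivity) h1 hs1
        _ = r ^ s := by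
            rw [← Real.mul_rpow hρ.le (by positivity), mul_div_cancel₀ _ hρ.ne']
    calc ‖f y - c‖ * ‖φ y‖ ≤ (K * (r + dist x y) ^ s * v y) *
          (D * 2 ^ n * C * ballWeight μ x r (r + dist x y)) := by
          gcongr
          · exact hc y hy
          · exact hsz y
      _ = K * (D * 2 ^ n) * C * ((r + dist x y) ^ s * (r / (r + dist x y))) *
          (r / (r + dist x y) * (μ.real (ball x (r + dist x y)))⁻¹ * v y) := by
          rw [ballWeight]; ring
      _ ≤ _ := by gcongr
  calc ∫⁻ y, ‖(f y - c) * φ y‖ₑ ∂μ ≤ ∫⁻ y, ENNReal.ofReal (K * (D * 2 ^ n) * C * r ^ s) *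
      (ENNReal.ofReal (r / (r + dist x y) * (μ.real (ball x (r + dist x y)))⁻¹) *
        ENNReal.ofReal (v y)) ∂μ := by
        refine lintegral_mono_ae ?_
        filter_upwards [measure_eq_zero_iff_ae_notMem.1 hE] with y hy using hpt y hy
    _ ≤ ENNReal.ofReal (K * (D * 2 ^ n) * C * r ^ s) *
        (ENNReal.ofReal K₁ * ENNReal.ofReal (2 * T)) := by
        rw [lintegral_const_mul' _ _ ENNReal.ofReal_ne_top]
        gcongr
        exact hK₁' x r _ _ hr hvm.ennreal_ofReal hvav
    _ = _ := by
        rw [← ENNReal.ofReal_mul hK₁.le, ← ENNReal.ofReal_mul (by positivity)]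
        congr 1; ring

end BallGrowth

end

section

variable {X : Type*} [MetricSpace X] [MeasurableSpace X] {𝕜 : Type*} [RCLike 𝕜]
  {μ : Measure X} {n D : ℝ}

theorem two_zpow_neg_rpow (k : ℤ) (s : ℝ) :
    (((2 : ℝ) ^ (-k)) ^ s) = ((2 : ℝ) ^ ((k : ℝ) * s))⁻¹ := by
  rw [← Real.rpow_intCast, ← Real.rpow_mul two_pos.le, ← Real.rpow_neg two_pos.le]
  congr 1; push_cast; ring

theorem enorm_le_grandFunction {x₁ : X} {s C : ℝ} (Λ : testSpace 𝕜 μ x₁ 1 1 2 →ₗ[𝕜] 𝕜) {x : X}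
    {k : ℤ} {φ : testSpace 𝕜 μ x₁ 1 1 2} (hC : 0 < C) (hint : ∫ y, (φ : X → 𝕜) y ∂μ = 0)
    (hφ : IsTestBound μ x ((2 : ℝ) ^ (-k)) 1 2 (φ : X → 𝕜) C) :
    ‖Λ φ‖ₑ ≤ ENNReal.ofReal (C * ((2 : ℝ) ^ (-k)) ^ s) * grandFunction μ x₁ s Λ x := by
  have hmem : ((C⁻¹ : ℝ) : 𝕜) • φ ∈ testClass 𝕜 μ x₁ k x := by
    refine mem_testClass_iff.2 ⟨?_, ?_⟩
    · simp only [Submodule.coe_smul, Pi.smul_apply]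
      rw [integral_smul, hint, smul_zero]
    · have := hφ.smul ((C⁻¹ : ℝ) : 𝕜)
      rwa [RCLike.norm_ofReal, abs_of_pos (inv_pos.2 hC), inv_mul_cancel₀ hC.ne'] at this
  have h1 : ENNReal.ofReal ((2 : ℝ) ^ ((k : ℝ) * s)) * ‖Λ (((C⁻¹ : ℝ) : 𝕜) • φ)‖ₑ ≤
      grandFunction μ x₁ s Λ x :=
    le_trans (mul_le_mul' le_rfl (le_iSup₂ (f := fun ψ (_ : ψ ∈ testClass 𝕜 μ x₁ k x) => ‖Λ ψ‖ₑ)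
      _ hmem)) (le_iSup (fun k : ℤ => ENNReal.ofReal ((2 : ℝ) ^ ((k : ℝ) * s)) *
        ⨆ φ ∈ testClass 𝕜 μ x₁ k x, ‖Λ φ‖ₑ) k)
  have h2 : ‖Λ (((C⁻¹ : ℝ) : 𝕜) • φ)‖ₑ = ENNReal.ofReal C⁻¹ * ‖Λ φ‖ₑ := by
    rw [map_smul, smul_eq_mul, enorm_mul, ← ofReal_norm (((C⁻¹ : ℝ) : 𝕜)), RCLike.norm_ofReal,
      abs_of_pos (inv_pos.2 hC)]
  have hP : 0 < (2 : ℝ) ^ ((k : ℝ) * s) := by positivity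
  calc ‖Λ φ‖ₑ = ENNReal.ofReal (C * ((2 : ℝ) ^ (-k)) ^ s) *
        (ENNReal.ofReal ((2 : ℝ) ^ ((k : ℝ) * s)) * (ENNReal.ofReal C⁻¹ * ‖Λ φ‖ₑ)) := by
        rw [← mul_assoc, ← mul_assoc, ← ENNReal.ofReal_mul (by positivity),
          ← ENNReal.ofReal_mul (by positivity), two_zpow_neg_rpow]
        have : C * ((2 : ℝ) ^ ((k : ℝ) * s))⁻¹ * (2 : ℝ) ^ ((k : ℝ) * s) * C⁻¹ = 1 := by
          field_simp
        rw [this, ENNReal.ofReal_one, one_mul]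
    _ ≤ _ := by rw [← h2]; gcongr

theorem grandNorm_eq_lintegral {x₁ : X} {s p : ℝ} (hp : 0 < p)
    (Λ : testSpace 𝕜 μ x₁ 1 1 2 →ₗ[𝕜] 𝕜) :
    grandNorm μ x₁ s p Λ = (∫⁻ x, grandFunction μ x₁ s Λ x ^ p ∂μ) ^ (1 / p) := by
  rw [grandNorm, eLpNorm_eq_lintegral_rpow_enorm_toReal (by simpa using hp)
    ENNReal.ofReal_ne_top, ENNReal.toReal_ofReal hp.le]
  simp only [enorm_eq_self]

theorem eLpNorm_eq_lintegral_of_nonneg {X : Type*} [MeasurableSpace X] {μ : Measure X} {p : ℝ}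
    (hp : 0 < p) {g : X → ℝ} (hg : ∀ x, 0 ≤ g x) :
    eLpNorm g (ENNReal.ofReal p) μ = (∫⁻ x, ENNReal.ofReal (g x ^ p) ∂μ) ^ (1 / p) := by
  rw [eLpNorm_eq_lintegral_rpow_enorm_toReal (by simpa using hp)
    ENNReal.ofReal_ne_top, ENNReal.toReal_ofReal hp.le]
  congr 1
  refine lintegral_congr fun x => ?_
  rw [← ofReal_norm, Real.norm_of_nonneg (hg x), ENNReal.ofReal_rpow_of_nonneg (hg x) hp.le]

namespace BallGrowth

/-- The maximal function of `g ^ q` in `L^{p/q}`, for `q < p`. -/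
theorem lintegral_ballMaximal_rpow_div_le [BorelSpace X] (h : BallGrowth μ n D) (x₁ : X)
    {q p : ℝ} (hq : 0 < q) (hqp : q < p) : ∃ C : ℝ, 0 < C ∧ ∀ g : X → ℝ, Measurable g →
      (∀ x, 0 ≤ g x) → ∫⁻ x, ballMaximal μ (fun z => ENNReal.ofReal (g z ^ q)) x ^ (p / q) ∂μ ≤
        ENNReal.ofReal C * ∫⁻ x, ENNReal.ofReal (g x ^ p) ∂μ := by
  obtain ⟨C, hC, hC'⟩ := h.lintegral_ballMaximal_rpow_le x₁ ((one_lt_div hq).2 hqp)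
  refine ⟨C, hC, fun g hgm hg => ?_⟩
  have := hC' (fun z => g z ^ q) (hgm.pow_const q) fun z => Real.rpow_nonneg (hg z) q
  simp_rw [← Real.rpow_mul (hg _), mul_div_cancel₀ p hq.ne'] at this
  exact this

/-- A real number `T` above `(M u)^{1/q}` bounds the averages of `u`. -/
theorem setLIntegral_ball_le_of_rpow_le (h : BallGrowth μ n D) {q T : ℝ} (hq : 0 < q)
    (hT : 0 ≤ T) {u : X → ℝ≥0∞} {x : X} (hM : ballMaximal μ u x ^ (1 / q) ≤ ENNReal.ofReal T)
    {ρ : ℝ} (hρ : 0 < ρ) :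
    ∫⁻ z in ball x ρ, u z ∂μ ≤ ENNReal.ofReal (T ^ q) * μ (ball x ρ) := by
  refine (h.setLIntegral_ball_le u x hρ).trans ?_
  gcongr
  rw [← ENNReal.ofReal_rpow_of_nonneg hT hq.le]
  calc ballMaximal μ u x = (ballMaximal μ u x ^ (1 / q)) ^ q := by
        rw [← ENNReal.rpow_mul, one_div_mul_cancel hq.ne', ENNReal.rpow_one]
    _ ≤ _ := by gcongr

/-- The grand function of `f` is controlled by the maximal function of its gradients. -/
theorem grandFunction_le_ballMaximal [BorelSpace X] (h : BallGrowth μ n D) (x₁ : X) {s : ℝ}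
    (hs : 0 < s) (hs1 : s ≤ 1) :
    ∃ K : ℝ, 0 < K ∧ ∀ (f : X → 𝕜) (g : X → ℝ) (Λ : testSpace 𝕜 μ x₁ 1 1 2 →ₗ[𝕜] 𝕜),
      g ∈ hajlaszGradients μ s f → Represents μ x₁ f Λ → ∀ x, grandFunction μ x₁ s Λ x ≤
        ENNReal.ofReal K * ballMaximal μ (fun z => ENNReal.ofReal (g z ^ (n / (n + s)))) x ^
          (1 / (n / (n + s))) := by
  obtain ⟨K, hK, hK'⟩ := h.exists_lintegral_sub_const_mul_le (𝕜 := 𝕜) hs hs1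
  have hn := h.exponent_pos
  have hq : 0 < n / (n + s) := by positivity
  refine ⟨K, hK, fun f g Λ hg hΛ x => ?_⟩
  set S := ballMaximal μ (fun z => ENNReal.ofReal (g z ^ (n / (n + s)))) x ^ (1 / (n / (n + s)))
  by_cases hS : S = ∞
  · rw [hS, ENNReal.mul_top (by simpa using hK)]; exact le_top
  refine ENNReal.le_of_forall_pos_le_add fun ε hε _ => ?_
  have hε' : (0 : ℝ) < ε := hε
  set T : ℝ := S.toReal + ε / K with hT
  have hT0 : 0 < T := by positivity
  have hST : S ≤ ENNReal.ofReal T := by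
    rw [← ENNReal.ofReal_toReal hS]
    exact ENNReal.ofReal_le_ofReal (by rw [hT]; have : 0 < ε / K := by positivity
                                       linarith)
  have hKT : ENNReal.ofReal (K * T) = ENNReal.ofReal K * S + ε := by
    rw [hT, mul_add, mul_div_cancel₀ _ hK.ne', ENNReal.ofReal_add (by positivity) hε'.le,
      ENNReal.ofReal_mul hK.le, ENNReal.ofReal_toReal hS, ENNReal.ofReal_coe_nnreal]
  rw [← hKT]
  refine iSup_le fun k => ?_
  set r : ℝ := (2 : ℝ) ^ (-k) with hr
  have hr0 : 0 < r := by positivity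
  obtain ⟨c, hc⟩ := hK' f g hg x r T hr0 hT0
    (fun ρ hρ => h.setLIntegral_ball_le_of_rpow_le hq hT0.le hST hρ)
  rw [ENNReal.mul_iSup]
  refine iSup_le fun φ => ?_
  rw [ENNReal.mul_iSup]
  refine iSup_le fun hφ => ?_
  obtain ⟨hint, hφ⟩ := mem_testClass_iff.1 hφ
  have hφi := h.integrable_testFunction hr0 hφ
  have hΛφ : Λ φ = ∫ y, (f y - c) * (φ : X → 𝕜) y ∂μ := by
    simp_rw [sub_mul]
    rw [integral_sub (hΛ φ).1 (hφi.const_mul c), integral_const_mul, hint, mul_zero, sub_zero,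
      (hΛ φ).2]
  calc ENNReal.ofReal ((2 : ℝ) ^ ((k : ℝ) * s)) * ‖Λ φ‖ₑ ≤
      ENNReal.ofReal ((2 : ℝ) ^ ((k : ℝ) * s)) * ENNReal.ofReal (K * 1 * (r ^ s * T)) := by
        gcongr
        rw [hΛφ]
        exact (enorm_integral_le_lintegral_enorm _).trans (hc φ 1 hφ)
    _ = _ := by
        rw [← ENNReal.ofReal_mul (by positivity), hr, two_zpow_neg_rpow]
        congr 1; field_simp

theorem grandNorm_le_eLpNorm [BorelSpace X] (h : BallGrowth μ n D) (x₁ : X) {s p : ℝ}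
    (hs : 0 < s) (hs1 : s ≤ 1) (hp : n / (n + s) < p) :
    ∃ K : ℝ, 0 < K ∧ ∀ (f : X → 𝕜) (g : X → ℝ) (Λ : testSpace 𝕜 μ x₁ 1 1 2 →ₗ[𝕜] 𝕜),
      g ∈ hajlaszGradients μ s f → Represents μ x₁ f Λ →
        grandNorm μ x₁ s p Λ ≤ ENNReal.ofReal K * eLpNorm g (ENNReal.ofReal p) μ := by
  have hn := h.exponent_pos
  obtain ⟨K, hK, hK'⟩ := h.grandFunction_le_ballMaximal (𝕜 := 𝕜) x₁ hs hs1
  set q : ℝ := n / (n + s) with hqdef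
  have hq : 0 < q := by positivity
  have hp0 : 0 < p := hq.trans hp
  obtain ⟨C, hC, hC'⟩ := h.lintegral_ballMaximal_rpow_div_le x₁ hq hp
  refine ⟨K * C ^ (1 / p), by positivity, fun f g Λ hg hΛ => ?_⟩
  rw [grandNorm_eq_lintegral hp0, eLpNorm_eq_lintegral_of_nonneg hp0 hg.2.1]
  calc (∫⁻ x, grandFunction μ x₁ s Λ x ^ p ∂μ) ^ (1 / p) ≤
      (∫⁻ x, ENNReal.ofReal (K ^ p) *
        ballMaximal μ (fun z => ENNReal.ofReal (g z ^ q)) x ^ (p / q) ∂μ) ^ (1 / p) := by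
        gcongr with x
        calc _ ≤ (ENNReal.ofReal K * ballMaximal μ (fun z => ENNReal.ofReal (g z ^ q)) x ^
              (1 / q)) ^ p := by gcongr; exact hK' f g Λ hg hΛ x
          _ = _ := by
            rw [ENNReal.mul_rpow_of_nonneg _ _ hp0.le, ENNReal.ofReal_rpow_of_nonneg hK.le hp0.le,
              ← ENNReal.rpow_mul, one_div_mul_eq_div]
    _ ≤ (ENNReal.ofReal (K ^ p) * (ENNReal.ofReal C *
        ∫⁻ x, ENNReal.ofReal (g x ^ p) ∂μ)) ^ (1 / p) := by
        rw [lintegral_const_mul' _ _ ENNReal.ofReal_ne_top]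
        gcongr
        exact hC' g hg.1 hg.2.1
    _ = _ := by
        have hp1 : 0 ≤ 1 / p := by positivity
        rw [ENNReal.mul_rpow_of_nonneg _ _ hp1, ENNReal.mul_rpow_of_nonneg _ _ hp1,
          ENNReal.ofReal_rpow_of_nonneg (by positivity) hp1,
          ENNReal.ofReal_rpow_of_nonneg hC.le hp1, ← mul_assoc,
          ← ENNReal.ofReal_mul (by positivity), ← Real.rpow_mul hK.le,
          mul_one_div_cancel hp0.ne', Real.rpow_one]

theorem grandNorm_le_hajlaszNorm [BorelSpace X] (h : BallGrowth μ n D) (x₁ : X) {s p : ℝ}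
    (hs : 0 < s) (hs1 : s ≤ 1) (hp : n / (n + s) < p) :
    ∃ K : ℝ, 0 < K ∧ ∀ (f : X → 𝕜) (Λ : testSpace 𝕜 μ x₁ 1 1 2 →ₗ[𝕜] 𝕜),
      Represents μ x₁ f Λ → grandNorm μ x₁ s p Λ ≤ ENNReal.ofReal K * hajlaszNorm μ s p f := by
  obtain ⟨K, hK, hK'⟩ := h.grandNorm_le_eLpNorm (𝕜 := 𝕜) x₁ hs hs1 hp
  refine ⟨K, hK, fun f Λ hΛ => ?_⟩
  have hK0 : ENNReal.ofReal K ≠ 0 := by simpa using hK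
  rw [hajlaszNorm, ← ENNReal.div_le_iff' hK0 ENNReal.ofReal_ne_top]
  refine le_iInf₂ fun g hg => ?_
  rw [ENNReal.div_le_iff' hK0 ENNReal.ofReal_ne_top]
  exact hK' f g Λ hg hΛ

theorem neBot_ae (h : BallGrowth μ n D) (x₁ : X) : (ae μ).NeBot := by
  rw [ae_neBot]
  rintro rfl
  exact (h.measure_ball_pos x₁ 1 one_pos).ne' (by simp)

/-- A function with an `L^p` gradient pairs with all test functions. -/
theorem exists_lintegral_mul_testFunction_le [BorelSpace X] (h : BallGrowth μ n D) (x₁ : X)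
    {s p : ℝ} (hs : 0 < s) (hs1 : s ≤ 1) (hp : n / (n + s) < p) {f : X → 𝕜} {g : X → ℝ}
    (hg : g ∈ hajlaszGradients μ s f) (hgp : eLpNorm g (ENNReal.ofReal p) μ ≠ ∞) :
    ∃ B : ℝ, 0 ≤ B ∧ ∀ (φ : X → 𝕜) (C : ℝ), IsTestBound μ x₁ 1 1 2 φ C →
      ∫⁻ y, ‖f y * φ y‖ₑ ∂μ ≤ ENNReal.ofReal (B * C) := by
  have hn := h.exponent_pos
  obtain ⟨K, hK, hK'⟩ := h.exists_lintegral_sub_const_mul_le (𝕜 := 𝕜) hs hs1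
  set q : ℝ := n / (n + s) with hqdef
  have hq : 0 < q := by positivity
  have hp0 : 0 < p := hq.trans hp
  obtain ⟨C₀, hC₀, hC₀'⟩ := h.lintegral_ballMaximal_rpow_div_le x₁ hq hp
  set M := ballMaximal μ fun z => ENNReal.ofReal (g z ^ q)
  have hfin : ∫⁻ x, M x ^ (p / q) ∂μ ≠ ∞ := by
    refine ne_top_of_le_ne_top ?_ (hC₀' g hg.1 hg.2.1)
    refine ENNReal.mul_ne_top ENNReal.ofReal_ne_top fun htop => hgp ?_
    rw [eLpNorm_eq_lintegral_of_nonneg hp0 hg.2.1, htop, ENNReal.top_rpow_of_pos (by positivity)]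
  have := h.neBot_ae x₁
  obtain ⟨x₀, hx₀⟩ := (ae_lt_top ((measurable_ballMaximal μ _).pow_const _) hfin).exists
  have hS : M x₀ ^ (1 / q) ≠ ∞ := fun htop => by
    rw [ENNReal.rpow_eq_top_iff_of_pos (by positivity)] at htop
    refine hx₀.ne ?_
    change M x₀ ^ (p / q) = ∞
    rw [htop, ENNReal.top_rpow_of_pos (by positivity)]
  set T : ℝ := (M x₀ ^ (1 / q)).toReal + 1 with hT
  have hT0 : 0 < T := by positivity
  have hST : M x₀ ^ (1 / q) ≤ ENNReal.ofReal T := by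
    rw [← ENNReal.ofReal_toReal hS]
    exact ENNReal.ofReal_le_ofReal (by rw [hT]; linarith)
  obtain ⟨c, hc⟩ := hK' f g hg x₀ 1 T one_pos hT0
    (fun ρ hρ => h.setLIntegral_ball_le_of_rpow_le hq hT0.le hST hρ)
  obtain ⟨K₁, hK₁, hK₁'⟩ := h.exists_isTestBound_transfer (𝕜 := 𝕜) x₁ x₀ one_pos one_pos
  obtain ⟨K₂, hK₂, hK₂'⟩ := h.lintegral_enorm_testFunction_le (𝕜 := 𝕜)
  refine ⟨K * K₁ * (1 ^ s * T) + ‖c‖ * K₂, by positivity, fun φ C hφ => ?_⟩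
  have hC := hφ.1
  calc ∫⁻ y, ‖f y * φ y‖ₑ ∂μ ≤ ∫⁻ y, (‖(f y - c) * φ y‖ₑ + ‖c‖ₑ * ‖φ y‖ₑ) ∂μ := by
        gcongr with y
        rw [← enorm_mul]
        refine le_trans (le_of_eq ?_) (enorm_add_le _ _)
        congr 1; ring
    _ ≤ ENNReal.ofReal (K * (K₁ * C) * (1 ^ s * T)) + ‖c‖ₑ * ENNReal.ofReal (K₂ * C) := by
        have hφm : Measurable φ := (hφ.continuous one_pos).measurable
        rw [lintegral_add_right _ (hφm.enorm.const_mul _),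
          lintegral_const_mul _ hφm.enorm]
        gcongr
        · exact hc φ _ (hK₁' φ C hφ)
        · exact hK₂' x₁ 1 φ C one_pos hφ
    _ = _ := by
        rw [← ofReal_norm, ← ENNReal.ofReal_mul (norm_nonneg c),
          ← ENNReal.ofReal_add (by positivity) (by positivity)]
        congr 1; ring

/-- A function in `Ṁ^{s,p}` induces a bounded functional on the test functions. -/
theorem exists_represents [BorelSpace X] (h : BallGrowth μ n D) (x₁ : X) {s p : ℝ} (hs : 0 < s)
    (hs1 : s ≤ 1) (hp : n / (n + s) < p) {f : X → 𝕜} (hf : AEStronglyMeasurable f μ)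
    {g : X → ℝ} (hg : g ∈ hajlaszGradients μ s f)
    (hgp : eLpNorm g (ENNReal.ofReal p) μ ≠ ∞) :
    ∃ Λ : testSpace 𝕜 μ x₁ 1 1 2 →ₗ[𝕜] 𝕜, Represents μ x₁ f Λ ∧ MemGrand μ x₁ s p Λ := by
  have := h.secondCountableTopology x₁
  obtain ⟨B, hB, hB'⟩ := h.exists_lintegral_mul_testFunction_le x₁ hs hs1 hp hg hgp
  have hint : ∀ φ : testSpace 𝕜 μ x₁ 1 1 2, Integrable (fun x => f x * (φ : X → 𝕜) x) μ :=
    fun φ => by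
      have hφ := isTestBound_testNorm φ.2
      exact ⟨hf.mul (hφ.continuous one_pos).aestronglyMeasurable,
        (hB' φ _ hφ).trans_lt ENNReal.ofReal_lt_top⟩
  let Λ : testSpace 𝕜 μ x₁ 1 1 2 →ₗ[𝕜] 𝕜 :=
    { toFun := fun φ => ∫ x, f x * (φ : X → 𝕜) x ∂μ
      map_add' := fun φ ψ => by
        rw [← integral_add (hint φ) (hint ψ)]
        simp only [Submodule.coe_add, Pi.add_apply, mul_add]
      map_smul' := fun c φ => by
        rw [RingHom.id_apply, smul_eq_mul, ← integral_const_mul]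
        simp only [Submodule.coe_smul, Pi.smul_apply, smul_eq_mul, mul_left_comm] }
  have hΛ : Represents μ x₁ f Λ := fun φ => ⟨hint φ, rfl⟩
  refine ⟨Λ, hΛ, ⟨B, fun φ => ?_⟩, ?_⟩
  · have hφ := isTestBound_testNorm φ.2
    have hN := hφ.1
    have := (enorm_integral_le_lintegral_enorm _).trans (hB' φ _ hφ)
    rwa [← ofReal_norm, ENNReal.ofReal_le_ofReal_iff (by positivity)] at this
  · obtain ⟨K, -, hK'⟩ := h.grandNorm_le_eLpNorm (𝕜 := 𝕜) x₁ hs hs1 hp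
    exact (hK' f g Λ hg hΛ).trans_lt (ENNReal.mul_lt_top ENNReal.ofReal_lt_top hgp.lt_top)

end BallGrowth

end

section

variable {X : Type*} [MetricSpace X] [MeasurableSpace X] {𝕜 : Type*} [RCLike 𝕜]
  {μ : Measure X} {n D : ℝ}

/-- A lower semicontinuous function comparable with `grandFunction`. -/
noncomputable def grandMajorant (μ : Measure X) (x₁ : X) (s : ℝ)
    (Λ : testSpace 𝕜 μ x₁ 1 1 2 →ₗ[𝕜] 𝕜) (x : X) : ℝ≥0∞ :=
  ⨆ (k : ℤ) (y : X), (ball y ((2 : ℝ) ^ (-k))).indicator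
    (fun _ => ENNReal.ofReal ((2 : ℝ) ^ ((k : ℝ) * s)) * ⨆ φ ∈ testClass 𝕜 μ x₁ k y, ‖Λ φ‖ₑ) x

theorem measurable_grandMajorant [BorelSpace X] (μ : Measure X) (x₁ : X) (s : ℝ)
    (Λ : testSpace 𝕜 μ x₁ 1 1 2 →ₗ[𝕜] 𝕜) : Measurable (grandMajorant μ x₁ s Λ) := by
  apply LowerSemicontinuous.measurable
  exact lowerSemicontinuous_iSup fun k => lowerSemicontinuous_iSup fun y =>
    isOpen_ball.lowerSemicontinuous_indicator zero_le

theorem grandFunction_le_grandMajorant (μ : Measure X) (x₁ : X) (s : ℝ)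
    (Λ : testSpace 𝕜 μ x₁ 1 1 2 →ₗ[𝕜] 𝕜) (x : X) :
    grandFunction μ x₁ s Λ x ≤ grandMajorant μ x₁ s Λ x := by
  refine iSup_mono fun k => le_trans ?_ (le_iSup _ x)
  rw [Set.indicator_of_mem (mem_ball_self (by positivity))]

/-- A function with a Hajłasz gradient is measurable. -/
theorem aestronglyMeasurable_of_mem_hajlaszGradients [BorelSpace X]
    [SecondCountableTopology X] {s : ℝ} (hs : 0 < s) {f : X → 𝕜} {g : X → ℝ}
    (hg : g ∈ hajlaszGradients μ s f) : AEStronglyMeasurable f μ := by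
  obtain ⟨hgm, hg0, E, hE, hfg⟩ := hg
  let F := toMeasurable μ E
  let S : ℕ → Set X := fun N => {x | g x ≤ N} \ F
  have hS : ∀ N, MeasurableSet (S N) := fun N =>
    (measurableSet_le hgm measurable_const).diff (measurableSet_toMeasurable _ _)
  have hFE : ∀ x, x ∉ F → x ∉ E := fun x hx hxE => hx (subset_toMeasurable μ E hxE)
  have hcont : ∀ N, ContinuousOn f (S N) := by
    intro N x hx
    rw [ContinuousWithinAt, tendsto_iff_norm_sub_tendsto_zero]
    have hlim : Tendsto (fun y => dist y x ^ s * (N + N : ℝ)) (𝓝[S N] x) (𝓝 0) := by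
      have : Continuous fun y => dist y x ^ s * (N + N : ℝ) :=
        ((continuous_id.dist continuous_const).rpow_const fun _ => Or.inr hs.le).mul
          continuous_const
      have := this.tendsto x
      rw [dist_self, Real.zero_rpow hs.ne', zero_mul] at this
      exact this.mono_left nhdsWithin_le_nhds
    refine squeeze_zero' (Eventually.of_forall fun y => norm_nonneg _) ?_ hlim
    filter_upwards [self_mem_nhdsWithin] with y hy
    refine (hfg y (hFE y hy.2) x (hFE x hx.2)).trans ?_
    have h1 : g y ≤ N := hy.1
    have h2 : g x ≤ N := hx.1
    gcongr
  have hmem : ∀ᵐ x ∂μ, x ∈ ⋃ N, S N := by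
    have hF : μ F = 0 := by rw [measure_toMeasurable, hE]
    filter_upwards [measure_eq_zero_iff_ae_notMem.1 hF] with x hx
    obtain ⟨N, hN⟩ := exists_nat_ge (g x)
    exact Set.mem_iUnion.2 ⟨N, hN, hx⟩
  rw [← Measure.restrict_eq_self_of_ae_mem hmem, aestronglyMeasurable_iUnion_iff]
  exact fun N => (hcont N).aestronglyMeasurable (hS N)

namespace BallGrowth

theorem memLp_ball_of_mem_hajlaszGradients [BorelSpace X] (h : BallGrowth μ n D) (x₁ : X)
    {s : ℝ} {p : ℝ≥0∞} (hs : 0 < s) {f : X → 𝕜} {g : X → ℝ} (hg : g ∈ hajlaszGradients μ s f)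
    (hgp : MemLp g p μ) (x : X) (r : ℝ) : MemLp f p (μ.restrict (ball x r)) := by
  have := h.secondCountableTopology x₁
  have hf := aestronglyMeasurable_of_mem_hajlaszGradients hs hg
  obtain ⟨hgm, hg0, E, hE, hfg⟩ := hg
  have hEae := measure_eq_zero_iff_ae_notMem.1 hE
  have := h.neBot_ae x₁
  obtain ⟨y₀, hy₀⟩ := hEae.exists
  have hfinite : IsFiniteMeasure (μ.restrict (ball x r)) :=
    isFiniteMeasure_restrict.2 (h.measure_ball_lt_top x r).ne
  obtain ⟨R, hR⟩ : ∃ R, R = (r + dist x y₀) ^ s := ⟨_, rfl⟩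
  have hb1 : MemLp (fun y => g y + g y₀) p (μ.restrict (ball x r)) :=
    (hgp.restrict (ball x r)).add (memLp_const (g y₀))
  have hbound : MemLp (fun y => ‖f y₀‖ + R * (g y + g y₀)) p (μ.restrict (ball x r)) :=
    (memLp_const ‖f y₀‖).add (hb1.const_mul R)
  refine hbound.mono' hf.restrict ?_
  filter_upwards [ae_restrict_mem measurableSet_ball, ae_restrict_of_ae hEae] with y hy hyE
  have h1 : ‖f y - f y₀‖ ≤ R * (g y + g y₀) := by
    refine (hfg y hyE y₀ hy₀).trans ?_
    have := hg0 y
    have := hg0 y₀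
    have hd : dist y y₀ ≤ r + dist x y₀ :=
      (dist_triangle y x y₀).trans (by have := mem_ball.1 hy; linarith)
    rw [hR]
    gcongr
  have := norm_sub_norm_le (f y) (f y₀)
  linarith

theorem exists_grandMajorant_le [BorelSpace X] (h : BallGrowth μ n D) (x₁ : X) (s : ℝ) :
    ∃ K : ℝ, 0 < K ∧ ∀ (Λ : testSpace 𝕜 μ x₁ 1 1 2 →ₗ[𝕜] 𝕜) (x : X),
      grandMajorant μ x₁ s Λ x ≤ ENNReal.ofReal K * grandFunction μ x₁ s Λ x := by
  obtain ⟨K, hK, hK'⟩ := h.isTestBound_transfer (𝕜 := 𝕜) (L := 1) le_rfl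
  refine ⟨K, hK, fun Λ x => iSup₂_le fun k y => ?_⟩
  have hr : (0 : ℝ) < 2 ^ (-k) := by positivity
  by_cases hx : x ∈ ball y ((2 : ℝ) ^ (-k))
  swap; · rw [Set.indicator_of_notMem hx]; exact zero_le
  rw [Set.indicator_of_mem hx, ENNReal.mul_iSup]
  refine iSup_le fun φ => ?_
  rw [ENNReal.mul_iSup]
  refine iSup_le fun hφ => ?_
  obtain ⟨hint, hφ⟩ := mem_testClass_iff.1 hφ
  have hφ' := hK' y x _ _ _ 1 hr hr (by rw [one_mul]; exact (mem_ball'.1 hx).le)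
    (one_mul _).ge (one_mul _).ge hφ
  calc _ ≤ ENNReal.ofReal ((2 : ℝ) ^ ((k : ℝ) * s)) *
        (ENNReal.ofReal (K * 1 * ((2 : ℝ) ^ (-k)) ^ s) * grandFunction μ x₁ s Λ x) := by
        gcongr; exact enorm_le_grandFunction Λ (by positivity) hint hφ'
    _ = _ := by
        rw [← mul_assoc, ← ENNReal.ofReal_mul (by positivity), two_zpow_neg_rpow]
        congr 2; field_simp

variable (𝕜) in
/-- The averaging kernel at scale `2^{-k}` as a test function. -/
noncomputable def kernel [BorelSpace X] (h : BallGrowth μ n D) (x₁ x : X) (k : ℤ) :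
    testSpace 𝕜 μ x₁ 1 1 2 :=
  ⟨ballKernel 𝕜 μ x ((2 : ℝ) ^ (-k)), by
    obtain ⟨K, -, hK⟩ := h.isTestBound_ballKernel (𝕜 := 𝕜)
    exact h.mem_testSpace_of_isTestBound x₁ (by positivity) (hK x _ (by positivity))⟩

theorem exists_enorm_kernel_sub_le [BorelSpace X] (h : BallGrowth μ n D) (x₁ : X) (s : ℝ) :
    ∃ K : ℝ, 0 < K ∧ ∀ (Λ : testSpace 𝕜 μ x₁ 1 1 2 →ₗ[𝕜] 𝕜) (x y : X) (k l : ℤ),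
      dist x y ≤ 2 ^ (-k) → k ≤ l → l ≤ k + 1 →
      ‖Λ (h.kernel 𝕜 x₁ x k) - Λ (h.kernel 𝕜 x₁ y l)‖ₑ ≤
        ENNReal.ofReal (K * ((2 : ℝ) ^ (-k)) ^ s) * grandFunction μ x₁ s Λ x := by
  obtain ⟨K₁, hK₁, hK₁'⟩ := h.isTestBound_ballKernel (𝕜 := 𝕜)
  obtain ⟨K₂, hK₂, hK₂'⟩ := h.isTestBound_transfer (𝕜 := 𝕜) (L := 2) one_le_two
  refine ⟨K₁ + K₂ * K₁, by positivity, fun Λ x y k l hxy hkl hlk => ?_⟩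
  have hr : (0 : ℝ) < 2 ^ (-k) := by positivity
  have hr' : (0 : ℝ) < 2 ^ (-l) := by positivity
  have h1 : (2 : ℝ) ^ (-l) ≤ 2 ^ (-k) := zpow_le_zpow_right₀ one_le_two (by linarith)
  have h2 : (2 : ℝ) ^ (-k) ≤ 2 * 2 ^ (-l) := by
    rw [← zpow_one_add₀ two_ne_zero]
    exact zpow_le_zpow_right₀ one_le_two (by linarith)
  have hb := (hK₁' x _ hr).sub (hK₂' y x _ _ _ _ hr' hr (by rw [dist_comm]; linarith)
    (by linarith) (by linarith) (hK₁' y _ hr'))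
  rw [← map_sub]
  refine enorm_le_grandFunction Λ (by positivity) ?_ hb
  change ∫ z, (ballKernel 𝕜 μ x ((2 : ℝ) ^ (-k)) z - ballKernel 𝕜 μ y ((2 : ℝ) ^ (-l)) z) ∂μ = 0
  rw [integral_sub (h.integrable_testFunction hr (hK₁' x _ hr))
    (h.integrable_testFunction hr' (hK₁' y _ hr')), h.integral_ballKernel x hr,
    h.integral_ballKernel y hr', sub_self]

theorem exists_norm_kernel_sub_le [BorelSpace X] (h : BallGrowth μ n D) (x₁ : X) (s : ℝ) :
    ∃ K : ℝ, 0 < K ∧ ∀ (Λ : testSpace 𝕜 μ x₁ 1 1 2 →ₗ[𝕜] 𝕜) (x y : X) (k l : ℤ),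
      grandFunction μ x₁ s Λ x ≠ ∞ → dist x y ≤ 2 ^ (-k) → k ≤ l → l ≤ k + 1 →
      ‖Λ (h.kernel 𝕜 x₁ x k) - Λ (h.kernel 𝕜 x₁ y l)‖ ≤
        K * ((2 : ℝ) ^ (-k)) ^ s * (grandFunction μ x₁ s Λ x).toReal := by
  obtain ⟨K, hK, hK'⟩ := h.exists_enorm_kernel_sub_le (𝕜 := 𝕜) x₁ s
  refine ⟨K, hK, fun Λ x y k l hG hxy hkl hlk => ?_⟩
  have := ENNReal.toReal_mono (ENNReal.mul_ne_top ENNReal.ofReal_ne_top hG)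
    (hK' Λ x y k l hxy hkl hlk)
  rwa [toReal_enorm, ENNReal.toReal_mul, ENNReal.toReal_ofReal (by positivity)] at this

theorem two_zpow_neg_add_rpow (k : ℤ) (j : ℕ) (s : ℝ) :
    ((2 : ℝ) ^ (-(k + j))) ^ s = ((2 : ℝ) ^ (-k)) ^ s * ((2 : ℝ) ^ (-s)) ^ j := by
  rw [neg_add, zpow_add₀ two_ne_zero, Real.mul_rpow (by positivity) (by positivity)]
  congr 1
  rw [zpow_neg, zpow_natCast, Real.inv_rpow (by positivity), Real.rpow_neg two_pos.le, inv_pow,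
    Real.rpow_pow_comm two_pos.le]

/-- The averages of a functional at small scales converge where its grand function is finite. -/
theorem exists_tendsto_kernel [BorelSpace X] (h : BallGrowth μ n D) (x₁ : X) {s : ℝ}
    (hs : 0 < s) (Λ : testSpace 𝕜 μ x₁ 1 1 2 →ₗ[𝕜] 𝕜) {x : X}
    (hG : grandFunction μ x₁ s Λ x ≠ ∞) :
    ∃ a, Tendsto (fun k : ℤ => Λ (h.kernel 𝕜 x₁ x k)) atTop (𝓝 a) := by
  obtain ⟨K, hK, hK'⟩ := h.exists_norm_kernel_sub_le (𝕜 := 𝕜) x₁ s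
  have hθ : (2 : ℝ) ^ (-s) < 1 := Real.rpow_lt_one_of_one_lt_of_neg one_lt_two (by linarith)
  have hcauchy : CauchySeq fun j : ℕ => Λ (h.kernel 𝕜 x₁ x j) := by
    refine cauchySeq_of_le_geometric _ (K * (grandFunction μ x₁ s Λ x).toReal) hθ fun j => ?_
    have := hK' Λ x x j (j + 1) hG (by rw [dist_self]; positivity) (by linarith) le_rfl
    have e := two_zpow_neg_add_rpow 0 j s
    rw [zero_add, neg_zero, zpow_zero, Real.one_rpow, one_mul] at e
    rw [e] at this
    rw [dist_eq_norm]
    push_cast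
    linarith
  obtain ⟨a, ha⟩ := cauchySeq_tendsto_of_complete hcauchy
  refine ⟨a, ?_⟩
  rw [← Nat.map_cast_int_atTop]
  exact ha

theorem exists_norm_kernel_sub_limit_le [BorelSpace X] (h : BallGrowth μ n D) (x₁ : X) {s : ℝ}
    (hs : 0 < s) : ∃ K : ℝ, 0 < K ∧ ∀ (Λ : testSpace 𝕜 μ x₁ 1 1 2 →ₗ[𝕜] 𝕜) (x : X) (a : 𝕜)
      (k : ℤ), grandFunction μ x₁ s Λ x ≠ ∞ →
      Tendsto (fun k : ℤ => Λ (h.kernel 𝕜 x₁ x k)) atTop (𝓝 a) →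
      ‖Λ (h.kernel 𝕜 x₁ x k) - a‖ ≤
        K * ((2 : ℝ) ^ (-k)) ^ s * (grandFunction μ x₁ s Λ x).toReal := by
  obtain ⟨K, hK, hK'⟩ := h.exists_norm_kernel_sub_le (𝕜 := 𝕜) x₁ s
  have hθ : (2 : ℝ) ^ (-s) < 1 := Real.rpow_lt_one_of_one_lt_of_neg one_lt_two (by linarith)
  have hθ0 : 0 < 1 - (2 : ℝ) ^ (-s) := by linarith
  refine ⟨K / (1 - 2 ^ (-s)), by positivity, fun Λ x a k hG ha => ?_⟩
  have hlim : Tendsto (fun j : ℕ => Λ (h.kernel 𝕜 x₁ x (k + j))) atTop (𝓝 a) :=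
    ha.comp (tendsto_atTop_add_const_left _ k tendsto_natCast_atTop_atTop)
  have := dist_le_of_le_geometric_of_tendsto₀ _
    (K * ((2 : ℝ) ^ (-k)) ^ s * (grandFunction μ x₁ s Λ x).toReal) hθ (fun j => ?_) hlim
  · rw [dist_eq_norm] at this
    simp only [Nat.cast_zero, add_zero] at this
    refine this.trans_eq ?_
    ring
  · have := hK' Λ x x (k + j) (k + (j + 1 : ℕ)) hG (by rw [dist_self]; positivity)
      (by push_cast; linarith) (by push_cast; linarith)
    rw [two_zpow_neg_add_rpow] at this
    rw [dist_eq_norm]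
    refine this.trans_eq ?_
    ring

theorem exists_norm_limit_sub_limit_le [BorelSpace X] (h : BallGrowth μ n D) (x₁ : X) {s : ℝ}
    (hs : 0 < s) : ∃ K : ℝ, 0 < K ∧ ∀ (Λ : testSpace 𝕜 μ x₁ 1 1 2 →ₗ[𝕜] 𝕜) (x y : X) (a b : 𝕜),
      grandFunction μ x₁ s Λ x ≠ ∞ → grandFunction μ x₁ s Λ y ≠ ∞ →
      Tendsto (fun k : ℤ => Λ (h.kernel 𝕜 x₁ x k)) atTop (𝓝 a) →
      Tendsto (fun k : ℤ => Λ (h.kernel 𝕜 x₁ y k)) atTop (𝓝 b) →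
      ‖a - b‖ ≤ dist x y ^ s * (K * (grandFunction μ x₁ s Λ x).toReal +
        K * (grandFunction μ x₁ s Λ y).toReal) := by
  obtain ⟨K₁, hK₁, hK₁'⟩ := h.exists_norm_kernel_sub_le (𝕜 := 𝕜) x₁ s
  obtain ⟨K₂, hK₂, hK₂'⟩ := h.exists_norm_kernel_sub_limit_le (𝕜 := 𝕜) x₁ hs
  refine ⟨2 ^ s * (K₁ + K₂), by positivity, fun Λ x y a b hx hy ha hb => ?_⟩
  rcases eq_or_ne x y with rfl | hxy
  · rw [tendsto_nhds_unique ha hb, sub_self, norm_zero]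
    positivity
  obtain ⟨m, hm1, hm2⟩ := exists_mem_Ioc_zpow (dist_pos.2 hxy) (one_lt_two (α := ℝ))
  set k : ℤ := -(m + 1) with hk
  have hkm : (2 : ℝ) ^ (-k) = 2 * 2 ^ m := by
    rw [hk, neg_neg, zpow_add_one₀ two_ne_zero]; ring
  have hpow : ((2 : ℝ) ^ (-k)) ^ s ≤ 2 ^ s * dist x y ^ s := by
    rw [hkm, Real.mul_rpow two_pos.le (by positivity)]
    gcongr
  have h1 := hK₁' Λ x y k k hx (by rw [hk, neg_neg]; exact hm2) le_rfl (by linarith)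
  have h2 := hK₂' Λ x a k hx ha
  have h3 := hK₂' Λ y b k hy hb
  set Gx := (grandFunction μ x₁ s Λ x).toReal
  set Gy := (grandFunction μ x₁ s Λ y).toReal
  have hGx : 0 ≤ Gx := ENNReal.toReal_nonneg
  have hGy : 0 ≤ Gy := ENNReal.toReal_nonneg
  set Ax := Λ (h.kernel 𝕜 x₁ x k)
  set Ay := Λ (h.kernel 𝕜 x₁ y k)
  calc ‖a - b‖ = ‖-(Ax - a) + (Ax - Ay) + (Ay - b)‖ := by congr 1; ring
    _ ≤ ‖Ax - a‖ + ‖Ax - Ay‖ + ‖Ay - b‖ := by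
        refine (norm_add₃_le ..).trans ?_
        rw [norm_neg]
    _ ≤ ((2 : ℝ) ^ (-k)) ^ s * ((K₁ + K₂) * Gx + K₂ * Gy) := by linarith
    _ ≤ (2 ^ s * dist x y ^ s) * ((K₁ + K₂) * Gx + (K₁ + K₂) * Gy) := by
        gcongr; linarith
    _ = _ := by ring

/-- If the averages of `Λ` at small scales converge to `f`, then the grand function of `Λ` gives a
gradient of `f`. -/
theorem exists_gradient_of_tendsto [BorelSpace X] (h : BallGrowth μ n D) (x₁ : X) {s p : ℝ}
    (hs : 0 < s) (hp : 0 < p) : ∃ K : ℝ, 0 < K ∧ ∀ (Λ : testSpace 𝕜 μ x₁ 1 1 2 →ₗ[𝕜] 𝕜)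
      (f : X → 𝕜), grandNorm μ x₁ s p Λ ≠ ∞ →
      (∀ᵐ x ∂μ, Tendsto (fun k : ℤ => Λ (h.kernel 𝕜 x₁ x k)) atTop (𝓝 (f x))) →
      ∃ g ∈ hajlaszGradients μ s f,
        eLpNorm g (ENNReal.ofReal p) μ ≤ ENNReal.ofReal K * grandNorm μ x₁ s p Λ := by
  obtain ⟨K₁, hK₁, hK₁'⟩ := h.exists_norm_limit_sub_limit_le (𝕜 := 𝕜) x₁ hs
  obtain ⟨K₂, hK₂, hK₂'⟩ := h.exists_grandMajorant_le (𝕜 := 𝕜) x₁ s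
  refine ⟨K₁ * K₂, by positivity, fun Λ f hΛ hlim => ?_⟩
  set G := grandFunction μ x₁ s Λ
  set M := grandMajorant μ x₁ s Λ
  have hMm : Measurable M := measurable_grandMajorant μ x₁ s Λ
  have hGM : ∀ x, G x ≤ M x := grandFunction_le_grandMajorant μ x₁ s Λ
  have hMG : ∫⁻ x, M x ^ p ∂μ ≤ ENNReal.ofReal (K₂ ^ p) * ∫⁻ x, G x ^ p ∂μ := by
    rw [← lintegral_const_mul' _ _ ENNReal.ofReal_ne_top]
    refine lintegral_mono fun x => ?_
    rw [← ENNReal.ofReal_rpow_of_nonneg hK₂.le hp.le, ← ENNReal.mul_rpow_of_nonneg _ _ hp.le]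
    exact ENNReal.rpow_le_rpow (hK₂' Λ x) hp.le
  rw [grandNorm_eq_lintegral hp] at hΛ ⊢
  have hGfin : ∫⁻ x, G x ^ p ∂μ ≠ ∞ := fun htop => hΛ (by
    rw [htop, ENNReal.top_rpow_of_pos (by positivity)])
  have hMfin : ∀ᵐ x ∂μ, M x ≠ ∞ := by
    filter_upwards [ae_lt_top (hMm.pow_const p)
      (ne_top_of_le_ne_top (ENNReal.mul_ne_top ENNReal.ofReal_ne_top hGfin) hMG)] with x hx htop
    rw [htop, ENNReal.top_rpow_of_pos hp] at hx
    exact hx.ne rfl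
  refine ⟨fun x => K₁ * (M x).toReal, ⟨hMm.ennreal_toReal.const_mul _, fun x => by positivity,
    {x | ¬ (Tendsto (fun k : ℤ => Λ (h.kernel 𝕜 x₁ x k)) atTop (𝓝 (f x)) ∧ M x ≠ ∞)},
    hlim.and hMfin, fun x hx y hy => ?_⟩, ?_⟩
  · rw [Set.mem_ofPred_eq, not_not] at hx hy
    refine (hK₁' Λ x y _ _ (ne_top_of_le_ne_top hx.2 (hGM x)) (ne_top_of_le_ne_top hy.2 (hGM y))
      hx.1 hy.1).trans ?_
    have h1 : (grandFunction μ x₁ s Λ x).toReal ≤ (M x).toReal := ENNReal.toReal_mono hx.2 (hGM x)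
    have h2 : (grandFunction μ x₁ s Λ y).toReal ≤ (M y).toReal := ENNReal.toReal_mono hy.2 (hGM y)
    dsimp only
    gcongr
  · rw [eLpNorm_eq_lintegral_of_nonneg hp fun x => by positivity]
    have hp1 : 0 ≤ 1 / p := by positivity
    calc (∫⁻ x, ENNReal.ofReal ((K₁ * (M x).toReal) ^ p) ∂μ) ^ (1 / p) ≤
        (ENNReal.ofReal (K₁ ^ p) * (ENNReal.ofReal (K₂ ^ p) * ∫⁻ x, G x ^ p ∂μ)) ^ (1 / p) := by
          refine ENNReal.rpow_le_rpow (le_trans ?_ (mul_le_mul' le_rfl hMG)) hp1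
          rw [← lintegral_const_mul' _ _ ENNReal.ofReal_ne_top]
          refine lintegral_mono fun x => ?_
          rw [Real.mul_rpow hK₁.le ENNReal.toReal_nonneg, ENNReal.ofReal_mul (by positivity),
            ← ENNReal.ofReal_rpow_of_nonneg ENNReal.toReal_nonneg hp.le]
          gcongr
          exact ENNReal.ofReal_toReal_le
      _ = _ := by
          rw [← mul_assoc, ← ENNReal.ofReal_mul (by positivity), ← Real.mul_rpow hK₁.le hK₂.le,
            ENNReal.mul_rpow_of_nonneg _ _ hp1, ENNReal.ofReal_rpow_of_nonneg (by positivity) hp1,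
            ← Real.rpow_mul (by positivity), mul_one_div_cancel hp.ne', Real.rpow_one]

theorem integrableOn_ball_of_represents [BorelSpace X] (h : BallGrowth μ n D) {x₁ : X}
    {f : X → 𝕜} {Λ : testSpace 𝕜 μ x₁ 1 1 2 →ₗ[𝕜] 𝕜} (hΛ : Represents μ x₁ f Λ) (x : X)
    {R : ℝ} (hR : 0 < R) : IntegrableOn f (ball x R) μ := by
  have hmem : (fun y => (ballCutoff x R y : 𝕜)) ∈ testSpace 𝕜 μ x₁ 1 1 2 := by
    refine h.mem_testSpace_of_lipschitz x₁ (R := dist x₁ x + 2 * R) (a := 1) (b := 1 / R)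
      (fun y hy => ?_) (fun y => ?_) fun y z => ?_
    · have := dist_le_of_ballCutoff_ne_zero hR fun h0 => hy (by rw [h0, RCLike.ofReal_zero])
      linarith [dist_triangle x₁ x y]
    · rw [RCLike.norm_ofReal, abs_of_nonneg (ballCutoff_nonneg x R y)]
      exact ballCutoff_le_one x R y
    · rw [← RCLike.ofReal_sub, RCLike.norm_ofReal, one_div_mul_eq_div]
      exact abs_ballCutoff_sub_le x hR y z
  refine (hΛ ⟨_, hmem⟩).1.integrableOn.congr_fun (fun y hy => ?_) measurableSet_ball
  simp only [ballCutoff_eq_one hR (mem_ball'.1 hy).le, RCLike.ofReal_one, mul_one]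

theorem ae_tendsto_kernel_of_represents [BorelSpace X] (h : BallGrowth μ n D) {x₁ : X}
    {f : X → 𝕜} {Λ : testSpace 𝕜 μ x₁ 1 1 2 →ₗ[𝕜] 𝕜} (hΛ : Represents μ x₁ f Λ) :
    ∀ᵐ x ∂μ, Tendsto (fun k : ℤ => Λ (h.kernel 𝕜 x₁ x k)) atTop (𝓝 (f x)) := by
  have := h.secondCountableTopology x₁
  have := h.isUnifLocDoublingMeasure
  have := h.isLocallyFiniteMeasure
  have hD := h.const_pos
  have hloc : LocallyIntegrable f μ := fun x =>
    ⟨ball x 1, ball_mem_nhds x one_pos, h.integrableOn_ball_of_represents hΛ x one_pos⟩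
  filter_upwards [IsUnifLocDoublingMeasure.ae_tendsto_average_norm_sub μ hloc 1] with x hx
  have hδ : Tendsto (fun k : ℤ => 2 * (2 : ℝ) ^ (-k)) atTop (𝓝[>] 0) := by
    refine tendsto_nhdsWithin_iff.2 ⟨?_, Eventually.of_forall fun k => by
      show (0 : ℝ) < 2 * 2 ^ (-k); positivity⟩
    rw [← Nat.map_cast_int_atTop, tendsto_map'_iff]
    have := (tendsto_pow_atTop_nhds_zero_of_lt_one (r := (2 : ℝ)⁻¹) (by norm_num)
      (by norm_num)).const_mul 2
    rw [mul_zero] at this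
    refine this.congr fun j => ?_
    simp
  have hlim := hx (fun _ : ℤ => x) (fun k : ℤ => 2 * (2 : ℝ) ^ (-k)) hδ
    (Eventually.of_forall fun k => mem_closedBall_self (by positivity))
  rw [tendsto_iff_norm_sub_tendsto_zero]
  have hlim' := hlim.const_mul (D * 3 ^ n)
  rw [mul_zero] at hlim'
  refine squeeze_zero (fun k => norm_nonneg _) (fun k => ?_) hlim'
  set r : ℝ := (2 : ℝ) ^ (-k) with hr
  have hr0 : 0 < r := by positivity
  have hv := h.real_ball_pos x hr0
  have hvc : 0 < μ.real (closedBall x (2 * r)) :=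
    (h.real_ball_pos x (by positivity : 0 < 2 * r)).trans_le (measureReal_mono
      ball_subset_closedBall (ne_top_of_le_ne_top (h.measure_ball_lt_top x (3 * r)).ne
        (measure_mono (closedBall_subset_ball (by linarith)))))
  have hvol : μ.real (closedBall x (2 * r)) ≤ D * 3 ^ n * μ.real (ball x r) :=
    (h.real_mono (closedBall_subset_ball (by linarith : 2 * r < 3 * r))).trans
      (h.growth x r 3 hr0 (by norm_num))
  obtain ⟨K₁, -, hK₁⟩ := h.isTestBound_ballKernel (𝕜 := 𝕜)
  have hki := h.integrable_testFunction hr0 (hK₁ x r hr0)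
  have hf3 : IntegrableOn (fun y => ‖f y - f x‖) (closedBall x (2 * r)) μ := by
    have h3 := h.integrableOn_ball_of_represents hΛ x (by positivity : 0 < 3 * r)
    have h4 : IntegrableOn (fun _ => f x) (ball x (3 * r)) μ :=
      integrableOn_const (h.measure_ball_lt_top _ _).ne
    have h5 : IntegrableOn (fun y => ‖f y - f x‖) (ball x (3 * r)) μ := (h3.sub h4).norm
    exact h5.mono_set (closedBall_subset_ball (by linarith))
  have heq : Λ (h.kernel 𝕜 x₁ x k) - f x = ∫ y, (f y - f x) * ballKernel 𝕜 μ x r y ∂μ := by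
    simp_rw [sub_mul]
    have hfk : Integrable (fun y => f y * ballKernel 𝕜 μ x r y) μ := (hΛ (h.kernel 𝕜 x₁ x k)).1
    rw [integral_sub hfk (hki.const_mul _), integral_const_mul,
      h.integral_ballKernel x hr0, mul_one, (hΛ (h.kernel 𝕜 x₁ x k)).2]
    rfl
  rw [heq]
  calc _ ≤ ∫ y, (closedBall x (2 * r)).indicator
        (fun y => 1 / μ.real (ball x r) * ‖f y - f x‖) y ∂μ := by
        refine norm_integral_le_of_norm_le ((integrable_indicator_iff
          isClosed_closedBall.measurableSet).2 (hf3.const_mul _)) (ae_of_all _ fun y => ?_)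
        by_cases hy : y ∈ closedBall x (2 * r)
        · rw [Set.indicator_of_mem hy, norm_mul, mul_comm]
          gcongr
          exact h.norm_ballKernel_le x hr0 y
        · rw [Set.indicator_of_notMem hy]
          have : ballKernel 𝕜 μ x r y = 0 := by
            by_contra hne
            exact hy (mem_closedBall'.2
              (dist_le_of_ballCutoff_ne_zero hr0 (ballKernel_ne_zero hne)))
          rw [this, mul_zero, norm_zero]
    _ = 1 / μ.real (ball x r) * ∫ y in closedBall x (2 * r), ‖f y - f x‖ ∂μ := by
        rw [integral_indicator isClosed_closedBall.measurableSet, integral_const_mul]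
    _ ≤ D * 3 ^ n * (μ.real (closedBall x (2 * r)))⁻¹ *
          ∫ y in closedBall x (2 * r), ‖f y - f x‖ ∂μ := by
        have : 0 ≤ ∫ y in closedBall x (2 * r), ‖f y - f x‖ ∂μ :=
          integral_nonneg fun y => norm_nonneg _
        gcongr
        rw [← div_eq_mul_inv, div_le_div_iff₀ hv hvc, one_mul]
        exact hvol
    _ = _ := by rw [setAverage_eq, smul_eq_mul, mul_assoc]

end BallGrowth

end

section

variable {X : Type*} [MetricSpace X] [MeasurableSpace X] {𝕜 : Type*} [RCLike 𝕜]
  {μ : Measure X} {n D : ℝ}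

namespace BallGrowth

/-- The part of a test function away from a large ball is small at a large scale. -/
theorem exists_isTestBound_tail (h : BallGrowth μ n D) :
    ∃ K : ℝ, 0 < K ∧ ∀ (x : X) (R : ℝ) (φ : X → 𝕜) (C : ℝ), 1 ≤ R → IsTestBound μ x 1 1 2 φ C →
      IsTestBound μ x R 1 2 (fun y => φ y * (1 - ballCutoff x R y : ℝ)) (K * (C / R ^ 2)) := by
  have hD := h.const_pos
  obtain ⟨K, hK, hK'⟩ := h.isTestBound_of_isLocalTestBound (𝕜 := 𝕜) (δ := 1 / 8) (by norm_num)
  set P : ℝ := D * 3 ^ n * 3 ^ 2 with hP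
  have hP0 : 0 < P := by positivity
  refine ⟨K * (8 * (D * 2 ^ n * P)), by positivity, fun x R φ C hR hφ => ?_⟩
  have hR0 : 0 < R := by linarith
  have hC := hφ.1
  obtain ⟨hA, hs, hreg⟩ := h.isLocalTestBound_of_isTestBound one_pos hφ
  set A : ℝ := D * 2 ^ n * C with hAdef
  have hw : ∀ y, R / 2 ≤ dist x y → ballWeight μ x 1 (1 + dist x y) ≤
      P / R ^ 2 * ballWeight μ x R (R + dist x y) := fun y hy => by
    have := h.ballWeight_le_of_le x 1 (ρ := R + dist x y) (ρ' := 1 + dist x y) (L := 3)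
      (by positivity) (by positivity) (by norm_num) (by linarith)
    refine this.trans_eq ?_
    rw [ballWeight, ballWeight, hP]
    field_simp
  have hcut0 : ∀ y, 0 ≤ 1 - ballCutoff x R y := fun y => by
    have := ballCutoff_le_one x R y; linarith
  have hcut1 : ∀ y, ‖((1 - ballCutoff x R y : ℝ) : 𝕜)‖ ≤ 1 := fun y => by
    rw [RCLike.norm_ofReal, abs_of_nonneg (hcut0 y)]
    have := ballCutoff_nonneg x R y; linarith
  have hzero : ∀ y, dist x y ≤ R → φ y * ((1 - ballCutoff x R y : ℝ) : 𝕜) = 0 := fun y hy => by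
    rw [ballCutoff_eq_one hR0 hy]; simp
  have key := hK' x R (fun y => φ y * (1 - ballCutoff x R y : ℝ)) (8 * (A * (P / R ^ 2))) hR0
    ⟨by positivity, fun y => ?_, fun y z hyz => ?_⟩
  · convert key using 1; rw [hAdef]; ring
  · have hb := ballWeight_nonneg μ x R (R + dist x y)
    rcases le_or_gt (dist x y) R with hy | hy
    · simp only [hzero y hy, norm_zero]; positivity
    · calc ‖φ y * ((1 - ballCutoff x R y : ℝ) : 𝕜)‖ ≤ ‖φ y‖ * 1 := by
            rw [norm_mul]; gcongr; exact hcut1 y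
        _ ≤ A * (P / R ^ 2 * ballWeight μ x R (R + dist x y)) := by
            rw [mul_one]
            exact (hs y).trans (mul_le_mul_of_nonneg_left (hw y (by linarith)) hA)
        _ = 1 * (A * (P / R ^ 2)) * ballWeight μ x R (R + dist x y) := by ring
        _ ≤ _ := by gcongr; norm_num
  · have hb := ballWeight_nonneg μ x R (R + dist x y)
    have hd1 := dist_triangle x y z
    have hd2 := dist_triangle x z y
    rw [dist_comm z y] at hd2
    have hyz0 : 0 ≤ dist y z := dist_nonneg
    have hxy0 : 0 ≤ dist x y := dist_nonneg
    rcases lt_or_ge (dist x y) (R / 2) with hy | hy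
    · simp only [hzero y (by linarith), hzero z (by linarith), sub_zero, norm_zero]
      positivity
    · set ρ := R + dist x y with hρ
      have hρ0 : 0 < ρ := by positivity
      have h1 : ‖φ y - φ z‖ ≤ A * (3 * (dist y z / ρ) * ballWeight μ x 1 (1 + dist x y)) := by
        have hb1 := ballWeight_nonneg μ x 1 (1 + dist x y)
        refine (hreg y z (by linarith)).trans ?_
        gcongr
        rw [mul_div_assoc', div_le_div_iff₀ (by positivity) hρ0]
        nlinarith
      have h2 : |ballCutoff x R z - ballCutoff x R y| ≤ 5 * (dist y z / ρ) := by
        rcases le_or_gt (dist x y) (4 * R) with hle | hlt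
        · rw [abs_sub_comm]
          refine (abs_ballCutoff_sub_le x hR0 y z).trans ?_
          rw [mul_div_assoc', div_le_div_iff₀ hR0 hρ0]
          nlinarith
        · rw [ballCutoff_eq_zero hR0 (by linarith : 2 * R ≤ dist x y),
            ballCutoff_eq_zero hR0 (by linarith : 2 * R ≤ dist x z), sub_zero, abs_zero]
          positivity
      have hsplit : φ y * ((1 - ballCutoff x R y : ℝ) : 𝕜) - φ z * ((1 - ballCutoff x R z : ℝ) : 𝕜)
          = (φ y - φ z) * ((1 - ballCutoff x R z : ℝ) : 𝕜) +
            φ y * ((ballCutoff x R z - ballCutoff x R y : ℝ) : 𝕜) := by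
        push_cast; ring
      calc _ ≤ ‖φ y - φ z‖ * 1 + ‖φ y‖ * |ballCutoff x R z - ballCutoff x R y| := by
            rw [hsplit]
            refine (norm_add_le _ _).trans ?_
            rw [norm_mul, norm_mul]
            gcongr
            · exact hcut1 z
            · rw [RCLike.norm_ofReal]
        _ ≤ A * (3 * (dist y z / ρ) * ballWeight μ x 1 (1 + dist x y)) * 1 +
            A * ballWeight μ x 1 (1 + dist x y) * (5 * (dist y z / ρ)) := by
            have hb1 := ballWeight_nonneg μ x 1 (1 + dist x y)
            gcongr
            exact hs y
        _ = 8 * A * (dist y z / ρ) * ballWeight μ x 1 (1 + dist x y) := by ring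
        _ ≤ 8 * A * (dist y z / ρ) * (P / R ^ 2 * ballWeight μ x R ρ) := by
            gcongr; exact hw y hy
        _ = _ := by ring

theorem exists_bounded_lipschitz_of_isTestBound (h : BallGrowth μ n D) {x : X} {φ : X → 𝕜}
    {C : ℝ} (hφ : IsTestBound μ x 1 1 2 φ C) :
    ∃ M : ℝ, 0 < M ∧ (∀ y, ‖φ y‖ ≤ M) ∧ ∀ y z, ‖φ y - φ z‖ ≤ 4 * M * dist y z := by
  have hv := h.real_ball_pos x one_pos
  have hC := hφ.1
  have hw : ∀ y, testWeight μ x 1 2 y ≤ 1 / μ.real (ball x 1) := fun y => by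
    have h0 : (0 : ℝ) ≤ μ.real (ball x (dist x y)) := measureReal_nonneg
    have hd : 0 ≤ dist x y := dist_nonneg
    rw [testWeight]
    calc _ ≤ 1 / (μ.real (ball x 1) + μ.real (ball x (dist x y))) * 1 := by
          gcongr
          exact Real.rpow_le_one (by positivity) ((div_le_one (by positivity)).2 (by linarith))
            two_pos.le
      _ ≤ _ := by rw [mul_one]; gcongr; linarith
  set M : ℝ := C / μ.real (ball x 1) + 1 with hM
  have hM0 : 0 < M := by positivity
  have hCM : C / μ.real (ball x 1) ≤ M := by linarith
  have hb : ∀ y, ‖φ y‖ ≤ M := fun y => (hφ.2.1 y).trans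
    ((mul_le_mul_of_nonneg_left (hw y) hC).trans (by rw [mul_one_div]; exact hCM))
  refine ⟨M, hM0, hb, fun y z => ?_⟩
  have hd : 0 ≤ dist x y := dist_nonneg
  have hyz : 0 ≤ dist y z := dist_nonneg
  rcases le_total (dist y z) (1 / 2) with hle | hle
  · have hyw := testWeight_nonneg μ x zero_le_one (γ := 2) y
    calc ‖φ y - φ z‖ ≤ C * ((dist y z / (1 + dist x y)) ^ (1 : ℝ) * testWeight μ x 1 2 y) :=
          hφ.2.2 y z (by linarith)
      _ ≤ C * (dist y z * (1 / μ.real (ball x 1))) := by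
          rw [Real.rpow_one]
          have := div_le_self hyz (by linarith : 1 ≤ 1 + dist x y)
          have := hw y
          gcongr
      _ = C / μ.real (ball x 1) * dist y z := by ring
      _ ≤ 4 * M * dist y z := by gcongr; linarith
  · calc ‖φ y - φ z‖ ≤ M + M := (norm_sub_le _ _).trans (add_le_add (hb y) (hb z))
      _ ≤ 4 * M * dist y z := by nlinarith

/-- A localization estimate: a functional that is controlled on test functions at scale `r`,
applied to a Lipschitz function supported in a ball of radius `2r`. -/
theorem exists_enorm_localized_rpow_le [BorelSpace X] (h : BallGrowth μ n D) (x₁ : X)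
    {s q : ℝ} (hq : 0 < q) (hq1 : q ≤ 1) {R a : ℝ} (hR : 0 ≤ R) (ha : 0 < a)
    (Λ : testSpace 𝕜 μ x₁ 1 1 2 →ₗ[𝕜] 𝕜) {H : X → ℝ≥0∞}
    (hΛ : ∀ᵐ x ∂μ, ∀ (k : ℤ) (φ : testSpace 𝕜 μ x₁ 1 1 2) (C : ℝ), 0 < C →
      IsTestBound μ x ((2 : ℝ) ^ (-k)) 1 2 (φ : X → 𝕜) C →
        ‖Λ φ‖ₑ ≤ ENNReal.ofReal (C * ((2 : ℝ) ^ (-k)) ^ s) * H x) :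
    ∃ B : ℝ, 0 < B ∧ ∀ (k : ℕ) (i : X), dist x₁ i ≤ R →
      ∀ ψ : testSpace 𝕜 μ x₁ 1 1 2, (∀ y, (ψ : X → 𝕜) y ≠ 0 → dist i y ≤ 2 * 2 ^ (-(k : ℤ))) →
        (∀ y, ‖(ψ : X → 𝕜) y‖ ≤ a) →
        (∀ y z, ‖(ψ : X → 𝕜) y - (ψ : X → 𝕜) z‖ ≤ a * (dist y z / 2 ^ (-(k : ℤ)))) →
        ‖Λ ψ‖ₑ ^ q ≤ ENNReal.ofReal (B * ((2 : ℝ) ^ (-(k : ℤ))) ^ (s * q + n * (q - 1))) *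
          ∫⁻ x in ball i (2 ^ (-(k : ℤ)) / 2), H x ^ q ∂μ := by
  have hD := h.const_pos
  have hn := h.exponent_pos
  obtain ⟨K₁, hK₁, hK₁'⟩ := h.isTestBound_of_lipschitz (𝕜 := 𝕜) (L := 2) zero_le_two
  obtain ⟨K₂, hK₂, hK₂'⟩ := h.isTestBound_transfer (𝕜 := 𝕜) (L := 1) le_rfl
  have hv₁ := h.real_ball_pos x₁ one_pos
  set c : ℝ := μ.real (ball x₁ 1) / (D * (R + 2) ^ n) with hc
  have hc0 : 0 < c := by positivity
  set K : ℝ := K₂ * (K₁ * a) with hK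
  have hK0 : 0 < K := by positivity
  refine ⟨D * 2 ^ n * K ^ q * c ^ (q - 1), by positivity, fun k i hi ψ hsupp hb hlip => ?_⟩
  set r : ℝ := (2 : ℝ) ^ (-(k : ℤ)) with hr
  have hr0 : 0 < r := by positivity
  have hr1 : r ≤ 1 := zpow_le_one_of_nonpos₀ one_le_two (by simp)
  set V := μ.real (ball i r) with hV
  have hV0 : 0 < V := h.real_ball_pos i hr0
  have hcV : c * r ^ n ≤ V := by
    have : μ.real (ball x₁ 1) ≤ D * ((R + 2) / r) ^ n * V :=
      h.real_ball_le hr0 ((one_le_div hr0).2 (by linarith))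
        (by rw [div_mul_cancel₀ _ hr0.ne']; linarith)
    rw [Real.div_rpow (by positivity) hr0.le] at this
    rw [hc, div_mul_eq_mul_div, div_le_iff₀ (by positivity)]
    calc _ ≤ D * ((R + 2) ^ n / r ^ n) * V * r ^ n := by gcongr
      _ = _ := by field_simp
  have hψ := hK₁' i r ψ (a * V) hr0 (by positivity) hsupp
    (fun y => by rw [mul_div_cancel_right₀ _ hV0.ne']; exact hb y)
    (fun y z => by rw [mul_div_cancel_right₀ _ hV0.ne']; exact hlip y z)
  set t := ‖Λ ψ‖ₑ ^ q with ht
  have hpt : ∀ᵐ x ∂(μ.restrict (ball i (r / 2))),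
      t ≤ ENNReal.ofReal ((K * V * r ^ s) ^ q) * H x ^ q := by
    filter_upwards [ae_restrict_mem measurableSet_ball, ae_restrict_of_ae hΛ] with x hx hΛx
    have hx := mem_ball'.1 hx
    have h1 := hΛx k ψ _ (by positivity) (hK₂' i x r r ψ _ hr0 hr0 (by linarith) (by linarith)
      (by linarith) hψ)
    rw [ht, ← ENNReal.ofReal_rpow_of_nonneg (by positivity) hq.le,
      ← ENNReal.mul_rpow_of_nonneg _ _ hq.le]
    refine ENNReal.rpow_le_rpow (h1.trans_eq ?_) hq.le
    congr 2; rw [hK]; ring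
  set I := ∫⁻ x in ball i (r / 2), H x ^ q ∂μ with hI
  have hint : t * μ (ball i (r / 2)) ≤ ENNReal.ofReal ((K * V * r ^ s) ^ q) * I := by
    rw [hI, ← setLIntegral_const, ← lintegral_const_mul' _ _ ENNReal.ofReal_ne_top]
    exact lintegral_mono_ae hpt
  have hVhalf : ENNReal.ofReal V ≤ ENNReal.ofReal (D * 2 ^ n) * μ (ball i (r / 2)) := by
    rw [hV, h.ofReal_real_ball]
    exact h.measure_ball_le (by positivity) one_le_two (by rw [dist_self]; linarith)
  have hmul : t * ENNReal.ofReal V ≤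
      ENNReal.ofReal (D * 2 ^ n * (K * V * r ^ s) ^ q) * I := by
    calc t * ENNReal.ofReal V ≤ t * (ENNReal.ofReal (D * 2 ^ n) * μ (ball i (r / 2))) := by gcongr
      _ = ENNReal.ofReal (D * 2 ^ n) * (t * μ (ball i (r / 2))) := by ring
      _ ≤ ENNReal.ofReal (D * 2 ^ n) * (ENNReal.ofReal ((K * V * r ^ s) ^ q) * I) := by gcongr
      _ = _ := by rw [← mul_assoc, ← ENNReal.ofReal_mul (by positivity)]
  have hVne : ENNReal.ofReal V ≠ 0 := by simpa using hV0
  calc t ≤ ENNReal.ofReal (D * 2 ^ n * (K * V * r ^ s) ^ q) * I / ENNReal.ofReal V := by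
        rwa [ENNReal.le_div_iff_mul_le (Or.inl hVne) (Or.inl ENNReal.ofReal_ne_top)]
    _ = ENNReal.ofReal (D * 2 ^ n * (K * V * r ^ s) ^ q / V) * I := by
        rw [ENNReal.ofReal_div_of_pos hV0, ENNReal.mul_div_right_comm]
    _ ≤ _ := by
        gcongr
        have e1 : V ^ q / V = V ^ (q - 1) := by rw [Real.rpow_sub hV0, Real.rpow_one]
        have e2 : V ^ (q - 1) ≤ c ^ (q - 1) * r ^ (n * (q - 1)) := by
          rw [Real.rpow_mul hr0.le, ← Real.mul_rpow hc0.le (by positivity)]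
          exact Real.rpow_le_rpow_of_nonpos (by positivity) hcV (by linarith)
        calc D * 2 ^ n * (K * V * r ^ s) ^ q / V
            = D * 2 ^ n * K ^ q * (V ^ q / V) * r ^ (s * q) := by
              rw [Real.mul_rpow (by positivity) (by positivity), Real.mul_rpow hK0.le hV0.le,
                Real.rpow_mul hr0.le]
              ring
          _ ≤ D * 2 ^ n * K ^ q * (c ^ (q - 1) * r ^ (n * (q - 1))) * r ^ (s * q) := by
              rw [e1]; gcongr
          _ = _ := by rw [Real.rpow_add hr0]; ring

end BallGrowth

end

section

variable {X : Type*} [MetricSpace X] [MeasurableSpace X] {𝕜 : Type*} [RCLike 𝕜]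
  {μ : Measure X} {n D : ℝ}

namespace BallGrowth

/-- A functional that is controlled on test functions at all small scales, without cancellation,
vanishes on Lipschitz functions with bounded support. -/
theorem apply_eq_zero_of_bounded_support [BorelSpace X] (h : BallGrowth μ n D) (x₁ : X)
    {s q : ℝ} (hq : n / (n + s) < q) (hs : 0 < s) (hq1 : q ≤ 1)
    (Λ : testSpace 𝕜 μ x₁ 1 1 2 →ₗ[𝕜] 𝕜) {H : X → ℝ≥0∞}
    (hH : ∀ R : ℝ, ∫⁻ x in ball x₁ R, H x ^ q ∂μ ≠ ∞)
    (hΛ : ∀ᵐ x ∂μ, ∀ (k : ℤ) (φ : testSpace 𝕜 μ x₁ 1 1 2) (C : ℝ), 0 < C →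
      IsTestBound μ x ((2 : ℝ) ^ (-k)) 1 2 (φ : X → 𝕜) C →
        ‖Λ φ‖ₑ ≤ ENNReal.ofReal (C * ((2 : ℝ) ^ (-k)) ^ s) * H x)
    (φ : testSpace 𝕜 μ x₁ 1 1 2) {R M b : ℝ} (hR : 0 ≤ R) (hM : 0 < M) (hb : 0 ≤ b)
    (hsupp : ∀ y, (φ : X → 𝕜) y ≠ 0 → dist x₁ y ≤ R) (hφM : ∀ y, ‖(φ : X → 𝕜) y‖ ≤ M)
    (hlip : ∀ y z, ‖(φ : X → 𝕜) y - (φ : X → 𝕜) z‖ ≤ b * dist y z) : Λ φ = 0 := by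
  classical
  have hn := h.exponent_pos
  have hq0 : 0 < q := lt_trans (by positivity) hq
  obtain ⟨B, hB, hB'⟩ := h.exists_enorm_localized_rpow_le x₁ hq0 hq1 hR
    (a := 2 * M + b) (by positivity) Λ hΛ
  set e : ℝ := s * q + n * (q - 1) with he
  have he0 : 0 < e := by
    rw [div_lt_iff₀ (by positivity)] at hq
    rw [he]; linarith
  set I := ∫⁻ x in ball x₁ (R + 1), H x ^ q ∂μ with hI
  have hscale : ∀ k : ℕ, ‖Λ φ‖ₑ ^ q ≤
      ENNReal.ofReal (B * ((2 : ℝ) ^ (-(k : ℤ))) ^ e) * I := by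
    intro k
    set r : ℝ := (2 : ℝ) ^ (-(k : ℤ)) with hr
    have hr0 : 0 < r := by positivity
    have hr1 : r ≤ 1 := zpow_le_one_of_nonpos₀ one_le_two (by simp)
    obtain ⟨T, hTA, hTsep, hTcov⟩ := exists_separated_covering (closedBall x₁ R) hr0
    have hTfin : T.Finite := h.finite_of_separated hr0
      (hTA.trans (closedBall_subset_ball (by linarith : R < R + 1))) hTsep
    have hind : ∀ F : Finset X, (F : Set X) ⊆ T → ∃ m : X → ℝ, (∀ y, 0 ≤ m y) ∧ (∀ y, m y ≤ 1) ∧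
        (∀ y z, |m y - m z| ≤ dist y z / r) ∧ (∀ i ∈ F, ∀ y, ballCutoff i r y ≤ m y) ∧
        ∃ hm : (fun y => (φ : X → 𝕜) y * (m y : 𝕜)) ∈ testSpace 𝕜 μ x₁ 1 1 2,
          ‖Λ ⟨_, hm⟩‖ₑ ^ q ≤ ENNReal.ofReal (B * r ^ e) *
            ∑ i ∈ F, ∫⁻ x in ball i (r / 2), H x ^ q ∂μ := by
      intro F
      induction F using Finset.induction_on with
      | empty =>
        intro _
        have h0 : (fun y => (φ : X → 𝕜) y * (((fun _ => 0 : X → ℝ) y : ℝ) : 𝕜)) = 0 := by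
          ext y; simp
        refine ⟨fun _ => 0, fun _ => le_rfl, fun _ => zero_le_one, fun y z => by
          rw [sub_self, abs_zero]; positivity, by simp, by rw [h0]; exact Submodule.zero_mem _, ?_⟩
        simp only [h0]
        have : (⟨0, Submodule.zero_mem _⟩ : testSpace 𝕜 μ x₁ 1 1 2) = 0 := rfl
        rw [this, map_zero, enorm_zero, ENNReal.zero_rpow_of_pos hq0]
        exact zero_le
      | insert i F hiF ih =>
        intro hF
        rw [Finset.coe_insert, Set.insert_subset_iff] at hF
        obtain ⟨m, hm0, hm1, hmlip, hmF, hmem, hle⟩ := ih hF.2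
        have hi : dist x₁ i ≤ R := mem_closedBall'.1 (hTA hF.1)
        set m' : X → ℝ := fun y => max (ballCutoff i r y) (m y) with hm'
        have hm'0 : ∀ y, 0 ≤ m' y := fun y => (hm0 y).trans (le_max_right _ _)
        have hm'1 : ∀ y, m' y ≤ 1 := fun y => max_le (ballCutoff_le_one i r y) (hm1 y)
        have hm'lip : ∀ y z, |m' y - m' z| ≤ dist y z / r := fun y z =>
          (abs_max_sub_max_le_max _ _ _ _).trans
            (max_le (abs_ballCutoff_sub_le i hr0 y z) (hmlip y z))
        set d : X → ℝ := fun y => m' y - m y with hd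
        have hd0 : ∀ y, 0 ≤ d y := fun y => sub_nonneg.2 (le_max_right _ _)
        have hd1 : ∀ y, |d y| ≤ 1 := fun y => by
          rw [abs_of_nonneg (hd0 y), hd]
          linarith [hm'1 y, hm0 y]
        have hdlip : ∀ y z, |d y - d z| ≤ 2 * (dist y z / r) := fun y z => by
          have : d y - d z = (m' y - m' z) - (m y - m z) := by rw [hd]; ring
          rw [this, two_mul]
          exact (abs_sub _ _).trans (add_le_add (hm'lip y z) (hmlip y z))
        have hdsupp : ∀ y, d y ≠ 0 → dist i y ≤ 2 * r := fun y hy => by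
          refine dist_le_of_ballCutoff_ne_zero hr0 fun h0 => hy ?_
          rw [hd, hm']
          simp only [h0, max_eq_right (hm0 y), sub_self]
        have hψb : ∀ y, ‖(φ : X → 𝕜) y * (d y : 𝕜)‖ ≤ 2 * M + b := fun y => by
          rw [norm_mul, RCLike.norm_ofReal]
          calc _ ≤ M * 1 := by gcongr; exacts [hφM y, hd1 y]
            _ ≤ _ := by linarith
        have hψlip : ∀ y z, ‖(φ : X → 𝕜) y * (d y : 𝕜) - (φ : X → 𝕜) z * (d z : 𝕜)‖ ≤
            (2 * M + b) * (dist y z / r) := fun y z => by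
          have hsplit : (φ : X → 𝕜) y * (d y : 𝕜) - (φ : X → 𝕜) z * (d z : 𝕜) =
              (φ : X → 𝕜) y * ((d y - d z : ℝ) : 𝕜) +
                ((φ : X → 𝕜) y - (φ : X → 𝕜) z) * (d z : 𝕜) := by push_cast; ring
          have hdr : dist y z ≤ dist y z / r := by
            rw [le_div_iff₀ hr0]
            exact mul_le_of_le_one_right dist_nonneg hr1
          rw [hsplit]
          refine (norm_add_le _ _).trans ?_
          rw [norm_mul, norm_mul, RCLike.norm_ofReal, RCLike.norm_ofReal]
          calc _ ≤ M * (2 * (dist y z / r)) + b * dist y z * 1 := by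
                gcongr; exacts [hφM y, hdlip y z, hlip y z, hd1 z]
            _ ≤ M * (2 * (dist y z / r)) + b * (dist y z / r) * 1 := by gcongr
            _ = _ := by ring
        have hψsupp : ∀ y, (φ : X → 𝕜) y * (d y : 𝕜) ≠ 0 → dist i y ≤ 2 * r := fun y hy =>
          hdsupp y fun h0 => hy (by rw [h0, RCLike.ofReal_zero, mul_zero])
        have hψmem : (fun y => (φ : X → 𝕜) y * (d y : 𝕜)) ∈ testSpace 𝕜 μ x₁ 1 1 2 :=
          h.mem_testSpace_of_lipschitz x₁ (R := R + 2 * r) (a := 2 * M + b)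
            (b := (2 * M + b) / r) (fun y hy => by
              have := hψsupp y hy
              linarith [dist_triangle x₁ i y]) hψb (fun y z => by
              refine (hψlip y z).trans_eq ?_; ring)
        have hψ := hB' k i hi ⟨_, hψmem⟩ hψsupp hψb hψlip
        have hadd : (fun y => (φ : X → 𝕜) y * (m' y : 𝕜)) =
            (fun y => (φ : X → 𝕜) y * (m y : 𝕜)) + fun y => (φ : X → 𝕜) y * (d y : 𝕜) := by
          ext y
          rw [Pi.add_apply, hd]
          push_cast; ring
        have hm'mem : (fun y => (φ : X → 𝕜) y * (m' y : 𝕜)) ∈ testSpace 𝕜 μ x₁ 1 1 2 := by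
          rw [hadd]; exact Submodule.add_mem _ hmem hψmem
        refine ⟨m', hm'0, hm'1, hm'lip, fun j hj y => ?_, hm'mem, ?_⟩
        · rcases Finset.mem_insert.1 hj with rfl | hj
          · exact le_max_left _ _
          · exact (hmF j hj y).trans (le_max_right _ _)
        · have hsum : (⟨_, hm'mem⟩ : testSpace 𝕜 μ x₁ 1 1 2) = ⟨_, hmem⟩ + ⟨_, hψmem⟩ :=
            Subtype.ext hadd
          rw [hsum, map_add, Finset.sum_insert hiF, mul_add, add_comm (ENNReal.ofReal _ * _)]
          exact (ENNReal.rpow_le_rpow (enorm_add_le _ _) hq0.le).trans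
            ((ENNReal.rpow_add_le_add_rpow _ _ hq0.le hq1).trans (add_le_add hle hψ))
    obtain ⟨m, hm0, hm1, -, hmF, hmem, hle⟩ := hind hTfin.toFinset (by simp)
    have hφm : (⟨_, hmem⟩ : testSpace 𝕜 μ x₁ 1 1 2) = φ := by
      refine Subtype.ext (funext fun y => ?_)
      by_cases hy : (φ : X → 𝕜) y = 0
      · simp [hy]
      · obtain ⟨i, hiT, hi⟩ := hTcov y (mem_closedBall'.2 (hsupp y hy))
        have h1 := hmF i (hTfin.mem_toFinset.2 hiT) y
        rw [ballCutoff_eq_one hr0 (by rw [dist_comm]; exact hi.le)] at h1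
        have : m y = 1 := le_antisymm (hm1 y) h1
        simp [this]
    rw [hφm] at hle
    refine hle.trans (mul_le_mul' le_rfl ?_)
    rw [← lintegral_biUnion_finset (fun i hi j hj hij => disjoint_ball_half_of_le_dist
      (hTsep (hTfin.mem_toFinset.1 hi) (hTfin.mem_toFinset.1 hj) hij))
      (fun _ _ => measurableSet_ball)]
    refine lintegral_mono_set (Set.iUnion₂_subset fun i hi => ball_subset_ball' ?_)
    have := mem_closedBall.1 (hTA (hTfin.mem_toFinset.1 hi))
    linarith
  have hlim : Tendsto (fun k : ℕ => ENNReal.ofReal (B * ((2 : ℝ) ^ (-(k : ℤ))) ^ e) * I) atTop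
      (𝓝 0) := by
    have h1 : Tendsto (fun k : ℕ => B * ((2 : ℝ) ^ (-(k : ℤ))) ^ e) atTop (𝓝 (B * 0)) := by
      refine Tendsto.const_mul B ?_
      have hθ : (2 : ℝ) ^ (-e) < 1 := Real.rpow_lt_one_of_one_lt_of_neg one_lt_two (by linarith)
      refine (tendsto_pow_atTop_nhds_zero_of_lt_one (by positivity) hθ).congr fun k => ?_
      have := two_zpow_neg_add_rpow 0 k e
      rw [zero_add, neg_zero, zpow_zero, Real.one_rpow, one_mul] at this
      exact this.symm
    have h2 := ENNReal.Tendsto.mul_const (ENNReal.tendsto_ofReal h1)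
      (Or.inr (hH (R + 1)) : ENNReal.ofReal (B * 0) ≠ 0 ∨ I ≠ ∞)
    rwa [mul_zero, ENNReal.ofReal_zero, zero_mul] at h2
  have h0 := le_antisymm (ge_of_tendsto' hlim hscale) zero_le
  rw [ENNReal.rpow_eq_zero_iff_of_pos hq0] at h0
  exact enorm_eq_zero.1 h0

/-- A functional that is controlled on test functions at all scales, without cancellation,
vanishes. -/
theorem eq_zero_of_forall_scale [BorelSpace X] (h : BallGrowth μ n D) (x₁ : X)
    {s p : ℝ} (hp : n / (n + s) < p) (hs : 0 < s) (hs1 : s ≤ 1)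
    (Λ : testSpace 𝕜 μ x₁ 1 1 2 →ₗ[𝕜] 𝕜) {H : X → ℝ≥0∞} (hHm : Measurable H)
    (hH : ∫⁻ x, H x ^ p ∂μ ≠ ∞)
    (hΛ : ∀ᵐ x ∂μ, ∀ (k : ℤ) (φ : testSpace 𝕜 μ x₁ 1 1 2) (C : ℝ), 0 < C →
      IsTestBound μ x ((2 : ℝ) ^ (-k)) 1 2 (φ : X → 𝕜) C →
        ‖Λ φ‖ₑ ≤ ENNReal.ofReal (C * ((2 : ℝ) ^ (-k)) ^ s) * H x) : Λ = 0 := by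
  have hn := h.exponent_pos
  have hp0 : 0 < p := lt_trans (by positivity) hp
  set q := min p 1
  have hq : n / (n + s) < q := lt_min hp ((div_lt_one (by positivity)).2 (by linarith))
  have hq0 : 0 < q := lt_min hp0 one_pos
  have hHq : ∀ R : ℝ, ∫⁻ x in ball x₁ R, H x ^ q ∂μ ≠ ∞ := fun R => by
    have hle : ∀ x, H x ^ q ≤ 1 + H x ^ p := fun x => by
      rcases le_total (H x) 1 with h1 | h1
      · exact (ENNReal.rpow_le_one h1 hq0.le).trans le_self_add
      · exact (ENNReal.rpow_le_rpow_of_exponent_le h1 (min_le_left _ _)).trans le_add_self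
    refine ne_top_of_le_ne_top ?_ (lintegral_mono hle)
    rw [lintegral_add_left measurable_const, setLIntegral_const, one_mul]
    exact ENNReal.add_ne_top.2 ⟨(h.measure_ball_lt_top _ _).ne,
      ne_top_of_le_ne_top hH (setLIntegral_le_lintegral _ _)⟩
  have hHfin : ∀ᵐ x ∂μ, H x ≠ ∞ := by
    filter_upwards [ae_lt_top (hHm.pow_const p) hH] with x hx htop
    rw [htop, ENNReal.top_rpow_of_pos hp0] at hx
    exact hx.ne rfl
  have := h.neBot_ae x₁
  obtain ⟨x, hx, hHx⟩ := (hΛ.and hHfin).exists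
  obtain ⟨K₁, hK₁, hK₁'⟩ := h.exists_isTestBound_tail (𝕜 := 𝕜)
  obtain ⟨K₂, hK₂, hK₂'⟩ := h.isTestBound_transfer (𝕜 := 𝕜) (L := 1) le_rfl
  ext φ
  rw [LinearMap.zero_apply]
  have hφ := (isTestBound_testNorm φ.2).mono zero_le_one (le_add_of_nonneg_right zero_le_one)
  set C : ℝ := testNorm μ x₁ 1 1 2 (φ : X → 𝕜) + 1 with hC
  have hC0 : 0 < C := by
    have := (isTestBound_testNorm φ.2).1
    linarith
  obtain ⟨M, hM, hφM, hφlip⟩ := h.exists_bounded_lipschitz_of_isTestBound hφ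
  have htail : ∀ J : ℕ, dist x₁ x ≤ 2 ^ J → ‖Λ φ‖ₑ ≤
      ENNReal.ofReal (K₂ * (K₁ * C) * (2⁻¹ : ℝ) ^ J) * H x := by
    intro J hJ
    set R : ℝ := (2 : ℝ) ^ J with hR
    have hR0 : 0 < R := by positivity
    have hR1 : 1 ≤ R := one_le_pow₀ one_le_two
    have hmain_b : ∀ y, ‖(φ : X → 𝕜) y * (ballCutoff x₁ R y : 𝕜)‖ ≤ M := fun y => by
      rw [norm_mul, RCLike.norm_ofReal, abs_of_nonneg (ballCutoff_nonneg _ _ _)]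
      exact (mul_le_of_le_one_right (norm_nonneg _) (ballCutoff_le_one _ _ _)).trans (hφM y)
    have hmain_lip : ∀ y z, ‖(φ : X → 𝕜) y * (ballCutoff x₁ R y : 𝕜) -
        (φ : X → 𝕜) z * (ballCutoff x₁ R z : 𝕜)‖ ≤ 5 * M * dist y z := fun y z => by
      have hsplit : (φ : X → 𝕜) y * (ballCutoff x₁ R y : 𝕜) -
          (φ : X → 𝕜) z * (ballCutoff x₁ R z : 𝕜) =
          (φ : X → 𝕜) y * ((ballCutoff x₁ R y - ballCutoff x₁ R z : ℝ) : 𝕜) +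
            ((φ : X → 𝕜) y - (φ : X → 𝕜) z) * (ballCutoff x₁ R z : 𝕜) := by push_cast; ring
      rw [hsplit]
      refine (norm_add_le _ _).trans ?_
      rw [norm_mul, norm_mul, RCLike.norm_ofReal, RCLike.norm_ofReal,
        abs_of_nonneg (ballCutoff_nonneg x₁ R z)]
      calc _ ≤ M * dist y z + 4 * M * dist y z * 1 := by
            have := ballCutoff_nonneg x₁ R z
            gcongr
            · exact hφM y
            · exact (abs_ballCutoff_sub_le x₁ hR0 y z).trans (div_le_self dist_nonneg hR1)
            · exact hφlip y z
            · exact ballCutoff_le_one _ _ _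
        _ = _ := by ring
    have hmain_supp : ∀ y, (φ : X → 𝕜) y * (ballCutoff x₁ R y : 𝕜) ≠ 0 → dist x₁ y ≤ 2 * R :=
      fun y hy => dist_le_of_ballCutoff_ne_zero hR0 fun h0 => hy (by
        rw [h0, RCLike.ofReal_zero, mul_zero])
    have hmain_mem := h.mem_testSpace_of_lipschitz x₁ hmain_supp hmain_b hmain_lip
    have hmain := h.apply_eq_zero_of_bounded_support x₁ hq hs (min_le_right _ _) Λ hHq hΛ
      ⟨_, hmain_mem⟩ (by positivity) hM (by positivity) hmain_supp hmain_b hmain_lip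
    have htb := hK₁' x₁ R φ C hR1 hφ
    have htail_mem := h.mem_testSpace_of_isTestBound x₁ hR0 htb
    have hsum : φ = ⟨_, hmain_mem⟩ + ⟨_, htail_mem⟩ := by
      refine Subtype.ext (funext fun y => ?_)
      change (φ : X → 𝕜) y = (φ : X → 𝕜) y * (ballCutoff x₁ R y : 𝕜) +
        (φ : X → 𝕜) y * ((1 - ballCutoff x₁ R y : ℝ) : 𝕜)
      push_cast; ring
    have hRk : (2 : ℝ) ^ (-(-(J : ℤ))) = R := by rw [neg_neg, zpow_natCast]
    have hb := hx (-(J : ℤ)) ⟨_, htail_mem⟩ (K₂ * (K₁ * (C / R ^ 2))) (by positivity) (by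
      rw [hRk]
      exact hK₂' x₁ x R R _ _ hR0 hR0 (by rw [one_mul]; exact hJ) (one_mul R).ge (one_mul R).ge htb)
    rw [hsum, map_add, hmain, zero_add]
    refine hb.trans (mul_le_mul' (ENNReal.ofReal_le_ofReal ?_) le_rfl)
    rw [hRk, inv_pow, ← hR]
    calc K₂ * (K₁ * (C / R ^ 2)) * R ^ s ≤ K₂ * (K₁ * (C / R ^ 2)) * R := by
          gcongr
          exact (Real.rpow_le_rpow_of_exponent_le hR1 hs1).trans_eq (Real.rpow_one R)
      _ = _ := by field_simp
  have hlim : Tendsto (fun J : ℕ => ENNReal.ofReal (K₂ * (K₁ * C) * (2⁻¹ : ℝ) ^ J) * H x) atTop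
      (𝓝 0) := by
    have h1 := (tendsto_pow_atTop_nhds_zero_of_lt_one (r := (2 : ℝ)⁻¹) (by norm_num)
      (by norm_num)).const_mul (K₂ * (K₁ * C))
    have h2 := ENNReal.Tendsto.mul_const (ENNReal.tendsto_ofReal h1)
      (Or.inr hHx : ENNReal.ofReal (K₂ * (K₁ * C) * 0) ≠ 0 ∨ H x ≠ ∞)
    rwa [mul_zero, ENNReal.ofReal_zero, zero_mul] at h2
  have hev : ∀ᶠ J : ℕ in atTop, ‖Λ φ‖ₑ ≤
      ENNReal.ofReal (K₂ * (K₁ * C) * (2⁻¹ : ℝ) ^ J) * H x := by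
    filter_upwards [(tendsto_pow_atTop_atTop_of_one_lt (one_lt_two (α := ℝ))).eventually_ge_atTop
      (dist x₁ x)] with J hJ using htail J hJ
  exact enorm_eq_zero.1 (le_antisymm (ge_of_tendsto hlim hev) zero_le)

end BallGrowth

end

section

variable {X : Type*} [MetricSpace X] [MeasurableSpace X] {𝕜 : Type*} [RCLike 𝕜]
  {μ : Measure X} {n D : ℝ}

namespace BallGrowth

theorem lintegral_grandMajorant_ne_top [BorelSpace X] (h : BallGrowth μ n D) (x₁ : X) {s p : ℝ}
    (hp : 0 < p) {Λ : testSpace 𝕜 μ x₁ 1 1 2 →ₗ[𝕜] 𝕜} (hΛ : grandNorm μ x₁ s p Λ ≠ ∞) :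
    ∫⁻ x, grandMajorant μ x₁ s Λ x ^ p ∂μ ≠ ∞ := by
  obtain ⟨K, hK, hK'⟩ := h.exists_grandMajorant_le (𝕜 := 𝕜) x₁ s
  rw [grandNorm_eq_lintegral hp] at hΛ
  have hfin : ∫⁻ x, grandFunction μ x₁ s Λ x ^ p ∂μ ≠ ∞ := fun htop => hΛ (by
    rw [htop, ENNReal.top_rpow_of_pos (by positivity)])
  refine ne_top_of_le_ne_top (ENNReal.mul_ne_top (ENNReal.ofReal_ne_top (r := K ^ p)) hfin) ?_
  rw [← lintegral_const_mul' _ _ ENNReal.ofReal_ne_top]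
  refine lintegral_mono fun x => ?_
  rw [← ENNReal.ofReal_rpow_of_nonneg hK.le hp.le, ← ENNReal.mul_rpow_of_nonneg _ _ hp.le]
  exact ENNReal.rpow_le_rpow (hK' Λ x) hp.le

theorem ae_grandFunction_ne_top [BorelSpace X] (h : BallGrowth μ n D) (x₁ : X) {s p : ℝ}
    (hp : 0 < p) {Λ : testSpace 𝕜 μ x₁ 1 1 2 →ₗ[𝕜] 𝕜} (hΛ : grandNorm μ x₁ s p Λ ≠ ∞) :
    ∀ᵐ x ∂μ, grandFunction μ x₁ s Λ x ≠ ∞ := by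
  filter_upwards [ae_lt_top ((measurable_grandMajorant μ x₁ s Λ).pow_const p)
    (h.lintegral_grandMajorant_ne_top x₁ hp hΛ)] with x hx
  refine ne_top_of_le_ne_top (fun htop => ?_) (grandFunction_le_grandMajorant μ x₁ s Λ x)
  rw [htop, ENNReal.top_rpow_of_pos hp] at hx
  exact hx.ne rfl

/-- Two functionals with finite grand norm whose averages at small scales have the same limits
almost everywhere are controlled, without cancellation, by their grand functions. -/
theorem exists_enorm_sub_le_of_tendsto [BorelSpace X] (h : BallGrowth μ n D) (x₁ : X) {s : ℝ}
    (hs : 0 < s) : ∃ K : ℝ, 0 < K ∧ ∀ (Λ Λ' : testSpace 𝕜 μ x₁ 1 1 2 →ₗ[𝕜] 𝕜) (x : X) (a : 𝕜),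
      grandFunction μ x₁ s Λ x ≠ ∞ → grandFunction μ x₁ s Λ' x ≠ ∞ →
      Tendsto (fun k : ℤ => Λ (h.kernel 𝕜 x₁ x k)) atTop (𝓝 a) →
      Tendsto (fun k : ℤ => Λ' (h.kernel 𝕜 x₁ x k)) atTop (𝓝 a) →
      ∀ (k : ℤ) (φ : testSpace 𝕜 μ x₁ 1 1 2) (C : ℝ), 0 < C →
        IsTestBound μ x ((2 : ℝ) ^ (-k)) 1 2 (φ : X → 𝕜) C → ‖(Λ - Λ') φ‖ₑ ≤
          ENNReal.ofReal (C * ((2 : ℝ) ^ (-k)) ^ s) * (ENNReal.ofReal K *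
            (grandFunction μ x₁ s Λ x + grandFunction μ x₁ s Λ' x)) := by
  obtain ⟨K₀, hK₀, hK₀'⟩ := h.isTestBound_ballKernel (𝕜 := 𝕜)
  obtain ⟨K₁, hK₁, hK₁'⟩ := h.norm_integral_testFunction_le (𝕜 := 𝕜)
  obtain ⟨K₂, hK₂, hK₂'⟩ := h.exists_norm_kernel_sub_limit_le (𝕜 := 𝕜) x₁ hs
  refine ⟨1 + K₁ * K₀ + K₁ * K₂, by positivity, fun Λ Λ' x a hG hG' ha ha' k φ C hC hφ => ?_⟩
  set r : ℝ := (2 : ℝ) ^ (-k) with hr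
  have hr0 : 0 < r := by positivity
  set c : 𝕜 := ∫ y, (φ : X → 𝕜) y ∂μ with hc
  have hcn : ‖c‖ ≤ K₁ * C := hK₁' x r φ C hr0 hφ
  set κ := h.kernel 𝕜 x₁ x k with hκ
  have hκb : IsTestBound μ x r 1 2 (κ : X → 𝕜) K₀ := hK₀' x r hr0
  have hψb : IsTestBound μ x r 1 2 ((φ - c • κ : testSpace 𝕜 μ x₁ 1 1 2) : X → 𝕜)
      (C * (1 + K₁ * K₀)) := by
    refine (hφ.sub (hκb.smul c)).mono hr0.le ?_
    have : ‖c‖ * K₀ ≤ K₁ * C * K₀ := by gcongr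
    linarith
  have hψint : ∫ y, ((φ - c • κ : testSpace 𝕜 μ x₁ 1 1 2) : X → 𝕜) y ∂μ = 0 := by
    change ∫ y, ((φ : X → 𝕜) y - c * ballKernel 𝕜 μ x r y) ∂μ = 0
    have hki : Integrable (ballKernel 𝕜 μ x r) μ := h.integrable_testFunction hr0 hκb
    rw [integral_sub (h.integrable_testFunction hr0 hφ) (hki.const_mul c), integral_const_mul,
      h.integral_ballKernel x hr0, mul_one, sub_self]
  have hcan : ∀ Λ : testSpace 𝕜 μ x₁ 1 1 2 →ₗ[𝕜] 𝕜, ‖Λ (φ - c • κ)‖ₑ ≤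
      ENNReal.ofReal (C * (1 + K₁ * K₀) * r ^ s) * grandFunction μ x₁ s Λ x := fun Λ =>
    enorm_le_grandFunction Λ (by positivity) hψint hψb
  have hker : ∀ Λ : testSpace 𝕜 μ x₁ 1 1 2 →ₗ[𝕜] 𝕜, grandFunction μ x₁ s Λ x ≠ ∞ →
      Tendsto (fun k : ℤ => Λ (h.kernel 𝕜 x₁ x k)) atTop (𝓝 a) →
      ‖c * (Λ κ - a)‖ₑ ≤ ENNReal.ofReal (K₁ * C * (K₂ * r ^ s)) * grandFunction μ x₁ s Λ x :=
    fun Λ hG ha => by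
      rw [← ofReal_norm, norm_mul, ← ENNReal.ofReal_toReal hG,
        ← ENNReal.ofReal_mul (by positivity)]
      refine ENNReal.ofReal_le_ofReal ?_
      rw [mul_assoc (K₁ * C)]
      gcongr
      exact hK₂' Λ x a k hG ha
  have hsplit : (Λ - Λ') φ = (Λ (φ - c • κ) + c * (Λ κ - a)) -
      (Λ' (φ - c • κ) + c * (Λ' κ - a)) := by
    simp only [LinearMap.sub_apply, map_sub, map_smul, smul_eq_mul]
    ring
  set G := grandFunction μ x₁ s Λ x
  set G' := grandFunction μ x₁ s Λ' x
  calc ‖(Λ - Λ') φ‖ₑ ≤ (‖Λ (φ - c • κ)‖ₑ + ‖c * (Λ κ - a)‖ₑ) +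
        (‖Λ' (φ - c • κ)‖ₑ + ‖c * (Λ' κ - a)‖ₑ) := by
        rw [hsplit]
        exact (enorm_sub_le).trans (add_le_add (enorm_add_le _ _) (enorm_add_le _ _))
    _ ≤ (ENNReal.ofReal (C * (1 + K₁ * K₀) * r ^ s) * G +
          ENNReal.ofReal (K₁ * C * (K₂ * r ^ s)) * G) +
        (ENNReal.ofReal (C * (1 + K₁ * K₀) * r ^ s) * G' +
          ENNReal.ofReal (K₁ * C * (K₂ * r ^ s)) * G') :=
        add_le_add (add_le_add (hcan Λ) (hker Λ hG ha)) (add_le_add (hcan Λ') (hker Λ' hG' ha'))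
    _ = _ := by
        rw [← add_mul, ← add_mul, ← mul_add, ← ENNReal.ofReal_add (by positivity) (by positivity),
          ← mul_assoc (ENNReal.ofReal (C * r ^ s)), ← ENNReal.ofReal_mul (by positivity)]
        congr 2; ring

/-- A functional with finite grand norm is determined by the limits of its averages. -/
theorem eq_of_tendsto_kernel [BorelSpace X] (h : BallGrowth μ n D) (x₁ : X) {s p : ℝ}
    (hp : n / (n + s) < p) (hs : 0 < s) (hs1 : s ≤ 1)
    {Λ Λ' : testSpace 𝕜 μ x₁ 1 1 2 →ₗ[𝕜] 𝕜} (hΛ : grandNorm μ x₁ s p Λ ≠ ∞)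
    (hΛ' : grandNorm μ x₁ s p Λ' ≠ ∞) {f : X → 𝕜}
    (hf : ∀ᵐ x ∂μ, Tendsto (fun k : ℤ => Λ (h.kernel 𝕜 x₁ x k)) atTop (𝓝 (f x)))
    (hf' : ∀ᵐ x ∂μ, Tendsto (fun k : ℤ => Λ' (h.kernel 𝕜 x₁ x k)) atTop (𝓝 (f x))) :
    Λ = Λ' := by
  have hn := h.exponent_pos
  have hp0 : 0 < p := lt_trans (by positivity) hp
  obtain ⟨K, hK, hK'⟩ := h.exists_enorm_sub_le_of_tendsto (𝕜 := 𝕜) x₁ hs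
  set M := grandMajorant μ x₁ s Λ
  set M' := grandMajorant μ x₁ s Λ'
  have hM : Measurable M := measurable_grandMajorant μ x₁ s Λ
  have hM' : Measurable M' := measurable_grandMajorant μ x₁ s Λ'
  have hfin : ∫⁻ x, (ENNReal.ofReal (K * 2) * max (M x) (M' x)) ^ p ∂μ ≠ ∞ := by
    have hle : ∀ x, (ENNReal.ofReal (K * 2) * max (M x) (M' x)) ^ p ≤
        ENNReal.ofReal ((K * 2) ^ p) * (M x ^ p + M' x ^ p) := fun x => by
      rw [ENNReal.mul_rpow_of_nonneg _ _ hp0.le,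
        ENNReal.ofReal_rpow_of_nonneg (by positivity) hp0.le]
      gcongr
      rcases le_total (M x) (M' x) with hle | hle
      · rw [max_eq_right hle]; exact le_add_self
      · rw [max_eq_left hle]; exact le_self_add
    refine ne_top_of_le_ne_top ?_ (lintegral_mono hle)
    rw [lintegral_const_mul' _ _ ENNReal.ofReal_ne_top, lintegral_add_left (hM.pow_const p)]
    exact ENNReal.mul_ne_top ENNReal.ofReal_ne_top (ENNReal.add_ne_top.2
      ⟨h.lintegral_grandMajorant_ne_top x₁ hp0 hΛ, h.lintegral_grandMajorant_ne_top x₁ hp0 hΛ'⟩)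
  refine sub_eq_zero.1 (h.eq_zero_of_forall_scale x₁ hp hs hs1 (Λ - Λ')
    ((hM.max hM').const_mul _) hfin ?_)
  filter_upwards [hf, hf', h.ae_grandFunction_ne_top x₁ hp0 hΛ,
    h.ae_grandFunction_ne_top x₁ hp0 hΛ'] with x hx hx' hG hG' k φ C hC hφ
  refine (hK' Λ Λ' x (f x) hG hG' hx hx' k φ C hC hφ).trans (mul_le_mul' le_rfl ?_)
  rw [ENNReal.ofReal_mul hK.le, mul_assoc, ENNReal.ofReal_ofNat, two_mul]
  gcongr
  · exact (grandFunction_le_grandMajorant μ x₁ s Λ x).trans (le_max_left _ _)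
  · exact (grandFunction_le_grandMajorant μ x₁ s Λ' x).trans (le_max_right _ _)

/-- Every functional with finite grand norm is induced by a function in `Ṁ^{s,p}`. -/
theorem exists_memHajlasz [BorelSpace X] (h : BallGrowth μ n D) (x₁ : X) {s p : ℝ}
    (hp : n / (n + s) < p) (hs : 0 < s) (hs1 : s ≤ 1)
    {Λ : testSpace 𝕜 μ x₁ 1 1 2 →ₗ[𝕜] 𝕜} (hΛ : grandNorm μ x₁ s p Λ ≠ ∞) :
    ∃ f : X → 𝕜, Represents μ x₁ f Λ ∧ MemHajlasz μ s p f := by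
  have := h.secondCountableTopology x₁
  have hn := h.exponent_pos
  have hp0 : 0 < p := lt_trans (by positivity) hp
  set f : X → 𝕜 := fun x => limUnder atTop fun k : ℤ => Λ (h.kernel 𝕜 x₁ x k) with hfdef
  have hf : ∀ᵐ x ∂μ, Tendsto (fun k : ℤ => Λ (h.kernel 𝕜 x₁ x k)) atTop (𝓝 (f x)) := by
    filter_upwards [h.ae_grandFunction_ne_top x₁ hp0 hΛ] with x hx
    exact tendsto_nhds_limUnder (h.exists_tendsto_kernel x₁ hs Λ hx)
  obtain ⟨K, hK, hK'⟩ := h.exists_gradient_of_tendsto (𝕜 := 𝕜) x₁ hs hp0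
  obtain ⟨g, hg, hgle⟩ := hK' Λ f hΛ hf
  have hgfin := ne_top_of_le_ne_top (ENNReal.mul_ne_top ENNReal.ofReal_ne_top hΛ) hgle
  have hfm : AEStronglyMeasurable f μ := aestronglyMeasurable_of_mem_hajlaszGradients hs hg
  have hgp : MemLp g (ENNReal.ofReal p) μ := ⟨hg.1.aestronglyMeasurable, hgfin.lt_top⟩
  obtain ⟨Λf, hΛf, hmem⟩ := h.exists_represents x₁ hs hs1 hp hfm hg hgfin
  have heq : Λ = Λf := h.eq_of_tendsto_kernel x₁ hp hs hs1 hΛ hmem.2.ne hf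
    (h.ae_tendsto_kernel_of_represents hΛf)
  refine ⟨f, heq ▸ hΛf, hfm, h.memLp_ball_of_mem_hajlaszGradients x₁ hs hg hgp, g, hg, hgp⟩

theorem hajlaszNorm_le_grandNorm [BorelSpace X] (h : BallGrowth μ n D) (x₁ : X) {s p : ℝ}
    (hs : 0 < s) (hp : 0 < p) : ∃ K : ℝ, 0 < K ∧ ∀ (f : X → 𝕜)
      (Λ : testSpace 𝕜 μ x₁ 1 1 2 →ₗ[𝕜] 𝕜), Represents μ x₁ f Λ →
        hajlaszNorm μ s p f ≤ ENNReal.ofReal K * grandNorm μ x₁ s p Λ := by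
  obtain ⟨K, hK, hK'⟩ := h.exists_gradient_of_tendsto (𝕜 := 𝕜) x₁ hs hp
  refine ⟨K, hK, fun f Λ hΛ => ?_⟩
  by_cases htop : grandNorm μ x₁ s p Λ = ∞
  · rw [htop, ENNReal.mul_top (by simpa using hK)]; exact le_top
  obtain ⟨g, hg, hgle⟩ := hK' Λ f htop (h.ae_tendsto_kernel_of_represents hΛ)
  exact (iInf₂_le g hg).trans hgle

/-- Test functions separate functions up to null sets. -/
theorem ae_eq_zero_of_forall_testFunction [BorelSpace X] (h : BallGrowth μ n D) (x₁ : X)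
    {u : X → 𝕜} (hu : ∀ φ : testSpace 𝕜 μ x₁ 1 1 2,
      Integrable (fun x => u x * (φ : X → 𝕜) x) μ ∧ ∫ x, u x * (φ : X → 𝕜) x ∂μ = 0) :
    ∀ᵐ x ∂μ, u x = 0 := by
  have := h.secondCountableTopology x₁
  have hloc : ∀ N : ℕ, ∀ᵐ x ∂μ, u x * (ballCutoff x₁ (N + 1) x : 𝕜) = 0 := by
    intro N
    have hN : (0 : ℝ) < N + 1 := by positivity
    have hmem : ∀ (b : ℝ) (w : X → ℝ), (∀ y, 0 ≤ w y) → (∀ y, w y ≤ 1) →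
        (∀ y z, |w y - w z| ≤ b * dist y z) →
        (fun y => ((ballCutoff x₁ (N + 1) y * w y : ℝ) : 𝕜)) ∈ testSpace 𝕜 μ x₁ 1 1 2 := by
      intro b w hw0 hw1 hwlip
      refine h.mem_testSpace_of_lipschitz x₁ (R := 2 * (N + 1)) (a := 1)
        (b := 1 / (N + 1) + b) (fun y hy => ?_) (fun y => ?_) fun y z => ?_
      · refine dist_le_of_ballCutoff_ne_zero hN fun h0 => hy ?_
        rw [h0, zero_mul, RCLike.ofReal_zero]
      · rw [RCLike.norm_ofReal, abs_of_nonneg (mul_nonneg (ballCutoff_nonneg _ _ _) (hw0 y))]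
        exact mul_le_one₀ (ballCutoff_le_one _ _ _) (hw0 y) (hw1 y)
      · rw [← RCLike.ofReal_sub, RCLike.norm_ofReal]
        have hsplit : ballCutoff x₁ (N + 1) y * w y - ballCutoff x₁ (N + 1) z * w z =
            (ballCutoff x₁ (N + 1) y - ballCutoff x₁ (N + 1) z) * w y +
              ballCutoff x₁ (N + 1) z * (w y - w z) := by ring
        rw [hsplit]
        refine (abs_add_le _ _).trans ?_
        rw [abs_mul, abs_mul, abs_of_nonneg (hw0 y), abs_of_nonneg (ballCutoff_nonneg _ _ z)]
        calc _ ≤ dist y z / (N + 1) * 1 + 1 * (b * dist y z) := by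
              have := hw0 y
              have := (abs_nonneg _).trans (hwlip y z)
              gcongr
              · exact abs_ballCutoff_sub_le x₁ hN y z
              · exact hw1 y
              · exact ballCutoff_le_one _ _ _
              · exact hwlip y z
          _ = _ := by ring
    have hone := hmem 0 (fun _ => 1) (fun _ => zero_le_one) (fun _ => le_rfl) (by simp)
    have hint : Integrable (fun x => u x * (ballCutoff x₁ (N + 1) x : 𝕜)) μ := by
      have := (hu ⟨_, hone⟩).1
      simpa only [mul_one] using this
    refine ae_eq_zero_of_forall_setIntegral_isClosed_eq_zero hint fun F hF => ?_
    rcases F.eq_empty_or_nonempty with rfl | hFne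
    · simp
    set w : ℕ → X → ℝ := fun j y => max 0 (1 - (j + 1) * infDist y F) with hw
    have hw0 : ∀ j y, 0 ≤ w j y := fun j y => le_max_left _ _
    have hw1 : ∀ j y, w j y ≤ 1 := fun j y => max_le zero_le_one (by
      have : 0 ≤ (j + 1) * infDist y F := mul_nonneg (by positivity) infDist_nonneg
      linarith)
    have hwlip : ∀ j y z, |w j y - w j z| ≤ (j + 1) * dist y z := fun j y z => by
      refine (abs_max_sub_max_le_max _ _ _ _).trans (max_le (by simp; positivity) ?_)
      rw [sub_sub_sub_cancel_left, ← mul_sub, abs_mul, abs_of_nonneg (by positivity)]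
      gcongr
      rw [dist_comm]
      have := (lipschitz_infDist_pt F).dist_le_mul z y
      rwa [NNReal.coe_one, one_mul, Real.dist_eq] at this
    have hzero : ∀ j, ∫ x, u x * (ballCutoff x₁ (N + 1) x : 𝕜) * (w j x : 𝕜) ∂μ = 0 := fun j => by
      have := (hu ⟨_, hmem (j + 1) (w j) (hw0 j) (hw1 j) (hwlip j)⟩).2
      simpa only [RCLike.ofReal_mul, mul_assoc] using this
    have hlim := tendsto_integral_of_dominated_convergence (μ := μ)
      (F := fun j x => u x * (ballCutoff x₁ (N + 1) x : 𝕜) * (w j x : 𝕜))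
      (f := F.indicator fun x => u x * (ballCutoff x₁ (N + 1) x : 𝕜))
      (fun x => ‖u x * (ballCutoff x₁ (N + 1) x : 𝕜)‖)
      (fun j => hint.1.mul (RCLike.continuous_ofReal.comp (by
        rw [hw]; fun_prop)).aestronglyMeasurable) hint.norm
      (fun j => ae_of_all _ fun x => by
        rw [norm_mul _ (w j x : 𝕜), RCLike.norm_ofReal, abs_of_nonneg (hw0 j x)]
        exact mul_le_of_le_one_right (norm_nonneg _) (hw1 j x))
      (ae_of_all _ fun x => by
        by_cases hx : x ∈ F
        · rw [Set.indicator_of_mem hx]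
          refine tendsto_const_nhds.congr fun j => ?_
          have : w j x = 1 := by
            rw [hw]; simp only [infDist_zero_of_mem hx, mul_zero, sub_zero]
            exact max_eq_right zero_le_one
          rw [this, RCLike.ofReal_one, mul_one]
        · rw [Set.indicator_of_notMem hx]
          have hpos := (hF.notMem_iff_infDist_pos hFne).1 hx
          obtain ⟨j₀, hj₀⟩ := exists_nat_ge (1 / infDist x F)
          refine tendsto_const_nhds.congr' ?_
          filter_upwards [eventually_ge_atTop j₀] with j hj
          have : w j x = 0 := by
            refine max_eq_left (sub_nonpos.2 ?_)
            rw [div_le_iff₀ hpos] at hj₀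
            have : (j₀ : ℝ) ≤ j := by exact_mod_cast hj
            nlinarith
          rw [this, RCLike.ofReal_zero, mul_zero])
    simp only [hzero] at hlim
    rw [integral_indicator hF.measurableSet] at hlim
    exact (tendsto_nhds_unique hlim tendsto_const_nhds)
  filter_upwards [ae_all_iff.2 hloc] with x hx
  obtain ⟨N, hN⟩ := exists_nat_ge (dist x₁ x)
  have := hx N
  rwa [ballCutoff_eq_one (by positivity) (by linarith), RCLike.ofReal_one, mul_one] at this

/-- The correspondence between functions and functionals is one-to-one up to null sets, and
compatible with constants. -/
theorem represents_sub_eq_const_iff [BorelSpace X] (h : BallGrowth μ n D) {x₁ : X}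
    {f f' : X → 𝕜} {Λ Λ' : testSpace 𝕜 μ x₁ 1 1 2 →ₗ[𝕜] 𝕜} (hΛ : Represents μ x₁ f Λ)
    (hΛ' : Represents μ x₁ f' Λ') (c : 𝕜) :
    (∀ φ : testSpace 𝕜 μ x₁ 1 1 2, Λ φ - Λ' φ = c * ∫ x, (φ : X → 𝕜) x ∂μ) ↔
      ∀ᵐ x ∂μ, f x - f' x = c := by
  constructor
  · intro heq
    have hφi : ∀ φ : testSpace 𝕜 μ x₁ 1 1 2, Integrable (φ : X → 𝕜) μ := fun φ =>
      h.integrable_testFunction one_pos (isTestBound_testNorm φ.2)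
    have := h.ae_eq_zero_of_forall_testFunction x₁ (u := fun x => f x - f' x - c) fun φ => by
      simp only [sub_mul]
      refine ⟨((hΛ φ).1.sub (hΛ' φ).1).sub ((hφi φ).const_mul c), ?_⟩
      rw [integral_sub (f := fun x => f x * (φ : X → 𝕜) x - f' x * (φ : X → 𝕜) x)
        ((hΛ φ).1.sub (hΛ' φ).1) ((hφi φ).const_mul c), integral_sub (hΛ φ).1 (hΛ' φ).1,
        integral_const_mul, ← (hΛ φ).2, ← (hΛ' φ).2, heq φ, sub_self]
    filter_upwards [this] with x hx using sub_eq_zero.1 hx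
  · intro hae φ
    rw [(hΛ φ).2, (hΛ' φ).2, ← integral_sub (hΛ φ).1 (hΛ' φ).1, ← integral_const_mul]
    refine integral_congr_ae ?_
    filter_upwards [hae] with x hx
    rw [← sub_mul, hx]

end BallGrowth

end

end

/-- On an RD-space of infinite measure, `Ṁ^{s,p} = 𝒜Ḟ^s_{p,∞}` with equivalent norms, for
`0 < s ≤ 1` and `n/(n+s) < p < ∞`, where a function is identified with the functional it induces
on `𝒢(1,2)`. Functions and functionals correspond to each other bijectively, and also modulo
constants (the constant `c` acts as `φ ↦ c ∫ φ`). -/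
theorem theorem1p3 {X : Type*} [MetricSpace X] [MeasurableSpace X] [BorelSpace X]
    {𝕜 : Type*} [RCLike 𝕜] (μ : Measure X) (κ n : ℝ) (hX : IsRDSpace μ κ n)
    (hμ : μ Set.univ = ∞) (x₁ : X) (s p : ℝ) (hs₀ : 0 < s) (hs₁ : s ≤ 1)
    (hp : n / (n + s) < p) :
    -- each element of either space corresponds to an element of the other
    (∀ f : X → 𝕜, MemHajlasz μ s p f →
      ∃ Λ : testSpace 𝕜 μ x₁ 1 1 2 →ₗ[𝕜] 𝕜, Represents μ x₁ f Λ ∧ MemGrand μ x₁ s p Λ) ∧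
    (∀ Λ : testSpace 𝕜 μ x₁ 1 1 2 →ₗ[𝕜] 𝕜, MemGrand μ x₁ s p Λ →
      ∃ f : X → 𝕜, Represents μ x₁ f Λ ∧ MemHajlasz μ s p f) ∧
    -- the correspondence is one-to-one up to null sets, and compatible with constants
    (∀ (f f' : X → 𝕜) (Λ Λ' : testSpace 𝕜 μ x₁ 1 1 2 →ₗ[𝕜] 𝕜),
      Represents μ x₁ f Λ → Represents μ x₁ f' Λ' → ∀ c : 𝕜,
        ((∀ φ : testSpace 𝕜 μ x₁ 1 1 2, Λ φ - Λ' φ = c * ∫ x, (φ : X → 𝕜) x ∂μ) ↔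
          ∀ᵐ x ∂μ, f x - f' x = c)) ∧
    -- the norms are equivalent
    ∃ C : ℝ, 0 < C ∧ ∀ (f : X → 𝕜) (Λ : testSpace 𝕜 μ x₁ 1 1 2 →ₗ[𝕜] 𝕜),
      Represents μ x₁ f Λ → MemHajlasz μ s p f →
        grandNorm μ x₁ s p Λ ≤ ENNReal.ofReal C * hajlaszNorm μ s p f ∧
        hajlaszNorm μ s p f ≤ ENNReal.ofReal C * grandNorm μ x₁ s p Λ := by
  obtain ⟨D, h⟩ := hX.exists_ballGrowth hμ x₁
  have hn : 0 < n := h.exponent_pos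
  have hp0 : 0 < p := lt_trans (by positivity) hp
  refine ⟨fun f hf => ?_, fun Λ hΛ => h.exists_memHajlasz x₁ hp hs₀ hs₁ hΛ.2.ne,
    fun f f' Λ Λ' hΛ hΛ' c => h.represents_sub_eq_const_iff hΛ hΛ' c, ?_⟩
  · obtain ⟨hfm, -, g, hg, hgp⟩ := hf
    exact h.exists_represents x₁ hs₀ hs₁ hp hfm hg hgp.2.ne
  · obtain ⟨K₁, hK₁, hK₁'⟩ := h.grandNorm_le_hajlaszNorm (𝕜 := 𝕜) x₁ hs₀ hs₁ hp
    obtain ⟨K₂, hK₂, hK₂'⟩ := h.hajlaszNorm_le_grandNorm (𝕜 := 𝕜) x₁ hs₀ hp0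
    refine ⟨max K₁ K₂, lt_max_of_lt_left hK₁, fun f Λ hΛ _ => ⟨(hK₁' f Λ hΛ).trans ?_,
      (hK₂' f Λ hΛ).trans ?_⟩⟩
    · gcongr; exact le_max_left _ _
    · gcongr; exact le_max_right _ _
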